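/- Let $n\in\{3,4,5,6\}$, $T=\mathbb R^n$, $$E=T\oplus\textstyle\bigwedge^2T^*\oplus\bigwedge^5T^*,\qquad N=T^*\oplus\bigwedge^4T^*\oplus(T^*\otimes\bigwedge^6T^*),$$ and let $(\cdot\otimes\cdot)_N\colon S^2E\to N$ be the map with $(u\otimes u)_N=2\iota_X\sigma_2+(2\iota_X\sigma_5-\sigma_2\wedge\sigma_2)+2\,j\sigma_2\wedge\sigma_5$ for $u=X+\sigma_2+\sigma_5$, where $(j\sigma_2\wedge\sigma_5)(Y)=(\iota_Y\sigma_2)\wedge\sigma_5$. Let $(\cdot\otimes\cdot)_{N^*}\colon S^2E^*\to N^*$ be given by the same formula with $T$ and $T^*$ exchanged, and let $E^*\otimes N\to E$, $\xi\otimes\nu\mapsto(\xi\otimes\nu)_E$, be determined by $\langle\eta,(\xi\otimes\nu)_E\rangle=\langle(\xi\otimes\eta)_{N^*},\nu\rangle$. Let $\pi\colon\operatorname{End}E\to\operatorname{End}E$ be the linear map with $\pi(\xi\otimes u)v=\langle\xi,v\rangle u-(\xi\otimes(u\otimes v)_N)_E$. Let $\mathfrak g\subset\operatorname{End}E$ be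 the Lie algebra $\mathfrak e_{n(n)}\oplus\mathbb R=\mathbb R\oplus\mathfrak{gl}(T)\oplus\bigwedge^3T^*\oplus\bigwedge^6T^*\oplus\bigwedge^3T\oplus\bigwedge^6T$ of $\mathsf G=\mathsf E_{n(n)}\times\mathbb R^+$, where $\mathbb R$ acts with weight $1$, $\mathfrak{gl}(T)$ acts naturally, $w_3\cdot u=\iota_{w_3}(\sigma_2+\sigma_5)$, $w_6\cdot u=-\iota_{w_6}\sigma_5$, $a_3\cdot u=\iota_Xa_3+a_3\wedge\sigma_2$, $a_6\cdot u=\iota_Xa_6$. An *elgebroid* with underlying bundle $M\times E\to M$ (with the product $\mathsf G$-structure) consists of an $\mathbb R$-bilinear bracket on $\Gamma(E)=C^\infty(M,E)$, a smooth vector bundle map $\rho\colon M\times E\to TM$ and an $\mathbb R$-linear map $\mathcal D\colon C^\infty(M,N)\to C^\infty(M,E)$ such that, for all sections $u,v,w$ of $E$, $\nu$ of $N$ and $f\in C^\infty(M)$, $$[u,[v,w]]=[[u,v],w]+[v,[u,w]],\qquad [u,fv]=f[u,v]+(\rho(u)f)v,$$ $$[u,v]+[v,u]=\mathcal D(u\otimes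 v)_N,\qquad \mathcal D(f\nu)=f\mathcal D\nu+(\hat df\otimes\nu)_E,$$ where $\hat d=\rho^t\circ d$, and $[u,\cdot]$ preserves the $\mathsf G$-structure (the endomorphism $v\mapsto[u,v](p)$, $v$ constant, lies in $\mathfrak g$ for every $p\in M$). It is *M-exact* if $\dim M=n$ and the sequence $T^*M\otimes N\to E\to TM\to0$, with first map $\alpha\otimes\nu\mapsto(\rho^t\alpha\otimes\nu)_E$ and second map $\rho$, is exact at $E$ and at $TM$. An *elgebra* is an elgebroid over a point. An *action* of an elgebra $E$ on a manifold $M'$ is a linear map $\chi\colon E\to\Gamma(TM')$ preserving brackets; it is *transitive* if $\chi_p\colon E\to T_pM'$ is surjective for all $p\in M'$, and $\operatorname{Ker}\chi_p$ is the *stabiliser* at $p$. A subspace $V\subset E$ is *coisotropic* if $(V^\circ\otimes V^\circ)_{N^*}=0$, and *co-Lagrangian* if it is minimal among coisotropic subspaces. An elgebroid on $M'\times E$ is a *pullback* of the elgebra $E$ if its bracket and its $\mathcal D$ agree with those of the elgebra on constant sections. **Theorem.** Let $\chi$ be a transitive action of an elgebra $E$ (for the given $n$) on an $n$-dimensional smooth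 manifold $M'$. There is an M-exact elgebroid on $E'=M'\times E$ which is a pullback of $E$ and has anchor $\chi$ if and only if at every point $p\in M'$ the stabiliser is co-Lagrangian of codimension $n$. Moreover, any pullback elgebroid on $E'$ with anchor $\chi$ is given by $$[u,v]'=[u,v]+\chi(u)v-\pi(\hat du)v,\qquad \mathcal D'\nu=\mathcal D\nu+(\hat d\nu)_E$$ for $u,v\in C^\infty(M',E)$, $\nu\in C^\infty(M',N)$, where $[u,v]$ and $\mathcal D\nu$ are computed pointwise in the elgebra; in particular it is unique. -/

import Mathlib

open scoped Manifold ContDiff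

noncomputable section

namespace Elg

/-! ### Exterior algebra in coordinates

`T = ℝⁿ`. The strictly increasing index sets `S = {s₁ < ⋯ < s_k} ⊆ {0, …, n-1}` index the standard
bases `e_{s₁} ∧ ⋯ ∧ e_{s_k}` of `⋀ᵏ T` and `e^{s₁} ∧ ⋯ ∧ e^{s_k}` of `⋀ᵏ T*`. -/

/-- The index set of the standard bases of `⋀ᵏ T` and of `⋀ᵏ T*`, for `T = ℝⁿ`. -/
abbrev Idx (n k : ℕ) : Type := Set.powersetCard (Fin n) k

/-- Coordinates, in the standard basis, of an element of `⋀ᵏ T` (a `k`-vector) or of `⋀ᵏ T*`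
(a `k`-form), for `T = ℝⁿ`. -/
abbrev Ext (n k : ℕ) : Type := Idx n k → ℝ

/-- The structure constant of the exterior product: `e_A ∧ e_B = ∑_C eps A B C • e_C`.
It vanishes unless `A` and `B` are disjoint with union `C`, and then it is the sign of the shuffle
which sorts `A` followed by `B`. -/
def eps {n : ℕ} (A B C : Finset (Fin n)) : ℝ :=
  if Disjoint A B ∧ A ∪ B = C then
    (-1 : ℝ) ^ ((A ×ˢ B).filter fun x => x.2 < x.1).card
  else 0

/-- The exterior product. -/
def wedge {n k l : ℕ} (α : Ext n k) (β : Ext n l) : Ext n (k + l) :=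
  fun C => ∑ A : Idx n k, ∑ B : Idx n l, eps A.1 B.1 C.1 * α A * β B

/-- The contraction `ι_w α` of a `(k+l)`-form `α` with a `k`-vector `w`, or of a `(k+l)`-vector
with a `k`-form: `ι_{X₁ ∧ ⋯ ∧ X_k} α = α(X₁, …, X_k, ·, …, ·)`. -/
def contract {n k l : ℕ} (w : Ext n k) (α : Ext n (l + k)) : Ext n l :=
  fun B => ∑ A : Idx n k, ∑ C : Idx n (l + k), eps A.1 B.1 C.1 * w A * α C

/-- A basis vector of `T` or of `T*`. -/
def basisVec {n : ℕ} (i : Idx n 1) : Ext n 1 := Pi.single i 1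

/-- The action of `L ∈ gl(T)` on `k+1`-forms: the derivation extending minus the transpose,
`L · α = - ∑_{i,j} L_{ij} e^j ∧ ι_{e_i} α`. -/
def glForm {n k : ℕ} (L : Matrix (Idx n 1) (Idx n 1) ℝ) (α : Ext n (k + 1)) : Ext n (1 + k) :=
  -∑ i : Idx n 1, ∑ j : Idx n 1, L i j • wedge (basisVec j) (contract (basisVec i) α)

/-! ### The exceptional group data -/

/-- The representation `E = T ⊕ ⋀² T* ⊕ ⋀⁵ T*`. -/
abbrev E (n : ℕ) : Type := Ext n 1 × Ext n 2 × Ext n 5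

/-- The representation `N = T* ⊕ ⋀⁴ T* ⊕ (T* ⊗ ⋀⁶ T*)`. -/
abbrev N (n : ℕ) : Type := Ext n 1 × Ext n 4 × (Idx n 1 → Ext n 6)

/-- `j σ₂ ∧ σ₅ ∈ T* ⊗ ⋀⁶ T*`, that is `Y ↦ (ι_Y σ₂) ∧ σ₅`. -/
def jWedge {n : ℕ} (σ₂ : Ext n 2) (σ₅ : Ext n 5) : Idx n 1 → Ext n 6 :=
  fun i => wedge (contract (basisVec i) σ₂ : Ext n 1) σ₅

/-- The map `E ⊗ E → S²E → N`, `u ⊗ v ↦ (u ⊗ v)_N`: the symmetric bilinear map with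
`(u ⊗ u)_N = 2 ι_X σ₂ + (2 ι_X σ₅ - σ₂ ∧ σ₂) + 2 j σ₂ ∧ σ₅` for `u = X + σ₂ + σ₅`. -/
def toN {n : ℕ} (u v : E n) : N n :=
  (contract u.1 v.2.1 + contract v.1 u.2.1,
    contract u.1 v.2.2 + contract v.1 u.2.2 - wedge u.2.1 v.2.1,
    jWedge u.2.1 v.2.2 + jWedge v.2.1 u.2.2)

theorem contDiff_wedge {n k l : ℕ} {W : Type*} [NormedAddCommGroup W] [NormedSpace ℝ W]
    {f : W → Ext n k} {g : W → Ext n l} (hf : ContDiff ℝ ∞ f) (hg : ContDiff ℝ ∞ g) :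
    ContDiff ℝ ∞ fun x => wedge (f x) (g x) :=
  contDiff_pi.2 fun _ => ContDiff.sum fun A _ => ContDiff.sum fun B _ =>
    (contDiff_const.mul (contDiff_pi.1 hf A)).mul (contDiff_pi.1 hg B)

theorem contDiff_contract {n k l : ℕ} {W : Type*} [NormedAddCommGroup W] [NormedSpace ℝ W]
    {f : W → Ext n k} {g : W → Ext n (l + k)} (hf : ContDiff ℝ ∞ f) (hg : ContDiff ℝ ∞ g) :
    ContDiff ℝ ∞ fun x => contract (f x) (g x) :=
  contDiff_pi.2 fun _ => ContDiff.sum fun A _ => ContDiff.sum fun C _ =>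
    (contDiff_const.mul (contDiff_pi.1 hf A)).mul (contDiff_pi.1 hg C)

theorem contDiff_jWedge {n : ℕ} {W : Type*} [NormedAddCommGroup W] [NormedSpace ℝ W]
    {f : W → Ext n 2} {g : W → Ext n 5} (hf : ContDiff ℝ ∞ f) (hg : ContDiff ℝ ∞ g) :
    ContDiff ℝ ∞ fun x => jWedge (f x) (g x) :=
  contDiff_pi.2 fun i => contDiff_wedge (k := 1) (l := 5)
    (contDiff_contract (k := 1) (l := 1) (contDiff_const (c := basisVec i)) hf) hg

theorem contDiff_toN {n : ℕ} : ContDiff ℝ ∞ fun q : E n × E n => toN q.1 q.2 := by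
  have a1 : ContDiff ℝ ∞ fun q : E n × E n => q.1.1 := by fun_prop
  have a2 : ContDiff ℝ ∞ fun q : E n × E n => q.1.2.1 := by fun_prop
  have a5 : ContDiff ℝ ∞ fun q : E n × E n => q.1.2.2 := by fun_prop
  have b1 : ContDiff ℝ ∞ fun q : E n × E n => q.2.1 := by fun_prop
  have b2 : ContDiff ℝ ∞ fun q : E n × E n => q.2.2.1 := by fun_prop
  have b5 : ContDiff ℝ ∞ fun q : E n × E n => q.2.2.2 := by fun_prop
  exact ((contDiff_contract (l := 1) a1 b2).add (contDiff_contract (l := 1) b1 a2)).prodMk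
    ((((contDiff_contract (l := 4) a1 b5).add (contDiff_contract (l := 4) b1 a5)).sub
      (contDiff_wedge (k := 2) (l := 2) a2 b2)).prodMk
      ((contDiff_jWedge a2 b5).add (contDiff_jWedge b2 a5)))

/-- The standard basis of `E`. -/
def basisE (n : ℕ) : Module.Basis (Idx n 1 ⊕ (Idx n 2 ⊕ Idx n 5)) ℝ (E n) :=
  (Pi.basisFun ℝ (Idx n 1)).prod ((Pi.basisFun ℝ (Idx n 2)).prod (Pi.basisFun ℝ (Idx n 5)))

/-- The components of `ξ ∈ E* = T* ⊕ ⋀² T ⊕ ⋀⁵ T`, in the dual standard basis. -/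
def covec {n : ℕ} (ξ : Module.Dual ℝ (E n)) : E n := ∑ i, ξ (basisE n i) • basisE n i

/-- The pairing of `N* = T ⊕ ⋀⁴ T ⊕ (T ⊗ ⋀⁶ T)` (in coordinates) with `N`. -/
def pairN {n : ℕ} (ν ν' : N n) : ℝ :=
  ∑ i, ν.1 i * ν'.1 i + ∑ S, ν.2.1 S * ν'.2.1 S + ∑ i, ∑ S, ν.2.2 i S * ν'.2.2 i S

/-- The map `S²E* → N*`, dual to `N → S²E`, as `⟨(ξ ⊗ η)_{N*}, ν⟩`. It is given by the same formula
as `S²E → N`, with the roles of `T` and `T*` exchanged; with this normalisation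
`π (End E) ⊆ 𝔤` holds. -/
def toNStar {n : ℕ} (ξ η : Module.Dual ℝ (E n)) (ν : N n) : ℝ :=
  pairN (toN (covec ξ) (covec η)) ν

/-- The partial dual `E* ⊗ N → E` of `N → S²E`, `ξ ⊗ ν ↦ (ξ ⊗ ν)_E`, characterised by
`⟨η, (ξ ⊗ ν)_E⟩ = ⟨(ξ ⊗ η)_{N*}, ν⟩`. -/
def toE {n : ℕ} (ξ : Module.Dual ℝ (E n)) (ν : N n) : E n :=
  ∑ i, toNStar ξ ((basisE n).coord i) ν • basisE n i

/-- The same map `E* ⊗ N → E`, with `E* ⊗ N` identified with `Hom(E, N)`. -/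
def homToE {n : ℕ} (K : E n →ₗ[ℝ] N n) : E n :=
  ∑ i, toE ((basisE n).coord i) (K (basisE n i))

theorem wedge_add_left {n k l : ℕ} (α α' : Ext n k) (β : Ext n l) :
    wedge (α + α') β = wedge α β + wedge α' β := by
  ext C; simp [wedge, mul_add, add_mul, Finset.sum_add_distrib]

theorem wedge_smul_left {n k l : ℕ} (c : ℝ) (α : Ext n k) (β : Ext n l) :
    wedge (c • α) β = c • wedge α β := by
  ext C; simp [wedge, Finset.mul_sum]; congr! 2; ring

theorem wedge_add_right {n k l : ℕ} (α : Ext n k) (β β' : Ext n l) :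
    wedge α (β + β') = wedge α β + wedge α β' := by
  ext C; simp [wedge, mul_add, Finset.sum_add_distrib]

theorem wedge_smul_right {n k l : ℕ} (c : ℝ) (α : Ext n k) (β : Ext n l) :
    wedge α (c • β) = c • wedge α β := by
  ext C; simp [wedge, Finset.mul_sum]; congr! 2; ring

theorem contract_add_left {n k l : ℕ} (w w' : Ext n k) (α : Ext n (l + k)) :
    contract (w + w') α = contract w α + contract w' α := by
  ext C; simp [contract, mul_add, add_mul, Finset.sum_add_distrib]

theorem contract_smul_left {n k l : ℕ} (c : ℝ) (w : Ext n k) (α : Ext n (l + k)) :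
    contract (c • w) α = c • contract w α := by
  ext C; simp [contract, Finset.mul_sum]; congr! 2; ring

theorem contract_add_right {n k l : ℕ} (w : Ext n k) (α α' : Ext n (l + k)) :
    contract w (α + α') = contract w α + contract w α' := by
  ext C; simp [contract, mul_add, Finset.sum_add_distrib]

theorem contract_smul_right {n k l : ℕ} (c : ℝ) (w : Ext n k) (α : Ext n (l + k)) :
    contract w (c • α) = c • contract w α := by
  ext C; simp [contract, Finset.mul_sum]; congr! 2; ring

theorem jWedge_add_left {n : ℕ} (s s' : Ext n 2) (f : Ext n 5) :
    jWedge (s + s') f = jWedge s f + jWedge s' f := by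
  funext i
  exact (congrArg (fun x => wedge x f) (contract_add_right (l := 1) (basisVec i) s s')).trans
    (wedge_add_left _ _ f)

theorem jWedge_smul_left {n : ℕ} (c : ℝ) (s : Ext n 2) (f : Ext n 5) :
    jWedge (c • s) f = c • jWedge s f := by
  funext i
  exact (congrArg (fun x => wedge x f) (contract_smul_right (l := 1) c (basisVec i) s)).trans
    (wedge_smul_left _ _ f)

theorem jWedge_add_right {n : ℕ} (s : Ext n 2) (f f' : Ext n 5) :
    jWedge s (f + f') = jWedge s f + jWedge s f' := by
  funext i
  exact wedge_add_right (contract (basisVec i) s : Ext n 1) f f'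

theorem jWedge_smul_right {n : ℕ} (c : ℝ) (s : Ext n 2) (f : Ext n 5) :
    jWedge s (c • f) = c • jWedge s f := by
  funext i
  exact wedge_smul_right c (contract (basisVec i) s : Ext n 1) f

theorem toN_add_left {n : ℕ} (u u' v : E n) : toN (u + u') v = toN u v + toN u' v := by
  have h1 := contract_add_right (n := n) (k := 1) (l := 1) v.1 u.2.1 u'.2.1
  have h2 := contract_add_right (n := n) (k := 1) (l := 4) v.1 u.2.2 u'.2.2
  refine Prod.ext ?_ (Prod.ext ?_ ?_)
  · simp only [toN, Prod.fst_add, Prod.snd_add, contract_add_left]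
    erw [h1]
    abel
  · simp only [toN, Prod.fst_add, Prod.snd_add, contract_add_left, wedge_add_left]
    erw [h2]
    abel
  · simp only [toN, Prod.fst_add, Prod.snd_add, jWedge_add_left, jWedge_add_right]
    abel

theorem toN_smul_left {n : ℕ} (c : ℝ) (u v : E n) : toN (c • u) v = c • toN u v := by
  have h1 := contract_smul_right (n := n) (k := 1) (l := 1) c v.1 u.2.1
  have h2 := contract_smul_right (n := n) (k := 1) (l := 4) c v.1 u.2.2
  refine Prod.ext ?_ (Prod.ext ?_ ?_)
  · simp only [toN, Prod.smul_fst, Prod.smul_snd, contract_smul_left, smul_add]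
    erw [h1]
  · simp only [toN, Prod.smul_fst, Prod.smul_snd, contract_smul_left, wedge_smul_left, smul_add,
      smul_sub]
    erw [h2]
  · simp only [toN, Prod.smul_fst, Prod.smul_snd, jWedge_smul_left, jWedge_smul_right, smul_add]

/-- `u ↦ (u ⊗ v)_N` as a linear map. -/
def toNLeft {n : ℕ} (v : E n) : E n →ₗ[ℝ] N n where
  toFun u := toN u v
  map_add' u u' := toN_add_left u u' v
  map_smul' c u := toN_smul_left c u v

/-- `π(B) v`, where `π = 1 - π'` and `π' : End E → End E` is the partial dual of the composition
`E ⊗ E → S²E → N → S²E → E ⊗ E`; on decomposable elements,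
`π(ξ ⊗ u) v = ⟨ξ, v⟩ u - (ξ ⊗ (u ⊗ v)_N)_E`. -/
def piMap {n : ℕ} (B : E n →ₗ[ℝ] E n) (v : E n) : E n :=
  B v - homToE (toNLeft v ∘ₗ B)

/-- The action on `E` of the element `c + L + a₃ + a₆ + w₃ + w₆` of
`𝔢_{n(n)} ⊕ ℝ = ℝ ⊕ gl(T) ⊕ ⋀³T* ⊕ ⋀⁶T* ⊕ ⋀³T ⊕ ⋀⁶T`. -/
def gAct {n : ℕ} (c : ℝ) (L : Matrix (Idx n 1) (Idx n 1) ℝ) (a₃ : Ext n 3) (a₆ : Ext n 6)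
    (w₃ : Ext n 3) (w₆ : Ext n 6) (u : E n) : E n :=
  (c • u.1 + L.mulVec u.1 + contract u.2.1 w₃ - contract u.2.2 w₆,
    c • u.2.1 + glForm L u.2.1 + contract w₃ u.2.2 + contract u.1 a₃,
    c • u.2.2 + glForm (k := 4) L u.2.2 + wedge a₃ u.2.1 + contract u.1 a₆)

/-- The endomorphism `A` of `E` belongs to the Lie algebra `𝔤 = 𝔢_{n(n)} ⊕ ℝ` of
`G = E_{n(n)} × ℝ⁺`. -/
def InG {n : ℕ} (A : E n → E n) : Prop :=
  ∃ (c : ℝ) (L : Matrix (Idx n 1) (Idx n 1) ℝ) (a₃ : Ext n 3) (a₆ : Ext n 6)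
    (w₃ : Ext n 3) (w₆ : Ext n 6), ∀ u, A u = gAct c L a₃ a₆ w₃ w₆ u

/-- `V ⊆ E` is coisotropic if `(V° ⊗ V°)_{N*} = 0`. -/
def IsCoisotropic {n : ℕ} (V : Submodule ℝ (E n)) : Prop :=
  ∀ ξ ∈ V.dualAnnihilator, ∀ η ∈ V.dualAnnihilator, ∀ ν : N n, toNStar ξ η ν = 0

/-- `V ⊆ E` is co-Lagrangian if it is minimal among the coisotropic subspaces. -/
def IsCoLagrangian {n : ℕ} (V : Submodule ℝ (E n)) : Prop := Minimal IsCoisotropic V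

/-! ### Elgebras -/

/-- An elgebra, i.e. an elgebroid over a point. The principal bundle over the point is trivialised,
so that sections are elements of `E` and `N`; the anchor is zero and the Leibniz rules reduce to
linearity. -/
structure Elgebra (n : ℕ) where
  /-- the bracket -/
  bracket : E n →ₗ[ℝ] E n →ₗ[ℝ] E n
  /-- the operator `𝒟` -/
  D : N n →ₗ[ℝ] E n
  jacobi : ∀ u v w, bracket u (bracket v w) = bracket (bracket u v) w + bracket v (bracket u w)
  symm : ∀ u v, bracket u v + bracket v u = D (toN u v)
  preserves : ∀ u, InG (bracket u)

/-! ### Elgebroids on trivial bundles -/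

section Manifold

variable {n m : ℕ} {M : Type*} [TopologicalSpace M] [ChartedSpace (EuclideanSpace ℝ (Fin m)) M]

/-- Smooth functions `M → W`, i.e. sections of the trivial bundle `M × W`. -/
abbrev Sec (m : ℕ) (M : Type*) [TopologicalSpace M] [ChartedSpace (EuclideanSpace ℝ (Fin m)) M]
    (W : Type*) [NormedAddCommGroup W] [NormedSpace ℝ W] : Type _ :=
  ContMDiffMap (𝓡 m) 𝓘(ℝ, W) M W ∞

/-- The constant section with value `x` (the pullback of `x` along the map to the point). -/
def constSec {W : Type*} [NormedAddCommGroup W] [NormedSpace ℝ W] (x : W) : Sec m M W :=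
  ContMDiffMap.const x

/-- The section `(u ⊗ v)_N`. -/
def secToN (u v : Sec m M (E n)) : Sec m M (N n) :=
  ⟨fun p => toN (u p) (v p),
    ContDiff.comp_contMDiff (g := fun q : E n × E n => toN q.1 q.2) (f := fun p => (u p, v p))
      contDiff_toN (ContMDiff.prodMk_space u.contMDiff v.contMDiff)⟩

/-- A linear map `d̂F_p : E → W`, i.e. an element of `E* ⊗ W`, from a linear map `r : E → T_pM`:
the composition of `r` with the differential of `F` at `p`. For `r = ρ_p` and `W = ℝ` this is
`d̂F = ρᵗ(dF)`. -/
def dHat {W : Type*} [NormedAddCommGroup W] [NormedSpace ℝ W] {p : M}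
    (r : E n →ₗ[ℝ] TangentSpace (𝓡 m) p) (F : Sec m M W) : E n →ₗ[ℝ] W :=
  (mfderiv (𝓡 m) 𝓘(ℝ, W) F p).toLinearMap ∘ₗ r

/-- A smooth vector bundle map `M × E → TM` over the identity; equivalently a linear map from `E`
to the smooth vector fields on `M`. -/
structure BundleMap (n m : ℕ) (M : Type*) [TopologicalSpace M]
    [ChartedSpace (EuclideanSpace ℝ (Fin m)) M] [IsManifold (𝓡 m) ∞ M] where
  /-- the map on the fibre over `p` -/
  toFun : (p : M) → E n →ₗ[ℝ] TangentSpace (𝓡 m) p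
  smooth : ∀ v : E n, ContMDiff (𝓡 m) (𝓡 m).tangent ∞
    (fun p => (⟨p, toFun p v⟩ : TangentBundle (𝓡 m) M))

variable [IsManifold (𝓡 m) ∞ M]

/-- An elgebroid over `M` whose underlying principal `G`-bundle is the trivial bundle `M × G`,
so that the sections of the associated bundles are the smooth maps to `E` and `N`. -/
structure Elgebroid (n m : ℕ) (M : Type*) [TopologicalSpace M]
    [ChartedSpace (EuclideanSpace ℝ (Fin m)) M] [IsManifold (𝓡 m) ∞ M] where
  /-- the bracket -/
  bracket : Sec m M (E n) →ₗ[ℝ] Sec m M (E n) →ₗ[ℝ] Sec m M (E n)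
  /-- the anchor `ρ : M × E → TM` -/
  anchor : BundleMap n m M
  /-- the operator `𝒟` -/
  D : Sec m M (N n) →ₗ[ℝ] Sec m M (E n)
  jacobi : ∀ u v w, bracket u (bracket v w) = bracket (bracket u v) w + bracket v (bracket u w)
  leibniz : ∀ (u v : Sec m M (E n)) (f : Sec m M ℝ) (p : M),
    bracket u (f • v) p = f p • bracket u v p + dHat (anchor.toFun p) f (u p) • v p
  symm : ∀ u v, bracket u v + bracket v u = D (secToN u v)
  leibniz_D : ∀ (ν : Sec m M (N n)) (f : Sec m M ℝ) (p : M),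
    D (f • ν) p = f p • D ν p + toE (dHat (anchor.toFun p) f) (ν p)
  /-- `[u, ·]` preserves the `G`-structure: in the given trivialisation, its vertical part, which is
  its value on constant sections, belongs to `𝔤` at every point. -/
  preserves : ∀ (u : Sec m M (E n)) (p : M), InG fun v => bracket u (constSec v) p

/-- An elgebroid is M-exact if `dim M = n` and `T*M ⊗ N → E → TM → 0` is exact at every point, where
the first map is `α ⊗ ν ↦ (ρᵗα ⊗ ν)_E`. -/
def Elgebroid.IsMExact (P : Elgebroid n m M) : Prop :=
  m = n ∧ ∀ p : M, Function.Surjective (P.anchor.toFun p) ∧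
    Submodule.span ℝ {e : E n | ∃ (α : TangentSpace (𝓡 m) p →ₗ[ℝ] ℝ) (ν : N n),
      e = toE (α ∘ₗ P.anchor.toFun p) ν} = LinearMap.ker (P.anchor.toFun p)

/-- The elgebroid `P` on `M × E` is a pullback of the elgebra `A` along the map from `M` to the
point. (The condition relating the anchors is void, since the tangent space of the point is `0`.) -/
def Elgebroid.IsPullback (P : Elgebroid n m M) (A : Elgebra n) : Prop :=
  (∀ u v : E n, P.bracket (constSec u) (constSec v) = constSec (A.bracket u v)) ∧
    ∀ ν : N n, P.D (constSec ν) = constSec (A.D ν)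

/-- An action of an elgebra on `M`: a linear map `χ : E → Γ(TM)` which preserves the brackets. -/
structure Action {n : ℕ} (A : Elgebra n) (m : ℕ) (M : Type*) [TopologicalSpace M]
    [ChartedSpace (EuclideanSpace ℝ (Fin m)) M] [IsManifold (𝓡 m) ∞ M] extends
    BundleMap n m M where
  map_bracket : ∀ (u v : E n) (p : M), toFun p (A.bracket u v) =
    VectorField.mlieBracket (𝓡 m) (fun q => toFun q u) (fun q => toFun q v) p

/-- The action is transitive if `χ_p : E → T_pM` is surjective for every `p`. -/
def Action.IsTransitive {A : Elgebra n} (χ : Action A m M) : Prop :=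
  ∀ p : M, Function.Surjective (χ.toFun p)

/-- The stabiliser at `p`, the kernel of `χ_p : E → T_pM`. -/
def Action.stabiliser {A : Elgebra n} (χ : Action A m M) (p : M) : Submodule ℝ (E n) :=
  LinearMap.ker (χ.toFun p)

end Manifold

end Elg

end

open scoped Manifold ContDiff

noncomputable section

namespace Elg

variable {n : ℕ}

/-! Uniqueness is forced. Every section of a trivial bundle is a finite combination of constant
sections with smooth coefficients. The Leibniz rules for `𝒟` and for the right argument, together
with the symmetric part of the bracket, then determine both operations from their values on
constants (`Elgebroid.D_eq`, `Elgebroid.bracket_eq`).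

Exactness gives the co-Lagrangian condition. Put `V = Ker χ_p`. Exactness says that `V` is the image
of `V° ⊗ N → E`. Because `⟨η, (ξ ⊗ ν)_E⟩ = ⟨(ξ ⊗ η)_{N*}, ν⟩`, this image lies in `V` exactly when
`V` is coisotropic. A coisotropic `W ⊆ V` has `V° ⊆ W°`, so it contains the image, which is `V`. The
codimension is that of a surjection onto `T_pM`.

For the converse the formulas are taken as definitions. The `G`-structure is preserved because
`π(End E) ⊆ 𝔤` (`isDer_piC`). The anchor respects brackets because isotropy of `V°` puts `(d̂ν)_E`
into the stabiliser. The Jacobiator vanishes on constants. It is function-linear in the last slot by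
the anchor property and in the middle slot by equivariance of `π`. The first slot is reached by
antisymmetry in the first two slots, which amounts to `[𝒟ν, ·] = 0`. At a point this last condition
becomes the algebraic identity `[(ξ ⊗ ν)_E, ·] = π(ξ ⊗ 𝒟ν) + π((H ⊗ ν)_E)`, where `ξ = d̂f` and `H`
is the second derivative of `f`. The antisymmetric part of `H` is `ξ([e, e'])`.

That identity is `gauge_of_good`. The bracket of the elgebra is compared with a model `Ω_u v - π(Ω_•
u) v` having the same image modulo `V`. The model satisfies the identity with its own `H`. The two
choices of `H` differ by a symmetric tensor, which `Good.symm` removes. The two brackets differ by a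
`V`-valued one, which `Good.gauge` handles.

The conditions in `Good` are invariant under automorphisms and are verified by hand for the
annihilator `T*` of `⋀²T* ⊕ ⋀⁵T*`. Every `n`-dimensional isotropic subspace is equivalent to this
one (`exists_map_eq_std`). Among its images, take one whose projection to `T` has maximal rank. If
the projection were not onto, a 3-vector or a 6-vector would raise the rank or the dimension would
be too small. What remains is a graph, straightened by a 3-form and a 6-form.

All computations take place in one Grassmann algebra, with `E*` and `N*` identified with `E` and `N`
by coordinates. The Lie algebra `𝔤` is handled as the derivations of both products (`InG.isDer`,
`IsDer.inG`). The bound `n ≤ 6` enters through the vanishing of elements of degree seven. -/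

/-! ### The Grassmann algebra on `n` generators -/

/-- The sign of the shuffle which sorts `A` followed by `B`. -/
def sgn {n : ℕ} (A B : Finset (Fin n)) : ℝ :=
  (-1 : ℝ) ^ ((A ×ˢ B).filter fun x => x.2 < x.1).card

theorem eps_eq (A B C : Finset (Fin n)) :
    eps A B C = if Disjoint A B ∧ A ∪ B = C then sgn A B else 0 := rfl

theorem sgn_union_left {A B : Finset (Fin n)} (h : Disjoint A B) (C : Finset (Fin n)) :
    sgn (A ∪ B) C = sgn A C * sgn B C := by
  unfold sgn
  rw [Finset.union_product, Finset.filter_union, Finset.card_union_of_disjoint, pow_add]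
  exact Finset.disjoint_filter_filter (Finset.disjoint_product.2 (Or.inl h))

theorem sgn_union_right {A B : Finset (Fin n)} (h : Disjoint A B) (C : Finset (Fin n)) :
    sgn C (A ∪ B) = sgn C A * sgn C B := by
  unfold sgn
  rw [Finset.product_union, Finset.filter_union, Finset.card_union_of_disjoint, pow_add]
  exact Finset.disjoint_filter_filter (Finset.disjoint_product.2 (Or.inr h))

theorem sgn_mul_self (A B : Finset (Fin n)) : sgn A B * sgn A B = 1 := by
  rw [sgn, ← mul_pow]; simp

theorem sgn_mul_swap {A B : Finset (Fin n)} (h : Disjoint A B) :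
    sgn A B * sgn B A = (-1) ^ (A.card * B.card) := by
  unfold sgn
  rw [← pow_add, ← Finset.card_product]
  congr 1
  have : ((B ×ˢ A).filter fun x => x.2 < x.1).card
      = ((A ×ˢ B).filter fun x => ¬ x.2 < x.1).card := by
    refine Finset.card_bij' (fun x _ => x.swap) (fun x _ => x.swap) ?_ ?_ ?_ ?_
    · rintro ⟨x, y⟩ hx
      simp only [Finset.mem_filter, Finset.mem_product, Prod.swap] at hx ⊢
      exact ⟨⟨hx.1.2, hx.1.1⟩, not_lt.2 hx.2.le⟩
    · rintro ⟨x, y⟩ hx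
      simp only [Finset.mem_filter, Finset.mem_product, Prod.swap] at hx ⊢
      refine ⟨⟨hx.1.2, hx.1.1⟩, lt_of_le_of_ne (not_lt.1 hx.2) ?_⟩
      rintro rfl
      exact Finset.disjoint_left.1 h hx.1.1 hx.1.2
    · intro x _; simp
    · intro x _; simp
  rw [this, Finset.card_filter_add_card_filter_not]

@[simp] theorem sgn_empty_left (B : Finset (Fin n)) : sgn ∅ B = 1 := by simp [sgn]
@[simp] theorem sgn_empty_right (B : Finset (Fin n)) : sgn B ∅ = 1 := by simp [sgn]

theorem sum_eps_mul (A B : Finset (Fin n)) (F : Finset (Fin n) → ℝ) :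
    ∑ C, eps A B C * F C = if Disjoint A B then sgn A B * F (A ∪ B) else 0 := by
  by_cases h : Disjoint A B <;> simp [eps_eq, h]

theorem sum_eps_singleton_mul (i : Fin n) (A : Finset (Fin n)) (F : Finset (Fin n) → ℝ) :
    ∑ B, eps {i} B A * F B = if i ∈ A then sgn {i} (A.erase i) * F (A.erase i) else 0 := by
  by_cases h : i ∈ A
  · rw [if_pos h, Finset.sum_eq_single (A.erase i)]
    · rw [eps_eq, if_pos]
      simp [h]
    · intro B _ hB
      rw [eps_eq, if_neg, zero_mul]
      rintro ⟨h1, rfl⟩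
      apply hB
      rw [← Finset.insert_eq, Finset.erase_insert]
      simpa using h1
    · simp
  · rw [if_neg h]
    refine Finset.sum_eq_zero fun B _ => ?_
    rw [eps_eq, if_neg, zero_mul]
    rintro ⟨h1, rfl⟩
    simp at h

/-- Associativity on monomials. For pairwise disjoint sets both sides carry the sign `sgn A B * sgn
A C * sgn B C`, since inversions are counted block by block. Otherwise both sides vanish. -/
theorem eps_assoc (A B C D : Finset (Fin n)) :
    ∑ X, eps A B X * eps X C D = ∑ X, eps B C X * eps A X D := by
  rw [sum_eps_mul, sum_eps_mul]
  simp only [eps_eq, Finset.disjoint_union_left, Finset.disjoint_union_right, Finset.union_assoc]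
  by_cases h1 : Disjoint A B <;> by_cases h2 : Disjoint A C <;> by_cases h3 : Disjoint B C <;>
    simp only [h1, h2, h3, and_true, true_and, and_false, false_and, if_true, if_false, mul_zero,
      mul_ite, ite_self]
  rw [sgn_union_left h1, sgn_union_right h3]; ring

theorem eps_comm (A B C : Finset (Fin n)) :
    eps A B C = (-1) ^ (A.card * B.card) * eps B A C := by
  simp only [eps_eq, disjoint_comm (a := B), Finset.union_comm B]
  split_ifs with h
  · rw [← sgn_mul_swap h.1, mul_assoc, sgn_mul_self, mul_one]
  · simp

/-- The antiderivation rule for contraction by a generator, on the monomials of `A` and `B`. If `i`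
lies in both sets, the product vanishes and the two terms on the right cancel, because moving the
generator past the rest of `A` costs the sign supplied by `sgn_mul_swap`. -/
theorem eps_contract (i : Fin n) (A B D : Finset (Fin n)) :
    ∑ C, eps {i} D C * eps A B C = ∑ A', eps {i} A' A * eps A' B D
      + (-1) ^ A.card * ∑ B', eps {i} B' B * eps A B' D := by
  rw [sum_eps_mul, sum_eps_singleton_mul i A (fun A' => eps A' B D),
    sum_eps_singleton_mul i B (fun B' => eps A B' D)]
  simp only [Finset.disjoint_singleton_left, ← Finset.insert_eq]
  by_cases hA : i ∈ A
  · obtain ⟨A, hiA, rfl⟩ : ∃ A', i ∉ A' ∧ A = insert i A' :=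
      ⟨A.erase i, Finset.notMem_erase i A, (Finset.insert_erase hA).symm⟩
    have dA : Disjoint {i} A := by simpa using hiA
    by_cases hB : i ∈ B
    · obtain ⟨B, hiB, rfl⟩ : ∃ B', i ∉ B' ∧ B = insert i B' :=
        ⟨B.erase i, Finset.notMem_erase i B, (Finset.insert_erase hB).symm⟩
      have dB : Disjoint {i} B := by simpa using hiB
      have e0 : eps (insert i A) (insert i B) (insert i D) = 0 := by
        rw [eps_eq, if_neg]
        rintro ⟨h, -⟩
        exact Finset.disjoint_left.1 h (Finset.mem_insert_self _ _) (Finset.mem_insert_self _ _)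
      simp only [e0, mul_zero, ite_self, Finset.mem_insert_self, if_true,
        Finset.erase_insert hiA, Finset.erase_insert hiB, eps_eq]
      by_cases h : Disjoint A B ∧ insert i (A ∪ B) = D
      · have h1 : Disjoint A (insert i B) ∧ A ∪ insert i B = D := by
          simp [hiA, h.1, Finset.union_insert, h.2]
        have h2 : Disjoint (insert i A) B ∧ insert i A ∪ B = D := by
          simp [hiB, h.1, Finset.insert_union, h.2]
        rw [if_pos h1, if_pos h2, Finset.card_insert_of_notMem hiA, Finset.insert_eq,
          Finset.insert_eq, sgn_union_right dB, sgn_union_left dA]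
        have h3 := sgn_mul_swap dA
        have h4 := sgn_mul_self {i} B
        simp only [Finset.card_singleton, one_mul] at h3
        rw [pow_succ]
        linear_combination (-sgn A B) * h3 + (-1) ^ A.card * sgn A B * h4
      · rw [if_neg, if_neg]
        · simp
        · rintro ⟨h1, h2⟩
          rw [Finset.insert_union] at h2
          exact h ⟨(Finset.disjoint_insert_left.1 h1).2, h2⟩
        · rintro ⟨h1, h2⟩
          rw [Finset.union_insert] at h2
          exact h ⟨(Finset.disjoint_insert_right.1 h1).2, h2⟩
    · have dB : Disjoint {i} B := by simpa using hB
      simp only [Finset.mem_insert_self, if_true, Finset.erase_insert hiA, hB, if_false, mul_zero,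
        add_zero, eps_eq]
      by_cases hD : i ∈ D
      · rw [if_neg (not_not.2 hD), if_neg, mul_zero]
        rintro ⟨-, rfl⟩
        simp [hiA, hB] at hD
      · rw [if_pos hD]
        by_cases h : Disjoint A B ∧ A ∪ B = D
        · rw [if_pos h, if_pos, ← h.2, Finset.insert_eq, sgn_union_left dA, sgn_union_right h.1]
          · have h4 := sgn_mul_self {i} B
            linear_combination sgn {i} A * sgn A B * h4
          · rw [Finset.insert_union, h.2]
            simp [hB, h.1]
        · rw [if_neg h, if_neg]
          · simp
          rintro ⟨h1, h2⟩
          rw [Finset.insert_union] at h2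
          refine h ⟨(Finset.disjoint_insert_left.1 h1).2, ?_⟩
          have := congrArg (Finset.erase · i) h2
          simpa [hiA, hB, hD] using this
  · simp only [hA, if_false, zero_add]
    by_cases hB : i ∈ B
    · obtain ⟨B, hiB, rfl⟩ : ∃ B', i ∉ B' ∧ B = insert i B' :=
        ⟨B.erase i, Finset.notMem_erase i B, (Finset.insert_erase hB).symm⟩
      have dB : Disjoint {i} B := by simpa using hiB
      have dA : Disjoint {i} A := by simpa using hA
      simp only [Finset.mem_insert_self, if_true, Finset.erase_insert hiB, eps_eq]
      by_cases hD : i ∈ D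
      · rw [if_neg (not_not.2 hD), if_neg]
        · simp
        · rintro ⟨-, rfl⟩
          simp [hiB, hA] at hD
      · rw [if_pos hD]
        by_cases h : Disjoint A B ∧ A ∪ B = D
        · rw [if_pos h, if_pos, ← h.2, Finset.insert_eq, sgn_union_right dB, sgn_union_right h.1]
          · have h3 := sgn_mul_swap dA
            simp only [Finset.card_singleton, one_mul] at h3
            linear_combination sgn {i} B * sgn A B * h3
          · rw [Finset.union_insert, h.2]
            simp [hA, h.1]
        · rw [if_neg h, if_neg]
          · simp
          · rintro ⟨h1, h2⟩
            rw [Finset.union_insert] at h2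
            refine h ⟨(Finset.disjoint_insert_right.1 h1).2, ?_⟩
            have := congrArg (Finset.erase · i) h2
            simpa [hiB, hA, hD] using this
    · simp only [hB, if_false, mul_zero, eps_eq]
      rw [if_neg (c := Disjoint A B ∧ A ∪ B = insert i D)]
      · simp
      · rintro ⟨-, h2⟩
        have : i ∈ A ∪ B := h2 ▸ Finset.mem_insert_self i D
        simp [hA, hB] at this

/-- The Grassmann algebra on `n` generators, in its monomial basis. -/
structure GA (n : ℕ) : Type where
  /-- the coefficients -/
  coeff : Finset (Fin n) → ℝ

instance : CoeFun (GA n) fun _ => Finset (Fin n) → ℝ := ⟨GA.coeff⟩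

/-- The coefficients as an equivalence. -/
def GA.equiv : GA n ≃ (Finset (Fin n) → ℝ) := ⟨GA.coeff, GA.mk, fun _ => rfl, fun _ => rfl⟩

instance : AddCommGroup (GA n) := GA.equiv.addCommGroup
instance : Module ℝ (GA n) := GA.equiv.module ℝ

@[ext] theorem GA.ext {f g : GA n} (h : ∀ A, f A = g A) : f = g := GA.equiv.injective (funext h)
@[simp] theorem GA.add_apply (f g : GA n) (A : Finset (Fin n)) : (f + g) A = f A + g A := rfl
@[simp] theorem GA.sub_apply (f g : GA n) (A : Finset (Fin n)) : (f - g) A = f A - g A := rfl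
@[simp] theorem GA.neg_apply (f : GA n) (A : Finset (Fin n)) : (-f) A = -f A := rfl
@[simp] theorem GA.zero_apply (A : Finset (Fin n)) : (0 : GA n) A = 0 := rfl
@[simp] theorem GA.smul_apply (c : ℝ) (f : GA n) (A : Finset (Fin n)) : (c • f) A = c * f A := rfl
theorem GA.sum_apply {ι : Type*} (s : Finset ι) (f : ι → GA n) (A : Finset (Fin n)) :
    (∑ i ∈ s, f i) A = ∑ i ∈ s, f i A := by
  let φ : GA n →+ ℝ := ⟨⟨fun f => f A, rfl⟩, fun _ _ => rfl⟩
  exact map_sum φ f s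

instance : Mul (GA n) := ⟨fun f g => ⟨fun C => ∑ A, ∑ B, eps A B C * f A * g B⟩⟩
instance : One (GA n) := ⟨⟨Pi.single ∅ 1⟩⟩

theorem GA.mul_apply (f g : GA n) (C : Finset (Fin n)) :
    (f * g) C = ∑ A, ∑ B, eps A B C * f A * g B := rfl

theorem GA.one_apply (A : Finset (Fin n)) : (1 : GA n) A = if A = ∅ then 1 else 0 := by
  change (Pi.single ∅ 1 : Finset (Fin n) → ℝ) A = _
  rw [Pi.single_apply]

theorem GA.mul_assoc' (f g h : GA n) : f * g * h = f * (g * h) := by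
  ext D
  simp only [GA.mul_apply, Finset.mul_sum, Finset.sum_mul]
  have e1 : ∑ X, ∑ C, ∑ A, ∑ B, eps X C D * (eps A B X * f A * g B) * h C
      = ∑ A, ∑ B, ∑ C, (∑ X, eps A B X * eps X C D) * f A * g B * h C := by
    simp only [Finset.sum_mul]
    rw [Finset.sum_comm]
    rw [Finset.sum_congr rfl fun C _ => Finset.sum_comm]
    rw [Finset.sum_comm]
    refine Finset.sum_congr rfl fun A _ => ?_
    rw [Finset.sum_congr rfl fun C _ => Finset.sum_comm, Finset.sum_comm]
    refine Finset.sum_congr rfl fun B _ => Finset.sum_congr rfl fun C _ =>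
      Finset.sum_congr rfl fun X _ => by ring
  have e2 : ∑ A, ∑ X, ∑ B, ∑ C, eps A X D * f A * (eps B C X * g B * h C)
      = ∑ A, ∑ B, ∑ C, (∑ X, eps B C X * eps A X D) * f A * g B * h C := by
    simp only [Finset.sum_mul]
    refine Finset.sum_congr rfl fun A _ => ?_
    rw [Finset.sum_comm]
    refine Finset.sum_congr rfl fun B _ => ?_
    rw [Finset.sum_comm]
    refine Finset.sum_congr rfl fun C _ => Finset.sum_congr rfl fun X _ => by ring
  rw [e1, e2]
  simp only [eps_assoc]

instance : Ring (GA n) where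
  __ := (inferInstance : AddCommGroup (GA n))
  mul := (· * ·)
  one := 1
  left_distrib f g h := by
    ext C; simp [GA.mul_apply, mul_add, Finset.sum_add_distrib]
  right_distrib f g h := by
    ext C; simp [GA.mul_apply, mul_add, add_mul, Finset.sum_add_distrib]
  zero_mul f := by ext C; simp [GA.mul_apply]
  mul_zero f := by ext C; simp [GA.mul_apply]
  mul_assoc := GA.mul_assoc'
  one_mul f := by ext C; simp [GA.mul_apply, GA.one_apply, eps_eq]
  mul_one f := by ext C; simp [GA.mul_apply, GA.one_apply, eps_eq]

theorem GA.smul_mul (c : ℝ) (f g : GA n) : (c • f) * g = c • (f * g) := by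
  ext C; simp only [GA.mul_apply, GA.smul_apply, Finset.mul_sum]; congr! 2; ring
theorem GA.mul_smul (c : ℝ) (f g : GA n) : f * (c • g) = c • (f * g) := by
  ext C; simp only [GA.mul_apply, GA.smul_apply, Finset.mul_sum]; congr! 2; ring

instance : IsScalarTower ℝ (GA n) (GA n) := ⟨fun c f g => GA.smul_mul c f g⟩
instance : SMulCommClass ℝ (GA n) (GA n) := ⟨fun c f g => (GA.mul_smul c f g).symm⟩

/-- The contraction of `g` by `f`. -/
def con (f : GA n) : GA n →ₗ[ℝ] GA n where
  toFun g := ⟨fun B => ∑ A, ∑ C, eps A B C * f A * g C⟩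
  map_add' g h := by ext B; simp [mul_add, Finset.sum_add_distrib]
  map_smul' c g := by
    ext B; simp only [GA.smul_apply, Finset.mul_sum, RingHom.id_apply]; congr! 2; ring

theorem con_apply (f g : GA n) (B : Finset (Fin n)) :
    con f g B = ∑ A, ∑ C, eps A B C * f A * g C := rfl

theorem con_add (f f' : GA n) : con (f + f') = con f + con f' := by
  ext g B; simp [con_apply, mul_add, add_mul, Finset.sum_add_distrib]

theorem con_smul (c : ℝ) (f : GA n) : con (c • f) = c • con f := by
  ext g B; simp only [con_apply, GA.smul_apply, Finset.mul_sum, LinearMap.smul_apply]; congr! 2; ring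

theorem con_zero : con (0 : GA n) = 0 := by
  simpa using con_smul 0 (0 : GA n)

/-- Contraction is the transpose of left multiplication, so this is associativity read backwards and
the same `eps_assoc` proves it. -/
theorem con_mul (f g h : GA n) : con (f * g) h = con g (con f h) := by
  ext D
  simp only [con_apply, GA.mul_apply, Finset.mul_sum, Finset.sum_mul]
  have e1 : ∑ X, ∑ C, ∑ A, ∑ B, eps X D C * (eps A B X * f A * g B) * h C
      = ∑ A, ∑ B, ∑ C, (∑ X, eps A B X * eps X D C) * f A * g B * h C := by
    simp only [Finset.sum_mul]
    rw [Finset.sum_comm]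
    rw [Finset.sum_congr rfl fun C _ => Finset.sum_comm]
    rw [Finset.sum_comm]
    refine Finset.sum_congr rfl fun A _ => ?_
    rw [Finset.sum_congr rfl fun C _ => Finset.sum_comm, Finset.sum_comm]
    refine Finset.sum_congr rfl fun B _ => Finset.sum_congr rfl fun C _ =>
      Finset.sum_congr rfl fun X _ => by ring
  have e2 : ∑ B, ∑ X, ∑ A, ∑ C, eps B D X * g B * (eps A X C * f A * h C)
      = ∑ A, ∑ B, ∑ C, (∑ X, eps B D X * eps A X C) * f A * g B * h C := by
    simp only [Finset.sum_mul]
    rw [Finset.sum_congr rfl fun B _ => Finset.sum_comm, Finset.sum_comm]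
    refine Finset.sum_congr rfl fun A _ => Finset.sum_congr rfl fun B _ => ?_
    rw [Finset.sum_comm]
    refine Finset.sum_congr rfl fun C _ => Finset.sum_congr rfl fun X _ => by ring
  rw [e1, e2]
  simp only [eps_assoc]

/-! ### Homogeneous elements, generators and the antiderivation property. -/

/-- `f` is homogeneous of degree `k`. -/
def Hom (k : ℕ) (f : GA n) : Prop := ∀ A, A.card ≠ k → f A = 0

theorem Hom.add {k : ℕ} {f g : GA n} (hf : Hom k f) (hg : Hom k g) : Hom k (f + g) :=
  fun A hA => by simp [hf A hA, hg A hA]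
theorem Hom.sub {k : ℕ} {f g : GA n} (hf : Hom k f) (hg : Hom k g) : Hom k (f - g) :=
  fun A hA => by simp [hf A hA, hg A hA]
theorem Hom.smul {k : ℕ} {f : GA n} (c : ℝ) (hf : Hom k f) : Hom k (c • f) :=
  fun A hA => by simp [hf A hA]
theorem Hom.neg {k : ℕ} {f : GA n} (hf : Hom k f) : Hom k (-f) :=
  fun A hA => by simp [hf A hA]
theorem Hom.zero {k : ℕ} : Hom k (0 : GA n) := fun _ _ => rfl
theorem Hom.sum {k : ℕ} {ι : Type*} {s : Finset ι} {f : ι → GA n} (h : ∀ i ∈ s, Hom k (f i)) :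
    Hom k (∑ i ∈ s, f i) := fun A hA => by
  rw [GA.sum_apply]; exact Finset.sum_eq_zero fun i hi => h i hi A hA

theorem eps_eq_zero_of_card {A B C : Finset (Fin n)} (h : A.card + B.card ≠ C.card) :
    eps A B C = 0 := by
  rw [eps_eq, if_neg]
  rintro ⟨h1, rfl⟩
  exact h (Finset.card_union_of_disjoint h1).symm

theorem Hom.mul {k l : ℕ} {f g : GA n} (hf : Hom k f) (hg : Hom l g) : Hom (k + l) (f * g) := by
  intro C hC
  rw [GA.mul_apply]
  refine Finset.sum_eq_zero fun A _ => Finset.sum_eq_zero fun B _ => ?_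
  by_cases hA : A.card = k
  · by_cases hB : B.card = l
    · rw [eps_eq_zero_of_card (by omega)]; simp
    · rw [hg B hB, mul_zero]
  · rw [hf A hA]; simp

theorem Hom.contraction {k l : ℕ} {f g : GA n} (hf : Hom k f) (hg : Hom (l + k) g) :
    Hom l (con f g) := by
  intro B hB
  rw [con_apply]
  refine Finset.sum_eq_zero fun A _ => Finset.sum_eq_zero fun C _ => ?_
  by_cases hA : A.card = k
  · by_cases hC : C.card = l + k
    · rw [eps_eq_zero_of_card (by omega)]; simp
    · rw [hg C hC, mul_zero]
  · rw [hf A hA]; simp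

theorem Hom.eq_zero {k : ℕ} {f : GA n} (hf : Hom k f) (h : n < k) : f = 0 := by
  ext A
  refine hf A ?_
  have := A.card_le_univ
  simp only [Fintype.card_fin] at this
  omega

theorem Hom.comm {k l : ℕ} {f g : GA n} (hf : Hom k f) (hg : Hom l g) :
    f * g = (-1 : ℝ) ^ (k * l) • (g * f) := by
  ext C
  simp only [GA.mul_apply, GA.smul_apply, Finset.mul_sum]
  rw [Finset.sum_comm]
  refine Finset.sum_congr rfl fun B _ => Finset.sum_congr rfl fun A _ => ?_
  by_cases hA : A.card = k
  · by_cases hB : B.card = l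
    · rw [eps_comm, hA, hB]; ring
    · rw [hg B hB]; simp
  · rw [hf A hA]; simp

/-- The `i`-th generator. -/
def gen (i : Fin n) : GA n := ⟨Pi.single {i} 1⟩

theorem gen_apply (i : Fin n) (A : Finset (Fin n)) : gen i A = if A = {i} then 1 else 0 := by
  change (Pi.single {i} 1 : Finset (Fin n) → ℝ) A = _
  rw [Pi.single_apply]

theorem hom_gen (i : Fin n) : Hom 1 (gen i) := fun A hA => by
  rw [gen_apply, if_neg]; rintro rfl; simp at hA

theorem con_gen_apply (i : Fin n) (g : GA n) (B : Finset (Fin n)) :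
    con (gen i) g B = ∑ C, eps {i} B C * g C := by
  rw [con_apply, Finset.sum_eq_single {i}]
  · simp [gen_apply]
  · intro A _ hA; simp [gen_apply, hA]
  · simp

theorem con_gen_apply' (i : Fin n) (g : GA n) (B : Finset (Fin n)) :
    con (gen i) g B = if i ∈ B then 0 else sgn {i} B * g (insert i B) := by
  rw [con_gen_apply, sum_eps_mul]
  simp only [Finset.disjoint_singleton_left, ← Finset.insert_eq, ite_not]

theorem gen_mul_apply (i : Fin n) (g : GA n) (C : Finset (Fin n)) :
    (gen i * g) C = if i ∈ C then sgn {i} (C.erase i) * g (C.erase i) else 0 := by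
  rw [← sum_eps_singleton_mul i C g.coeff, GA.mul_apply, Finset.sum_eq_single {i}]
  · simp [gen_apply]
  · intro A _ hA; simp [gen_apply, hA]
  · simp

theorem con_gen_mul {k : ℕ} (i : Fin n) {f : GA n} (hf : Hom k f) (g : GA n) :
    con (gen i) (f * g) = con (gen i) f * g + (-1 : ℝ) ^ k • (f * con (gen i) g) := by
  ext D
  have key : ∀ A B, (∑ C, eps {i} D C * eps A B C) * f A * g B
      = (∑ A', eps {i} A' A * eps A' B D) * f A * g B
        + (-1) ^ k * (∑ B', eps {i} B' B * eps A B' D) * f A * g B := by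
    intro A B
    by_cases hA : A.card = k
    · rw [eps_contract, hA]; ring
    · rw [hf A hA]; simp
  have e1 : con (gen i) (f * g) D = ∑ A, ∑ B, (∑ C, eps {i} D C * eps A B C) * f A * g B := by
    simp only [con_gen_apply, GA.mul_apply, Finset.mul_sum, Finset.sum_mul]
    rw [Finset.sum_comm]
    refine Finset.sum_congr rfl fun A _ => ?_
    rw [Finset.sum_comm]
    refine Finset.sum_congr rfl fun B _ => Finset.sum_congr rfl fun C _ => by ring
  have e2 : (con (gen i) f * g) D
      = ∑ A, ∑ B, (∑ A', eps {i} A' A * eps A' B D) * f A * g B := by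
    simp only [con_gen_apply, GA.mul_apply, Finset.mul_sum, Finset.sum_mul]
    rw [Finset.sum_congr rfl fun A' _ => Finset.sum_comm, Finset.sum_comm]
    refine Finset.sum_congr rfl fun A _ => ?_
    rw [Finset.sum_comm]
    refine Finset.sum_congr rfl fun B _ => Finset.sum_congr rfl fun C _ => by ring
  have e3 : (f * con (gen i) g) D
      = ∑ A, ∑ B, (∑ B', eps {i} B' B * eps A B' D) * f A * g B := by
    simp only [con_gen_apply, GA.mul_apply, Finset.mul_sum, Finset.sum_mul]
    refine Finset.sum_congr rfl fun A _ => ?_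
    rw [Finset.sum_comm]
    refine Finset.sum_congr rfl fun B _ => Finset.sum_congr rfl fun C _ => by ring
  rw [GA.add_apply, GA.smul_apply, e1, e2, e3, Finset.mul_sum, ← Finset.sum_add_distrib]
  refine Finset.sum_congr rfl fun A _ => ?_
  rw [Finset.mul_sum, ← Finset.sum_add_distrib]
  refine Finset.sum_congr rfl fun B _ => ?_
  rw [key]; ring

theorem Hom.eq_sum_gen {f : GA n} (hf : Hom 1 f) : f = ∑ i, f {i} • gen i := by
  ext A
  simp only [GA.sum_apply, GA.smul_apply, gen_apply]
  by_cases hA : A.card = 1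
  · obtain ⟨i, rfl⟩ := Finset.card_eq_one.1 hA
    simp
  · rw [hf A hA, Finset.sum_eq_zero]
    rintro i -
    rw [if_neg, mul_zero]; rintro rfl; simp at hA

theorem con_eq_sum {X : GA n} (hX : Hom 1 X) (g : GA n) :
    con X g = ∑ i, X {i} • con (gen i) g := by
  have h : con (∑ i, X {i} • gen i) = ∑ i, X {i} • con (gen i) := by
    let φ : GA n →ₗ[ℝ] (GA n →ₗ[ℝ] GA n) := ⟨⟨con, con_add⟩, con_smul⟩
    have : φ (∑ i, X {i} • gen i) = ∑ i, X {i} • φ (gen i) := by simp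
    exact this
  conv_lhs => rw [hX.eq_sum_gen, h]
  simp

/-- Contraction by a vector is an antiderivation. -/
theorem con_one_mul {k : ℕ} {X : GA n} (hX : Hom 1 X) {f : GA n} (hf : Hom k f) (g : GA n) :
    con X (f * g) = con X f * g + (-1 : ℝ) ^ k • (f * con X g) := by
  simp only [con_eq_sum hX, con_gen_mul _ hf, smul_add, Finset.sum_add_distrib, Finset.sum_mul,
    Finset.mul_sum, smul_mul_assoc, mul_smul_comm, Finset.smul_sum]
  congr 1
  exact Finset.sum_congr rfl fun i _ => smul_comm _ _ _

/-- The number operator. -/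
theorem sum_gen_mul_con {k : ℕ} {f : GA n} (hf : Hom k f) :
    ∑ i, gen i * con (gen i) f = (k : ℝ) • f := by
  ext A
  simp only [GA.sum_apply, gen_mul_apply, con_gen_apply', GA.smul_apply]
  have : ∀ i, (if i ∈ A then sgn {i} (A.erase i) * (if i ∈ A.erase i then 0 else
      sgn {i} (A.erase i) * f (insert i (A.erase i))) else 0) = if i ∈ A then f A else 0 := by
    intro i
    split_ifs with h1 h2
    · simp at h2
    · rw [Finset.insert_erase h1, ← mul_assoc, sgn_mul_self, one_mul]
    · rfl
  rw [Finset.sum_congr rfl fun i _ => this i]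
  by_cases hA : A.card = k
  · simp [hA]
  · simp [hf A hA]

theorem con_swap {X Y : GA n} (hX : Hom 1 X) (hY : Hom 1 Y) (f : GA n) :
    con X (con Y f) = -con Y (con X f) := by
  rw [← con_mul, ← con_mul, hX.comm hY, con_smul]; simp

theorem con_con_self {X : GA n} (hX : Hom 1 X) (f : GA n) : con X (con X f) = 0 := by
  have h : (2 : ℝ) • con X (con X f) = 0 := by
    rw [two_smul]; nth_rewrite 1 [con_swap hX hX f]; simp
  simpa using h

theorem con_gen_gen (i j : Fin n) : con (gen i) (gen j) = if i = j then (1 : GA n) else 0 := by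
  ext B
  rw [con_gen_apply', gen_apply]
  by_cases hB : B = ∅
  · subst hB
    by_cases h : i = j
    · simp [h, GA.one_apply]
    · simp [h]
  · have h1 : (if i = j then (1 : GA n) else 0) B = 0 := by
      split_ifs <;> simp [GA.one_apply, hB]
    rw [h1]
    split_ifs with h2 h3
    · rfl
    · exfalso
      obtain ⟨x, hx⟩ := Finset.nonempty_iff_ne_empty.2 hB
      have hx' : x = j := by simpa [h3] using Finset.mem_insert_of_mem (a := x) (b := i) hx
      have hi' : i = j := by simpa [h3] using Finset.mem_insert_self i B
      exact h2 (hi' ▸ hx' ▸ hx)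
    · simp

theorem gen_mul_gen (i j : Fin n) : gen i * gen j = -(gen j * gen i) := by
  rw [(hom_gen i).comm (hom_gen j)]; simp

/-- Two elements of positive degree agree if all their contractions by generators do. -/
theorem Hom.eq_of_con {k : ℕ} {f g : GA n} (hf : Hom (k + 1) f) (hg : Hom (k + 1) g)
    (h : ∀ i, con (gen i) f = con (gen i) g) : f = g := by
  have h1 := sum_gen_mul_con hf
  have h2 := sum_gen_mul_con hg
  simp only [h] at h1
  have : ((k + 1 : ℕ) : ℝ) ≠ 0 := by positivity
  exact smul_right_injective _ this (h1.symm.trans h2)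

/-! ### Forms as elements of the Grassmann algebra -/

/-- A `k`-form or a `k`-vector as an element of the Grassmann algebra. -/
def toGA (k : ℕ) : Ext n k →ₗ[ℝ] GA n where
  toFun α := ⟨fun A => if h : A.card = k then α ⟨A, h⟩ else 0⟩
  map_add' α β := by
    ext A
    change (if h : A.card = k then (α + β) ⟨A, h⟩ else 0) = (if h : A.card = k then α ⟨A, h⟩ else 0)
      + (if h : A.card = k then β ⟨A, h⟩ else 0)
    split_ifs <;> simp
  map_smul' c α := by
    ext A
    change (if h : A.card = k then (c • α) ⟨A, h⟩ else 0)
      = c * (if h : A.card = k then α ⟨A, h⟩ else 0)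
    split_ifs <;> simp

theorem toGA_apply {k : ℕ} (α : Ext n k) (A : Finset (Fin n)) :
    toGA k α A = if h : A.card = k then α ⟨A, h⟩ else 0 := rfl

@[simp] theorem toGA_apply_coe {k : ℕ} (α : Ext n k) (A : Idx n k) : toGA k α A.1 = α A := by
  rw [toGA_apply, dif_pos (show A.1.card = k from A.2)]

theorem hom_toGA {k : ℕ} (α : Ext n k) : Hom k (toGA k α) := fun A hA => by
  rw [toGA_apply, dif_neg hA]

theorem toGA_injective (k : ℕ) : Function.Injective (toGA (n := n) k) := fun α β h => by
  ext A; rw [← toGA_apply_coe α, h, toGA_apply_coe]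

/-- The degree `k` part of an element of the Grassmann algebra. -/
def ofGA (k : ℕ) : GA n →ₗ[ℝ] Ext n k where
  toFun f A := f A.1
  map_add' _ _ := rfl
  map_smul' _ _ := rfl

theorem toGA_ofGA {k : ℕ} {f : GA n} (hf : Hom k f) : toGA k (ofGA k f) = f := by
  ext A; rw [toGA_apply]
  split_ifs with h
  · rfl
  · rw [hf A h]

/-- Trades sums over `k`-element subsets for sums over all subsets. This is what turns `wedge` and
`contract` into operations of `GA n`. -/
theorem sum_idx {k : ℕ} (F : Finset (Fin n) → ℝ) (hF : ∀ A, A.card ≠ k → F A = 0) :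
    ∑ A : Idx n k, F A.1 = ∑ A, F A := by
  have h := Finset.sum_subtype (F := inferInstanceAs (Fintype (Idx n k))) (p := fun A => A ∈ Set.powersetCard (Fin n) k)
    (Finset.univ.filter fun A : Finset (Fin n) => A.card = k)
    (by simp [Set.powersetCard.mem_iff]) F
  rw [Finset.sum_filter_of_ne (fun A _ h => by by_contra h'; exact h (hF A h'))] at h
  rw [h]

theorem toGA_wedge {k l : ℕ} (α : Ext n k) (β : Ext n l) :
    toGA (k + l) (wedge α β) = toGA k α * toGA l β := by
  ext C
  by_cases hC : C.card = k + l
  · rw [toGA_apply, dif_pos hC, GA.mul_apply, ← sum_idx (k := k)]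
    · refine Finset.sum_congr rfl fun A _ => ?_
      rw [← sum_idx (k := l)]
      · simp
      · intro B hB; rw [hom_toGA β B hB, mul_zero]
    · intro A hA; simp [hom_toGA α A hA]
  · rw [hom_toGA _ C hC, (hom_toGA α).mul (hom_toGA β) C hC]

theorem toGA_contract {k l : ℕ} (w : Ext n k) (α : Ext n (l + k)) :
    toGA l (contract w α) = con (toGA k w) (toGA (l + k) α) := by
  ext B
  by_cases hB : B.card = l
  · rw [toGA_apply, dif_pos hB, con_apply, ← sum_idx (k := k)]
    · refine Finset.sum_congr rfl fun A _ => ?_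
      rw [← sum_idx (k := l + k)]
      · simp
      · intro C hC; rw [hom_toGA α C hC, mul_zero]
    · intro A hA; simp [hom_toGA w A hA]
  · rw [hom_toGA _ B hB, (hom_toGA w).contraction (hom_toGA α) B hB]

/-- The index of the `i`-th basis vector. -/
def ix (i : Fin n) : Idx n 1 := ⟨{i}, Finset.card_singleton i⟩

/-- The indices of the basis vectors. -/
def ixEquiv : Fin n ≃ Idx n 1 :=
  Equiv.ofBijective ix ⟨fun i j h => Finset.singleton_injective (congrArg Subtype.val h),
    fun A => by
      obtain ⟨i, hi⟩ := Finset.card_eq_one.1 A.2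
      exact ⟨i, Subtype.ext hi.symm⟩⟩

@[simp] theorem ixEquiv_apply (i : Fin n) : ixEquiv i = ix i := rfl

theorem ix_surj (A : Idx n 1) : ∃ i, A = ix i := ⟨ixEquiv.symm A, (ixEquiv.apply_symm_apply A).symm⟩

@[simp] theorem ix_inj {i j : Fin n} : ix i = ix j ↔ i = j := ixEquiv.injective.eq_iff

theorem sum_ix {W : Type*} [AddCommMonoid W] (F : Idx n 1 → W) : ∑ A, F A = ∑ i, F (ix i) :=
  (ixEquiv.sum_comp F).symm

theorem toGA_single {k : ℕ} (A : Idx n k) (c : ℝ) (B : Finset (Fin n)) :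
    toGA k (Pi.single A c) B = if B = A.1 then c else 0 := by
  rw [toGA_apply]
  by_cases h : B = A.1
  · subst h
    rw [dif_pos (show A.1.card = k from A.2), if_pos rfl]
    exact Pi.single_eq_same (M := fun _ : Idx n k => ℝ) A c
  · rw [if_neg h]
    split_ifs with h1
    · rw [Pi.single_eq_of_ne]
      intro h2; exact h (congrArg Subtype.val h2)
    · rfl

@[simp] theorem toGA_basisVec (i : Fin n) : toGA 1 (basisVec (ix i)) = gen i := by
  ext A
  rw [basisVec, toGA_single, gen_apply]; rfl

/-! ### The inner product, for which multiplication and contraction are adjoint. -/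

/-- The standard inner product on the Grassmann algebra. -/
def dotG (f g : GA n) : ℝ := ∑ A, f A * g A

theorem dotG_add_left (f f' g : GA n) : dotG (f + f') g = dotG f g + dotG f' g := by
  simp [dotG, add_mul, Finset.sum_add_distrib]
theorem dotG_add_right (f g g' : GA n) : dotG f (g + g') = dotG f g + dotG f g' := by
  simp [dotG, mul_add, Finset.sum_add_distrib]
theorem dotG_smul_left (c : ℝ) (f g : GA n) : dotG (c • f) g = c * dotG f g := by
  simp [dotG, Finset.mul_sum, mul_assoc]
theorem dotG_smul_right (c : ℝ) (f g : GA n) : dotG f (c • g) = c * dotG f g := by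
  simp [dotG, Finset.mul_sum, mul_left_comm]
theorem dotG_neg_left (f g : GA n) : dotG (-f) g = -dotG f g := by simp [dotG]
theorem dotG_neg_right (f g : GA n) : dotG f (-g) = -dotG f g := by simp [dotG]
theorem dotG_sub_left (f f' g : GA n) : dotG (f - f') g = dotG f g - dotG f' g := by
  simp [dotG, sub_mul]
theorem dotG_sub_right (f g g' : GA n) : dotG f (g - g') = dotG f g - dotG f g' := by
  simp [dotG, mul_sub]
@[simp] theorem dotG_zero_left (g : GA n) : dotG 0 g = 0 := by simp [dotG]
@[simp] theorem dotG_zero_right (g : GA n) : dotG g 0 = 0 := by simp [dotG]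
theorem dotG_comm (f g : GA n) : dotG f g = dotG g f := by simp [dotG, mul_comm]
theorem dotG_sum_right {ι : Type*} (s : Finset ι) (f : GA n) (g : ι → GA n) :
    dotG f (∑ i ∈ s, g i) = ∑ i ∈ s, dotG f (g i) := by
  let φ : GA n →+ ℝ := ⟨⟨dotG f, dotG_zero_right f⟩, dotG_add_right f⟩
  exact map_sum φ g s

/-- Product and contraction use the same structure constants. Every transposition between `E` and
`E*` below rests on this adjunction. -/
theorem dotG_mul_left (w f g : GA n) : dotG (w * f) g = dotG f (con w g) := by
  simp only [dotG, GA.mul_apply, con_apply, Finset.sum_mul, Finset.mul_sum]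
  rw [Finset.sum_comm' (t' := Finset.univ) (s' := fun _ => Finset.univ) (by simp)]
  rw [Finset.sum_congr rfl fun A _ => Finset.sum_comm, Finset.sum_comm]
  refine Finset.sum_congr rfl fun B _ => Finset.sum_congr rfl fun A _ =>
    Finset.sum_congr rfl fun C _ => by ring

theorem sum_mul_eq_dotG {k : ℕ} (α β : Ext n k) : ∑ A, α A * β A = dotG (toGA k α) (toGA k β) := by
  rw [dotG, ← sum_idx (k := k)]
  · simp
  · intro A hA; rw [hom_toGA α A hA, zero_mul]

theorem eq_of_dotG {f g : GA n} (h : ∀ x, dotG x f = dotG x g) : f = g := by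
  ext A
  have := h ⟨Pi.single A 1⟩
  simpa [dotG, Pi.single_apply] using this

theorem dotG_con {k : ℕ} {a f : GA n} (hf : Hom k f) {x : GA n} (hx : Hom 1 x) :
    dotG f (con x a) = (-1 : ℝ) ^ k * dotG x (con f a) := by
  rw [← dotG_mul_left, ← dotG_mul_left, hx.comm hf, dotG_smul_left, one_mul]

/-! ### Identities for contractions -/

theorem Hom.eq_smul_one {f : GA n} (hf : Hom 0 f) : f = f ∅ • (1 : GA n) := by
  ext A
  rw [GA.smul_apply, GA.one_apply]
  by_cases h : A = ∅
  · simp [h]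
  · rw [hf A (by simpa using h)]; simp [h]

theorem hom_con_gen {k : ℕ} {f : GA n} (hf : Hom (k + 1) f) (i : Fin n) : Hom k (con (gen i) f) :=
  (hom_gen i).contraction hf

theorem con_gen_hom_zero {f : GA n} (hf : Hom 0 f) (i : Fin n) : con (gen i) f = 0 := by
  rw [hf.eq_smul_one, map_smul]
  suffices con (gen i) (1 : GA n) = 0 by rw [this, smul_zero]
  ext B
  rw [con_gen_apply', GA.one_apply]; simp

theorem con_gen_mul_even {k : ℕ} (hk : Even k) (i : Fin n) {f : GA n} (hf : Hom k f) (g : GA n) :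
    con (gen i) (f * g) = con (gen i) f * g + f * con (gen i) g := by
  rw [con_gen_mul i hf, hk.neg_one_pow, one_smul]

theorem con_gen_mul_odd {k : ℕ} (hk : Odd k) (i : Fin n) {f : GA n} (hf : Hom k f) (g : GA n) :
    con (gen i) (f * g) = con (gen i) f * g - f * con (gen i) g := by
  rw [con_gen_mul i hf, hk.neg_one_pow, neg_one_smul, sub_eq_add_neg]

theorem Hom.comm_even {k l : ℕ} {f g : GA n} (hf : Hom k f) (hg : Hom l g) (h : Even (k * l)) :
    f * g = g * f := by
  rw [hf.comm hg, h.neg_one_pow, one_smul]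

theorem Hom.comm_odd {k l : ℕ} {f g : GA n} (hf : Hom k f) (hg : Hom l g) (h : Odd (k * l)) :
    f * g = -(g * f) := by
  rw [hf.comm hg, h.neg_one_pow, neg_one_smul]

theorem dotG_gen (i : Fin n) (f : GA n) : dotG (gen i) f = f {i} := by
  simp [dotG, gen_apply]

theorem dotG_one (f : GA n) : dotG 1 f = f ∅ := by
  simp [dotG, GA.one_apply]

/-- The coefficient at a generator is found by pairing with that generator. Adjunction turns it into
the pairing of `s` with a contraction of the trivector, which has three terms. -/
theorem con_two_gen_three {s : GA n} (hs : Hom 2 s) (x y z : Fin n) :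
    con s (gen x * gen y * gen z) = (con (gen z) (con (gen y) s)) ∅ • gen x
      - (con (gen z) (con (gen x) s)) ∅ • gen y + (con (gen y) (con (gen x) s)) ∅ • gen z := by
  have h1 : Hom 1 (con s (gen x * gen y * gen z)) :=
    hs.contraction (k := 2) (l := 1) (((hom_gen x).mul (hom_gen y)).mul (hom_gen z))
  have h2 : ∀ y z : Fin n, dotG s (gen y * gen z) = (con (gen z) (con (gen y) s)) ∅ := by
    intro y z
    rw [dotG_comm, dotG_mul_left, ← mul_one (gen z), dotG_mul_left, dotG_one, mul_one]
  have h3 : ∀ i, (con s (gen x * gen y * gen z)) {i} = dotG s (con (gen i)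
      (gen x * gen y * gen z)) := by
    intro i
    rw [← dotG_gen, ← dotG_mul_left, ← dotG_mul_left, hs.comm_even (hom_gen i) (by decide)]
  have h4 : ∀ i, con (gen i) (gen x * gen y * gen z) = (if i = x then gen y * gen z else 0)
      - (if i = y then gen x * gen z else 0) + (if i = z then gen x * gen y else 0) := by
    intro i
    rw [con_gen_mul_even (by decide) i ((hom_gen x).mul (hom_gen y)),
      con_gen_mul_odd (by decide) i (hom_gen x), con_gen_gen, con_gen_gen, con_gen_gen, sub_mul]
    simp only [ite_mul, mul_ite, one_mul, mul_one, zero_mul, mul_zero]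
  rw [h1.eq_sum_gen]
  simp only [h3, h4, dotG_add_right, dotG_sub_right, apply_ite (dotG s), dotG_zero_right, h2,
    add_smul, sub_smul, ite_smul, zero_smul, Finset.sum_add_distrib, Finset.sum_sub_distrib,
    Finset.sum_ite_eq', Finset.mem_univ, if_true]

theorem con_neg (f : GA n) : con (-f) = -con f := by
  rw [← neg_one_smul ℝ f, con_smul, neg_one_smul]

theorem con_sub (f g : GA n) : con (f - g) = con f - con g := by
  rw [sub_eq_add_neg, con_add, con_neg, sub_eq_add_neg]

theorem con_gen_three (x y z : Fin n) (f : GA n) :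
    con (gen x * gen y * gen z) f = con (gen z) (con (gen y) (con (gen x) f)) := by
  rw [con_mul, con_mul]

theorem Hom.scalar_mul {f : GA n} (hf : Hom 0 f) (g : GA n) : f * g = f ∅ • g := by
  conv_lhs => rw [hf.eq_smul_one]
  rw [smul_mul_assoc, one_mul]

theorem Hom.mul_scalar {f : GA n} (hf : Hom 0 f) (g : GA n) : g * f = f ∅ • g := by
  conv_lhs => rw [hf.eq_smul_one]
  rw [mul_smul_comm, mul_one]

theorem con_con_gen_three {s : GA n} (hs : Hom 2 s) (x y z : Fin n) (t : GA n) :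
    con (con s (gen x * gen y * gen z)) t = con (gen z) (con (gen y) s) * con (gen x) t
      - con (gen z) (con (gen x) s) * con (gen y) t
      + con (gen y) (con (gen x) s) * con (gen z) t := by
  have h : ∀ y z : Fin n, Hom 0 (con (gen z) (con (gen y) s)) := fun y z =>
    hom_con_gen (hom_con_gen hs y) z
  rw [con_two_gen_three hs, (h y z).scalar_mul, (h x z).scalar_mul, (h x y).scalar_mul]
  simp only [con_add, con_sub, con_smul, LinearMap.add_apply, LinearMap.sub_apply,
    LinearMap.smul_apply]

/-- The eight terms are the ways of distributing three contractions over two factors. Evenness of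
the degree makes all signs explicit. -/
theorem con_three_mul {k : ℕ} (hk : Even k) {s t : GA n} (hs : Hom (k + 2) s) (x y z : Fin n) :
    con (gen z) (con (gen y) (con (gen x) (s * t))) =
      con (gen z) (con (gen y) (con (gen x) s)) * t + con (gen y) (con (gen x) s) * con (gen z) t
      - con (gen z) (con (gen x) s) * con (gen y) t + con (gen x) s * con (gen z) (con (gen y) t)
      + con (gen z) (con (gen y) s) * con (gen x) t - con (gen y) s * con (gen z) (con (gen x) t)
      + con (gen z) s * con (gen y) (con (gen x) t)
      + s * con (gen z) (con (gen y) (con (gen x) t)) := by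
  have hk1 : Odd (k + 1) := hk.add_one
  have hk2 : Even (k + 2) := hk.add (by decide)
  rw [con_gen_mul_even hk2 x hs, map_add, con_gen_mul_odd hk1 y (hom_con_gen hs x),
    con_gen_mul_even hk2 y hs, map_add, map_sub, map_add,
    con_gen_mul_even hk z (hom_con_gen (hom_con_gen hs x) y),
    con_gen_mul_odd hk1 z (hom_con_gen hs x), con_gen_mul_odd hk1 z (hom_con_gen hs y),
    con_gen_mul_even hk2 z hs]
  abel

/-- Three contractions annihilate a 2-form. The six surviving terms of the expansion agree in pairs
because twofold contractions of `s` are scalars. -/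
theorem con_con_self_two {s : GA n} (hs : Hom 2 s) (x y z : Fin n) :
    con (gen z) (con (gen y) (con (gen x) (s * s))) =
      (2 : ℝ) • con (con s (gen x * gen y * gen z)) s := by
  have h : ∀ y z : Fin n, Hom 0 (con (gen z) (con (gen y) s)) := fun y z =>
    hom_con_gen (hom_con_gen hs y) z
  rw [con_three_mul (k := 0) (by decide) hs, con_con_gen_three hs,
    con_gen_hom_zero (h x y) z]
  simp only [(h _ _).scalar_mul, (h _ _).mul_scalar, zero_mul, mul_zero, zero_add, add_zero,
    two_smul]
  abel

/-- The product has degree six, so the degree alone does not annihilate it when `n = 6`. It vanishes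
because it equals its own negative, which follows by shifting the four contractions from one factor
to the other. -/
theorem con_three_five_mul_self (hn : n ≤ 6) {t : GA n} (ht : Hom 5 t) (x y z i : Fin n) :
    con (gen i) (con (gen z) (con (gen y) (con (gen x) t))) * t = 0 := by
  have v : ∀ {k l : ℕ} {f g : GA n}, Hom k f → Hom l g → k + l = 7 → f * g = 0 :=
    fun hf hg h => (hf.mul hg).eq_zero (by omega)
  have tx := hom_con_gen ht x
  have tyx := hom_con_gen tx y
  have tzyx := hom_con_gen tyx z
  have ti := hom_con_gen ht i
  have tzi := hom_con_gen ti z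
  have tyzi := hom_con_gen tzi y
  -- Each of the next four products has degree seven and is therefore zero. Contracting it moves one
  -- contraction across.
  have e1 := congrArg (con (gen i)) (v tzyx ht rfl)
  rw [con_gen_mul_even (by decide) i tzyx, map_zero] at e1
  have e2 := congrArg (con (gen z)) (v tyx ti rfl)
  rw [con_gen_mul_odd (by decide) z tyx, map_zero] at e2
  have e3 := congrArg (con (gen y)) (v tx tzi rfl)
  rw [con_gen_mul_even (by decide) y tx, map_zero] at e3
  have e4 := congrArg (con (gen x)) (v ht tyzi rfl)
  rw [con_gen_mul_odd (by decide) x ht, map_zero] at e4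
  have sw : ∀ (a b : Fin n) (f : GA n), con (gen a) (con (gen b) f) = -con (gen b) (con (gen a) f) :=
    fun a b f => con_swap (hom_gen a) (hom_gen b) f
  -- Reversing four anticommuting contractions is an even permutation.
  have e5 : con (gen x) (con (gen y) (con (gen z) (con (gen i) t)))
      = con (gen i) (con (gen z) (con (gen y) (con (gen x) t))) := by
    rw [sw z i t, map_neg, map_neg, sw y i, map_neg, neg_neg, sw x i, sw y z, map_neg, map_neg,
      neg_neg, sw x z, map_neg, sw x y, map_neg, map_neg, neg_neg]
  rw [e5, ht.comm_odd (hom_con_gen tzyx i) (by decide), sub_neg_eq_add] at e4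
  -- The four relations telescope when added with alternating signs.
  have h2 : (2 : ℝ) • (con (gen i) (con (gen z) (con (gen y) (con (gen x) t))) * t) = 0 := by
    rw [two_smul]
    calc _ = (con (gen i) (con (gen z) (con (gen y) (con (gen x) t))) * t
        + con (gen z) (con (gen y) (con (gen x) t)) * con (gen i) t)
        - (con (gen z) (con (gen y) (con (gen x) t)) * con (gen i) t
          - con (gen y) (con (gen x) t) * con (gen z) (con (gen i) t))
        - (con (gen y) (con (gen x) t) * con (gen z) (con (gen i) t)
          + con (gen x) t * con (gen y) (con (gen z) (con (gen i) t)))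
        + (con (gen x) t * con (gen y) (con (gen z) (con (gen i) t))
          + con (gen i) (con (gen z) (con (gen y) (con (gen x) t))) * t) := by abel
      _ = 0 := by rw [e1, e2, e3, e4]; simp
  simpa using h2

/-- This is the `⋀⁴` component of the equivariance of `E* ⊗ E* → N*` under a 3-vector. The two sides
differ by the triple contraction of `s * t`, an element of degree seven. -/
theorem sum_gen_mul_con_three (hn : n ≤ 6) {s t : GA n} (hs : Hom 2 s) (ht : Hom 5 t)
    (x y z : Fin n) :
    ∑ i, gen i * con (gen z) (con (gen y) (con (gen x) (con (gen i) s * t)))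
      = con (con s (gen x * gen y * gen z)) t - con (gen z) (con (gen y) (con (gen x) t)) * s := by
  have sc : ∀ y z : Fin n, Hom 0 (con (gen z) (con (gen y) s)) := fun y z =>
    hom_con_gen (hom_con_gen hs y) z
  have e : ∀ i, con (gen z) (con (gen y) (con (gen x) (con (gen i) s * t)))
      = con (gen x) (con (gen i) s) * con (gen z) (con (gen y) t)
        - con (gen y) (con (gen i) s) * con (gen z) (con (gen x) t)
        + con (gen z) (con (gen i) s) * con (gen y) (con (gen x) t)
        - con (gen i) s * con (gen z) (con (gen y) (con (gen x) t)) := by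
    intro i
    have si := hom_con_gen hs i
    rw [con_gen_mul_odd (by decide) x si, map_sub, con_gen_mul_even (by decide) y (sc i x),
      con_gen_mul_odd (by decide) y si, con_gen_hom_zero (sc i x), zero_mul, zero_add, map_sub,
      map_sub, con_gen_mul_even (by decide) z (sc i x), con_gen_mul_even (by decide) z (sc i y),
      con_gen_mul_odd (by decide) z si, con_gen_hom_zero (sc i x), con_gen_hom_zero (sc i y),
      zero_mul, zero_mul]
    abel
  have f : ∀ a, ∑ i, gen i * con (gen a) (con (gen i) s) = -con (gen a) s := by
    intro a
    have h := sum_gen_mul_con (hom_con_gen hs a)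
    simp only [con_swap (hom_gen a) (hom_gen _), mul_neg, Finset.sum_neg_distrib, h]
    simp
  have g := sum_gen_mul_con hs
  have z7 : s * t = 0 := (hs.mul ht).eq_zero (by omega)
  have e0 := con_three_mul (k := 0) (t := t) (by decide) hs x y z
  rw [z7, con_gen_hom_zero (sc x y) z] at e0
  simp only [map_zero, zero_mul] at e0
  have tt := hom_con_gen (hom_con_gen (hom_con_gen ht x) y) z
  simp only [e, mul_add, mul_sub, Finset.sum_add_distrib, Finset.sum_sub_distrib, ← mul_assoc,
    ← Finset.sum_mul, f, g]
  rw [con_con_gen_three hs, tt.comm_even hs (by decide), Nat.cast_ofNat, two_smul]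
  rw [← sub_eq_zero]
  rw [← neg_eq_zero, e0]
  noncomm_ring

/-! ### The representations `E` and `N` inside the Grassmann algebra -/

/-- The component in `T`. -/
def pr1 : E n →ₗ[ℝ] GA n := toGA 1 ∘ₗ LinearMap.fst ℝ _ _
/-- The component in `⋀² T*`. -/
def pr2 : E n →ₗ[ℝ] GA n := toGA 2 ∘ₗ LinearMap.fst ℝ _ _ ∘ₗ LinearMap.snd ℝ _ _
/-- The component in `⋀⁵ T*`. -/
def pr5 : E n →ₗ[ℝ] GA n := toGA 5 ∘ₗ LinearMap.snd ℝ _ _ ∘ₗ LinearMap.snd ℝ _ _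
/-- The component in `T*`. -/
def qr1 : N n →ₗ[ℝ] GA n := toGA 1 ∘ₗ LinearMap.fst ℝ _ _
/-- The component in `⋀⁴ T*`. -/
def qr4 : N n →ₗ[ℝ] GA n := toGA 4 ∘ₗ LinearMap.fst ℝ _ _ ∘ₗ LinearMap.snd ℝ _ _
/-- The components in `T* ⊗ ⋀⁶ T*`. -/
def qr6 (i : Fin n) : N n →ₗ[ℝ] GA n :=
  toGA 6 ∘ₗ LinearMap.proj (ix i) ∘ₗ LinearMap.snd ℝ _ _ ∘ₗ LinearMap.snd ℝ _ _

theorem hom_pr1 (u : E n) : Hom 1 (pr1 u) := hom_toGA _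
theorem hom_pr2 (u : E n) : Hom 2 (pr2 u) := hom_toGA _
theorem hom_pr5 (u : E n) : Hom 5 (pr5 u) := hom_toGA _
theorem hom_qr1 (u : N n) : Hom 1 (qr1 u) := hom_toGA _
theorem hom_qr4 (u : N n) : Hom 4 (qr4 u) := hom_toGA _
theorem hom_qr6 (i : Fin n) (u : N n) : Hom 6 (qr6 i u) := hom_toGA _

theorem E.ext' {u v : E n} (h1 : pr1 u = pr1 v) (h2 : pr2 u = pr2 v) (h5 : pr5 u = pr5 v) :
    u = v :=
  Prod.ext (toGA_injective 1 h1) (Prod.ext (toGA_injective 2 h2) (toGA_injective 5 h5))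

theorem N.ext' {u v : N n} (h1 : qr1 u = qr1 v) (h4 : qr4 u = qr4 v)
    (h6 : ∀ i, qr6 i u = qr6 i v) : u = v := by
  refine Prod.ext (toGA_injective 1 h1) (Prod.ext (toGA_injective 4 h4) ?_)
  funext I
  obtain ⟨i, rfl⟩ := ix_surj I
  exact toGA_injective 6 (h6 i)

/-- The linear map to `E` with given components. -/
def mkE {W : Type*} [AddCommGroup W] [Module ℝ W] (f1 f2 f5 : W →ₗ[ℝ] GA n) : W →ₗ[ℝ] E n :=
  (ofGA 1 ∘ₗ f1).prod ((ofGA 2 ∘ₗ f2).prod (ofGA 5 ∘ₗ f5))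

/-- The linear map to `N` with given components. -/
def mkN {W : Type*} [AddCommGroup W] [Module ℝ W] (f1 f4 : W →ₗ[ℝ] GA n)
    (f6 : Fin n → W →ₗ[ℝ] GA n) : W →ₗ[ℝ] N n :=
  (ofGA 1 ∘ₗ f1).prod ((ofGA 4 ∘ₗ f4).prod
    (LinearMap.pi fun I => ofGA 6 ∘ₗ f6 (ixEquiv.symm I)))

section mk
variable {W : Type*} [AddCommGroup W] [Module ℝ W] {f1 f2 f4 f5 : W →ₗ[ℝ] GA n}
  {f6 : Fin n → W →ₗ[ℝ] GA n} {w : W}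

theorem pr1_mkE (h : Hom 1 (f1 w)) : pr1 (mkE f1 f2 f5 w) = f1 w := toGA_ofGA h
theorem pr2_mkE (h : Hom 2 (f2 w)) : pr2 (mkE f1 f2 f5 w) = f2 w := toGA_ofGA h
theorem pr5_mkE (h : Hom 5 (f5 w)) : pr5 (mkE f1 f2 f5 w) = f5 w := toGA_ofGA h
theorem qr1_mkN (h : Hom 1 (f1 w)) : qr1 (mkN f1 f4 f6 w) = f1 w := toGA_ofGA h
theorem qr4_mkN (h : Hom 4 (f4 w)) : qr4 (mkN f1 f4 f6 w) = f4 w := toGA_ofGA h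
theorem qr6_mkN (i : Fin n) (h : Hom 6 (f6 i w)) : qr6 i (mkN f1 f4 f6 w) = f6 i w := by
  have : ixEquiv.symm (ix i) = i := ixEquiv.symm_apply_apply i
  change toGA 6 (ofGA 6 (f6 (ixEquiv.symm (ix i)) w)) = _
  rw [this, toGA_ofGA h]
end mk

theorem qr1_toN (u v : E n) : qr1 (toN u v) = con (pr1 u) (pr2 v) + con (pr1 v) (pr2 u) := by
  have h : ∀ (X : Ext n 1) (s : Ext n 2), toGA 1 (contract (l := 1) X s) = con (toGA 1 X) (toGA 2 s) :=
    fun X s => toGA_contract (l := 1) X s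
  change toGA 1 (_ + _) = _
  rw [map_add, h, h]; rfl

theorem qr4_toN (u v : E n) : qr4 (toN u v) = con (pr1 u) (pr5 v) + con (pr1 v) (pr5 u)
    - pr2 u * pr2 v := by
  have h : ∀ (X : Ext n 1) (s : Ext n 5), toGA 4 (contract (l := 4) X s) = con (toGA 1 X) (toGA 5 s) :=
    fun X s => toGA_contract (l := 4) X s
  have h' : ∀ (X : Ext n 2) (s : Ext n 2), toGA 4 (wedge X s) = toGA 2 X * toGA 2 s :=
    fun X s => toGA_wedge X s
  change toGA 4 (_ + _ - _) = _
  rw [map_sub, map_add, h, h, h']; rfl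

theorem qr6_toN (i : Fin n) (u v : E n) : qr6 i (toN u v) = con (gen i) (pr2 u) * pr5 v
    + con (gen i) (pr2 v) * pr5 u := by
  have h : ∀ (s : Ext n 2) (t : Ext n 5), toGA 6 (jWedge s t (ix i))
      = con (gen i) (toGA 2 s) * toGA 5 t := by
    intro s t
    have h1 := toGA_contract (l := 1) (basisVec (ix i)) s
    have h2 := toGA_wedge (contract (l := 1) (basisVec (ix i)) s) t
    rw [h1, toGA_basisVec] at h2
    exact h2
  change toGA 6 (jWedge _ _ (ix i) + jWedge _ _ (ix i)) = _
  rw [map_add, h, h]; rfl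

theorem toN_comm (u v : E n) : toN u v = toN v u := by
  refine N.ext' ?_ ?_ fun i => ?_
  · rw [qr1_toN, qr1_toN, add_comm]
  · rw [qr4_toN, qr4_toN, add_comm, (hom_pr2 u).comm_even (hom_pr2 v) (by decide)]
  · rw [qr6_toN, qr6_toN, add_comm]

theorem toN_add_right (u v v' : E n) : toN u (v + v') = toN u v + toN u v' := by
  rw [toN_comm, toN_add_left, toN_comm v, toN_comm v']

theorem toN_smul_right (c : ℝ) (u v : E n) : toN u (c • v) = c • toN u v := by
  rw [toN_comm, toN_smul_left, toN_comm v]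

/-- The bilinear map `u ⊗ v ↦ (u ⊗ v)_N`. -/
def toNB : E n →ₗ[ℝ] E n →ₗ[ℝ] N n :=
  LinearMap.mk₂ ℝ toN toN_add_left toN_smul_left toN_add_right toN_smul_right

@[simp] theorem toNB_apply (u v : E n) : toNB u v = toN u v := rfl

theorem toN_zero_left (v : E n) : toN 0 v = 0 := by rw [← toNB_apply]; simp
theorem toN_zero_right (v : E n) : toN v 0 = 0 := by rw [toN_comm, toN_zero_left]
theorem toN_neg_left (u v : E n) : toN (-u) v = -toN u v := by simp [← toNB_apply]
theorem toN_neg_right (u v : E n) : toN u (-v) = -toN u v := by simp [← toNB_apply]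
theorem toN_sub_left (u u' v : E n) : toN (u - u') v = toN u v - toN u' v := by simp [← toNB_apply]
theorem toN_sub_right (u v v' : E n) : toN u (v - v') = toN u v - toN u v' := by simp [← toNB_apply]

/-- The pairing of `E*` with `E`, in coordinates. -/
def dotE (u v : E n) : ℝ := dotG (pr1 u) (pr1 v) + dotG (pr2 u) (pr2 v) + dotG (pr5 u) (pr5 v)

theorem pairN_eq (μ ν : N n) : pairN μ ν = dotG (qr1 μ) (qr1 ν) + dotG (qr4 μ) (qr4 ν)
    + ∑ i, dotG (qr6 i μ) (qr6 i ν) := by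
  unfold pairN
  rw [sum_mul_eq_dotG, sum_mul_eq_dotG, sum_ix]
  congr 1
  exact Finset.sum_congr rfl fun i _ => sum_mul_eq_dotG _ _

theorem dotE_comm (u v : E n) : dotE u v = dotE v u := by
  simp only [dotE, dotG_comm (pr1 u), dotG_comm (pr2 u), dotG_comm (pr5 u)]

theorem pairN_comm (u v : N n) : pairN u v = pairN v u := by
  simp only [pairN_eq, dotG_comm (qr1 u), dotG_comm (qr4 u), dotG_comm (qr6 _ u)]

theorem dotE_add_left (u u' v : E n) : dotE (u + u') v = dotE u v + dotE u' v := by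
  simp only [dotE, map_add, dotG_add_left]; ring
theorem dotE_smul_left (c : ℝ) (u v : E n) : dotE (c • u) v = c * dotE u v := by
  simp only [dotE, map_smul, dotG_smul_left]; ring
theorem dotE_add_right (u v v' : E n) : dotE u (v + v') = dotE u v + dotE u v' := by
  rw [dotE_comm, dotE_add_left, dotE_comm v, dotE_comm v']
theorem dotE_smul_right (c : ℝ) (u v : E n) : dotE u (c • v) = c * dotE u v := by
  rw [dotE_comm, dotE_smul_left, dotE_comm v]

/-- The pairing of `E*` with `E` as a bilinear form. -/
def dotEB : E n →ₗ[ℝ] E n →ₗ[ℝ] ℝ :=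
  LinearMap.mk₂ ℝ dotE dotE_add_left dotE_smul_left dotE_add_right dotE_smul_right

@[simp] theorem dotEB_apply (u v : E n) : dotEB u v = dotE u v := rfl

theorem pairN_add_left (u u' v : N n) : pairN (u + u') v = pairN u v + pairN u' v := by
  simp only [pairN_eq, map_add, dotG_add_left, Finset.sum_add_distrib]; ring
theorem pairN_smul_left (c : ℝ) (u v : N n) : pairN (c • u) v = c * pairN u v := by
  simp only [pairN_eq, map_smul, dotG_smul_left, ← Finset.mul_sum]; ring
theorem pairN_add_right (u v v' : N n) : pairN u (v + v') = pairN u v + pairN u v' := by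
  rw [pairN_comm, pairN_add_left, pairN_comm v, pairN_comm v']
theorem pairN_smul_right (c : ℝ) (u v : N n) : pairN u (c • v) = c * pairN u v := by
  rw [pairN_comm, pairN_smul_left, pairN_comm v]

/-- The pairing of `N*` with `N` as a bilinear form. -/
def pairNB : N n →ₗ[ℝ] N n →ₗ[ℝ] ℝ :=
  LinearMap.mk₂ ℝ pairN pairN_add_left pairN_smul_left pairN_add_right pairN_smul_right

@[simp] theorem pairNB_apply (u v : N n) : pairNB u v = pairN u v := rfl

theorem dotE_self_pos {u : E n} (h : dotE u u = 0) : u = 0 := by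
  have key : ∀ f : GA n, 0 ≤ dotG f f := fun f => Finset.sum_nonneg fun A _ => mul_self_nonneg _
  have key2 : ∀ f : GA n, dotG f f = 0 → f = 0 := fun f hf => by
    ext A
    have := (Finset.sum_eq_zero_iff_of_nonneg fun A _ => mul_self_nonneg (f A)).1 hf A
      (Finset.mem_univ _)
    simpa using this
  unfold dotE at h
  have a := key (pr1 u); have b := key (pr2 u); have c := key (pr5 u)
  refine E.ext' ?_ ?_ ?_
  · rw [key2 (pr1 u) (by linarith), map_zero]
  · rw [key2 (pr2 u) (by linarith), map_zero]
  · rw [key2 (pr5 u) (by linarith), map_zero]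

theorem eq_of_dotE {u v : E n} (h : ∀ x, dotE x u = dotE x v) : u = v := by
  rw [← sub_eq_zero]
  apply dotE_self_pos
  have := h (u - v)
  rw [← dotEB_apply, map_sub, dotEB_apply, dotEB_apply, this, sub_self]

theorem pairN_self_pos {u : N n} (h : pairN u u = 0) : u = 0 := by
  have key : ∀ f : GA n, 0 ≤ dotG f f := fun f => Finset.sum_nonneg fun A _ => mul_self_nonneg _
  have key2 : ∀ f : GA n, dotG f f = 0 → f = 0 := fun f hf => by
    ext A
    have := (Finset.sum_eq_zero_iff_of_nonneg fun A _ => mul_self_nonneg (f A)).1 hf A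
      (Finset.mem_univ _)
    simpa using this
  rw [pairN_eq] at h
  have a := key (qr1 u); have b := key (qr4 u)
  have c : 0 ≤ ∑ i, dotG (qr6 i u) (qr6 i u) := Finset.sum_nonneg fun i _ => key _
  refine N.ext' ?_ ?_ fun i => ?_
  · rw [key2 (qr1 u) (by linarith), map_zero]
  · rw [key2 (qr4 u) (by linarith), map_zero]
  · have := (Finset.sum_eq_zero_iff_of_nonneg fun i _ => key (qr6 i u)).1 (by linarith) i
      (Finset.mem_univ _)
    rw [key2 _ this, map_zero]

/-! ### Derivations of `E ⊗ E → N` -/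

/-- `A` acts on `E`, `P` on `N`, their transposes are `B`, `Q`, and both `E ⊗ E → N` and
`E* ⊗ E* → N*` are equivariant. -/
structure DerPair (A B : E n →ₗ[ℝ] E n) (P Q : N n →ₗ[ℝ] N n) : Prop where
  dotE : ∀ u v, dotE (B u) v = dotE u (A v)
  pairN : ∀ μ ν, pairN (Q μ) ν = pairN μ (P ν)
  toN : ∀ u v, toN (A u) v + toN u (A v) = P (toN u v)
  toN' : ∀ u v, Elg.toN (B u) v + Elg.toN u (B v) = Q (Elg.toN u v)

theorem DerPair.symm {A B : E n →ₗ[ℝ] E n} {P Q : N n →ₗ[ℝ] N n} (h : DerPair A B P Q) :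
    DerPair B A Q P :=
  ⟨fun u v => by rw [dotE_comm, ← h.dotE, dotE_comm], fun u v => by
    rw [pairN_comm, ← h.pairN, pairN_comm], h.toN', h.toN⟩

theorem DerPair.add {A B A' B' : E n →ₗ[ℝ] E n} {P Q P' Q' : N n →ₗ[ℝ] N n}
    (h : DerPair A B P Q) (h' : DerPair A' B' P' Q') :
    DerPair (A + A') (B + B') (P + P') (Q + Q') where
  dotE u v := by simp only [LinearMap.add_apply, dotE_add_left, dotE_add_right, h.dotE, h'.dotE]
  pairN u v := by
    simp only [LinearMap.add_apply, pairN_add_left, pairN_add_right, h.pairN, h'.pairN]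
  toN u v := by
    simp only [LinearMap.add_apply, toN_add_left, toN_add_right, ← h.toN, ← h'.toN]; abel
  toN' u v := by
    simp only [LinearMap.add_apply, toN_add_left, toN_add_right, ← h.toN', ← h'.toN']; abel

theorem DerPair.smul {A B : E n →ₗ[ℝ] E n} {P Q : N n →ₗ[ℝ] N n} (c : ℝ)
    (h : DerPair A B P Q) : DerPair (c • A) (c • B) (c • P) (c • Q) where
  dotE u v := by simp only [LinearMap.smul_apply, dotE_smul_left, dotE_smul_right, h.dotE]
  pairN u v := by simp only [LinearMap.smul_apply, pairN_smul_left, pairN_smul_right, h.pairN]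
  toN u v := by simp only [LinearMap.smul_apply, toN_smul_left, toN_smul_right, ← h.toN, smul_add]
  toN' u v := by simp only [LinearMap.smul_apply, toN_smul_left, toN_smul_right, ← h.toN', smul_add]

theorem DerPair.zero : DerPair (n := n) 0 0 0 0 where
  dotE u v := by simp [← dotEB_apply]
  pairN u v := by simp [← pairNB_apply]
  toN u v := by simp [toN_zero_left, toN_zero_right]
  toN' u v := by simp [toN_zero_left, toN_zero_right]

theorem DerPair.comm {A B A' B' : E n →ₗ[ℝ] E n} {P Q P' Q' : N n →ₗ[ℝ] N n}
    (h : DerPair A B P Q) (h' : DerPair A' B' P' Q') :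
    DerPair (A ∘ₗ A' - A' ∘ₗ A) (B' ∘ₗ B - B ∘ₗ B') (P ∘ₗ P' - P' ∘ₗ P) (Q' ∘ₗ Q - Q ∘ₗ Q') where
  dotE u v := by
    simp only [LinearMap.sub_apply, LinearMap.comp_apply]
    simp only [← dotEB_apply, map_sub, LinearMap.sub_apply]
    simp only [dotEB_apply, h.dotE, h'.dotE]
  pairN u v := by
    simp only [LinearMap.sub_apply, LinearMap.comp_apply]
    simp only [← pairNB_apply, map_sub, LinearMap.sub_apply]
    simp only [pairNB_apply, h.pairN, h'.pairN]
  toN u v := by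
    simp only [LinearMap.sub_apply, LinearMap.comp_apply, toN_sub_left, toN_sub_right, ← h.toN,
      ← h'.toN, map_add]
    abel
  toN' u v := by
    simp only [LinearMap.sub_apply, LinearMap.comp_apply, toN_sub_left, toN_sub_right, ← h.toN',
      ← h'.toN', map_add]
    abel

/-- `A` is a derivation of the structure maps of `E` and `N`. -/
def IsDer (A : E n →ₗ[ℝ] E n) : Prop := ∃ B P Q, DerPair A B P Q

theorem IsDer.add {A A' : E n →ₗ[ℝ] E n} (h : IsDer A) (h' : IsDer A') : IsDer (A + A') := by
  obtain ⟨B, P, Q, h⟩ := h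
  obtain ⟨B', P', Q', h'⟩ := h'
  exact ⟨_, _, _, h.add h'⟩

theorem IsDer.smul {A : E n →ₗ[ℝ] E n} (c : ℝ) (h : IsDer A) : IsDer (c • A) := by
  obtain ⟨B, P, Q, h⟩ := h
  exact ⟨_, _, _, h.smul c⟩

theorem IsDer.neg {A : E n →ₗ[ℝ] E n} (h : IsDer A) : IsDer (-A) := by
  rw [← neg_one_smul ℝ A]; exact h.smul _

theorem IsDer.sub {A A' : E n →ₗ[ℝ] E n} (h : IsDer A) (h' : IsDer A') : IsDer (A - A') := by
  rw [sub_eq_add_neg]; exact h.add h'.neg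

theorem IsDer.zero : IsDer (0 : E n →ₗ[ℝ] E n) := ⟨_, _, _, DerPair.zero⟩

theorem IsDer.sum {ι : Type*} (s : Finset ι) (f : ι → E n →ₗ[ℝ] E n) (h : ∀ i ∈ s, IsDer (f i)) :
    IsDer (∑ i ∈ s, f i) :=
  Finset.sum_induction f IsDer (fun _ _ => IsDer.add) IsDer.zero h

theorem IsDer.comm {A A' : E n →ₗ[ℝ] E n} (h : IsDer A) (h' : IsDer A') :
    IsDer (A ∘ₗ A' - A' ∘ₗ A) := by
  obtain ⟨B, P, Q, h⟩ := h
  obtain ⟨B', P', Q', h'⟩ := h'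
  exact ⟨_, _, _, h.comm h'⟩

/-- It suffices to check the derivation property on the diagonal. -/
theorem toN_polarize {A : E n →ₗ[ℝ] E n} {P : N n →ₗ[ℝ] N n}
    (h : ∀ u, (2 : ℝ) • toN (A u) u = P (toN u u)) (u v : E n) :
    toN (A u) v + toN u (A v) = P (toN u v) := by
  have h1 := h (u + v)
  simp only [map_add, toN_add_left, toN_add_right, smul_add, h, toN_comm v u] at h1
  rw [toN_comm u (A v)]
  have h2 : (2 : ℝ) • (toN (A u) v + toN (A v) u) = (2 : ℝ) • P (toN u v) := by
    rw [two_smul ℝ (P _), smul_add]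
    have h3 := h u; have h4 := h v
    rw [← h3, ← h4] at h1
    linear_combination (exp := 1) h1
  exact smul_right_injective _ two_ne_zero h2

/-! ### The generators of `𝔤` are derivations -/

/-- Contraction into a fixed element. -/
def conL (g : GA n) : GA n →ₗ[ℝ] GA n where
  toFun f := con f g
  map_add' f f' := by rw [con_add]; rfl
  map_smul' c f := by rw [con_smul]; rfl

@[simp] theorem conL_apply (f g : GA n) : conL g f = con f g := rfl

/-- The number operator writes `f` as a sum of the terms `gen i * con (gen i) f`, up to division by
the positive degree. -/
theorem Hom.mem_span_mul {k : ℕ} {f : GA n} (hf : Hom (k + 1) f) :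
    f ∈ Submodule.span ℝ {x | ∃ i g, Hom k g ∧ x = gen i * g} := by
  have h := sum_gen_mul_con hf
  have h0 : ((k + 1 : ℕ) : ℝ) ≠ 0 := by positivity
  have h1 : f = ((k + 1 : ℕ) : ℝ)⁻¹ • ∑ i, gen i * con (gen i) f := by
    rw [h, smul_smul, inv_mul_cancel₀ h0, one_smul]
  rw [h1]
  exact Submodule.smul_mem _ _ (Submodule.sum_mem _ fun i _ =>
    Submodule.subset_span ⟨i, _, hom_con_gen hf i, rfl⟩)

/-- Elements of degree `k + 1` are spanned by multiples of generators. -/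
theorem Hom.induction_mul {k : ℕ} {p : GA n → Prop} (zero : p 0)
    (add : ∀ x y, p x → p y → p (x + y)) (smul : ∀ (c : ℝ) x, p x → p (c • x))
    (h : ∀ i g, Hom k g → p (gen i * g)) {f : GA n} (hf : Hom (k + 1) f) : p f := by
  refine Submodule.span_induction (p := fun x _ => p x) ?_ zero (fun x y _ _ => add x y)
    (fun c x _ => smul c x) hf.mem_span_mul
  rintro x ⟨i, g, hg, rfl⟩; exact h i g hg

/-- Reduces linear statements about 3-forms to monomials, for which contraction is three successive
contractions by generators. -/
theorem Hom.induction_three {p : GA n → Prop} (zero : p 0) (add : ∀ x y, p x → p y → p (x + y))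
    (smul : ∀ (c : ℝ) x, p x → p (c • x)) (h : ∀ x y z, p (gen x * gen y * gen z)) {f : GA n}
    (hf : Hom 3 f) : p f := by
  refine Hom.induction_mul zero add smul (fun x g hg => ?_) hf
  refine Hom.induction_mul (p := fun g => p (gen x * g)) (by simpa using zero)
    (fun a b ha hb => by rw [mul_add]; exact add _ _ ha hb)
    (fun c a ha => by rw [mul_smul_comm]; exact smul c _ ha) (fun y g hg => ?_) hg
  refine Hom.induction_mul (p := fun g => p (gen x * (gen y * g))) (by simpa using zero)
    (fun a b ha hb => by rw [mul_add, mul_add]; exact add _ _ ha hb)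
    (fun c a ha => by rw [mul_smul_comm, mul_smul_comm]; exact smul c _ ha) (fun z g hg => ?_) hg
  rw [hg.eq_smul_one, mul_smul_comm, mul_one, mul_smul_comm, mul_smul_comm, ← mul_assoc]
  exact smul _ _ (h x y z)

/-- Products of two 3-forms are enough in degree six. This is the form suited to commutators, since
`a3G_comm` produces the 6-form actions from such products. -/
theorem Hom.induction_six {p : GA n → Prop} (zero : p 0) (add : ∀ x y, p x → p y → p (x + y))
    (smul : ∀ (c : ℝ) x, p x → p (c • x)) (h : ∀ f g, Hom 3 f → Hom 3 g → p (f * g)) {f : GA n}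
    (hf : Hom 6 f) : p f := by
  refine Hom.induction_mul zero add smul (fun x g hg => ?_) hf
  refine Hom.induction_mul (p := fun g => p (gen x * g)) (by simpa using zero)
    (fun a b ha hb => by rw [mul_add]; exact add _ _ ha hb)
    (fun c a ha => by rw [mul_smul_comm]; exact smul c _ ha) (fun y g hg => ?_) hg
  refine Hom.induction_mul (p := fun g => p (gen x * (gen y * g))) (by simpa using zero)
    (fun a b ha hb => by rw [mul_add, mul_add]; exact add _ _ ha hb)
    (fun c a ha => by rw [mul_smul_comm, mul_smul_comm]; exact smul c _ ha) (fun z g hg => ?_) hg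
  rw [← mul_assoc, ← mul_assoc]
  exact h _ _ (((hom_gen x).mul (hom_gen y)).mul (hom_gen z)) hg

theorem con_con_three_self {s W : GA n} (hs : Hom 2 s) (hW : Hom 3 W) :
    (2 : ℝ) • con (con s W) s = con W (s * s) := by
  refine Hom.induction_three (p := fun W => (2 : ℝ) • con (con s W) s = con W (s * s)) ?_ ?_ ?_ ?_ hW
  · simp [con_zero]
  · intro x y hx hy; rw [map_add, con_add, con_add, LinearMap.add_apply, smul_add, hx, hy]; rfl
  · intro c x hx
    rw [map_smul, con_smul, con_smul, LinearMap.smul_apply, LinearMap.smul_apply, ← hx, smul_comm]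
  · intro x y z; rw [con_gen_three, con_con_self_two hs]

theorem con_three_mul_self (hn : n ≤ 6) {t W : GA n} (ht : Hom 5 t) (hW : Hom 3 W) (i : Fin n) :
    con (gen i) (con W t) * t = 0 := by
  refine Hom.induction_three (p := fun W => con (gen i) (con W t) * t = 0) ?_ ?_ ?_ ?_ hW
  · simp [con_zero]
  · intro x y hx hy; rw [con_add, LinearMap.add_apply, map_add, add_mul, hx, hy, add_zero]
  · intro c x hx
    rw [con_smul, LinearMap.smul_apply, map_smul, smul_mul_assoc, hx, smul_zero]
  · intro x y z; rw [con_gen_three, con_three_five_mul_self hn ht]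

theorem sum_gen_mul_con_mul (hn : n ≤ 6) {s t W : GA n} (hs : Hom 2 s) (ht : Hom 5 t)
    (hW : Hom 3 W) : ∑ i, gen i * con W (con (gen i) s * t) = con (con s W) t - con W t * s := by
  refine Hom.induction_three (p := fun W => ∑ i, gen i * con W (con (gen i) s * t)
    = con (con s W) t - con W t * s) ?_ ?_ ?_ ?_ hW
  · simp [con_zero]
  · intro x y hx hy
    simp only [con_add, LinearMap.add_apply, mul_add, add_mul, map_add, Finset.sum_add_distrib,
      hx, hy]
    abel
  · intro c x hx
    simp only [con_smul, LinearMap.smul_apply, mul_smul_comm, smul_mul_assoc, map_smul,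
      ← Finset.smul_sum, hx, smul_sub]
  · intro x y z; simp only [con_gen_three, sum_gen_mul_con_three hn hs ht]

/-! ### The actions of 3- and 6-forms and of 3- and 6-vectors. -/

/-- The action of a 3-form. -/
def a3G (A : GA n) : E n →ₗ[ℝ] E n :=
  mkE 0 (conL A ∘ₗ pr1) (LinearMap.mulLeft ℝ A ∘ₗ pr2)
/-- The action of a 3-vector. -/
def w3G (W : GA n) : E n →ₗ[ℝ] E n := mkE (conL W ∘ₗ pr2) (con W ∘ₗ pr5) 0
/-- The action of a 6-form. -/
def a6G (A : GA n) : E n →ₗ[ℝ] E n := mkE 0 0 (conL A ∘ₗ pr1)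
/-- The action of a 6-vector. -/
def w6G (W : GA n) : E n →ₗ[ℝ] E n := mkE (-(conL W ∘ₗ pr5)) 0 0

section
variable {A : GA n} (u : E n)

theorem pr1_a3G : pr1 (a3G A u) = 0 := pr1_mkE Hom.zero
theorem pr2_a3G (h : Hom 3 A) : pr2 (a3G A u) = con (pr1 u) A :=
  pr2_mkE (f2 := conL A ∘ₗ pr1) ((hom_pr1 u).contraction (l := 2) h)
theorem pr5_a3G (h : Hom 3 A) : pr5 (a3G A u) = A * pr2 u :=
  pr5_mkE (f5 := LinearMap.mulLeft ℝ A ∘ₗ pr2) (h.mul (hom_pr2 u))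
theorem pr1_w3G (h : Hom 3 A) : pr1 (w3G A u) = con (pr2 u) A :=
  pr1_mkE (f1 := conL A ∘ₗ pr2) ((hom_pr2 u).contraction (l := 1) h)
theorem pr2_w3G (h : Hom 3 A) : pr2 (w3G A u) = con A (pr5 u) :=
  pr2_mkE (f2 := con A ∘ₗ pr5) (h.contraction (l := 2) (hom_pr5 u))
theorem pr5_w3G : pr5 (w3G A u) = 0 := pr5_mkE Hom.zero
theorem pr1_a6G : pr1 (a6G A u) = 0 := pr1_mkE Hom.zero
theorem pr2_a6G : pr2 (a6G A u) = 0 := pr2_mkE Hom.zero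
theorem pr5_a6G (h : Hom 6 A) : pr5 (a6G A u) = con (pr1 u) A :=
  pr5_mkE (f5 := conL A ∘ₗ pr1) ((hom_pr1 u).contraction (l := 5) h)
theorem pr1_w6G (h : Hom 6 A) : pr1 (w6G A u) = -con (pr5 u) A :=
  pr1_mkE (f1 := -(conL A ∘ₗ pr5)) ((hom_pr5 u).contraction (l := 1) h).neg
theorem pr2_w6G : pr2 (w6G A u) = 0 := pr2_mkE Hom.zero
theorem pr5_w6G : pr5 (w6G A u) = 0 := pr5_mkE Hom.zero
end

/-- The action of a 3-form on `N`. -/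
def a3N (A : GA n) : N n →ₗ[ℝ] N n :=
  mkN 0 (-(LinearMap.mulLeft ℝ A ∘ₗ qr1)) fun i => LinearMap.mulLeft ℝ A ∘ₗ con (gen i) ∘ₗ qr4
/-- The action of a 3-vector on `N`. -/
def w3N (W : GA n) : N n →ₗ[ℝ] N n :=
  mkN (-(con W ∘ₗ qr4)) (∑ i, LinearMap.mulLeft ℝ (gen i) ∘ₗ con W ∘ₗ qr6 i) 0

section
variable {A : GA n} (u : N n)

theorem qr1_a3N : qr1 (a3N A u) = 0 := qr1_mkN Hom.zero
theorem qr4_a3N (h : Hom 3 A) : qr4 (a3N A u) = -(A * qr1 u) :=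
  qr4_mkN (f4 := -(LinearMap.mulLeft ℝ A ∘ₗ qr1)) (h.mul (hom_qr1 u)).neg
theorem qr6_a3N (h : Hom 3 A) (i : Fin n) : qr6 i (a3N A u) = A * con (gen i) (qr4 u) :=
  qr6_mkN (f6 := fun i => LinearMap.mulLeft ℝ A ∘ₗ con (gen i) ∘ₗ qr4) i
    (h.mul (hom_con_gen (hom_qr4 u) i))
theorem qr1_w3N (h : Hom 3 A) : qr1 (w3N A u) = -con A (qr4 u) :=
  qr1_mkN (f1 := -(con A ∘ₗ qr4)) (h.contraction (l := 1) (hom_qr4 u)).neg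
theorem qr4_w3N (h : Hom 3 A) : qr4 (w3N A u) = ∑ i, gen i * con A (qr6 i u) := by
  have e : (∑ i, LinearMap.mulLeft ℝ (gen i) ∘ₗ con A ∘ₗ qr6 i) u
      = ∑ i, gen i * con A (qr6 i u) := by simp
  rw [← e]
  refine qr4_mkN ?_
  rw [e]
  exact Hom.sum fun i _ => (hom_gen i).mul (l := 3) (h.contraction (l := 3) (hom_qr6 i u))
theorem qr6_w3N (i : Fin n) : qr6 i (w3N A u) = 0 := qr6_mkN (f6 := 0) i Hom.zero
end

/-- The 3-form action and the 3-vector action with the same coefficients are mutual transposes, so a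
single pair serves both generators. Equivariance is checked on the diagonal and one component of `N`
at a time. -/
theorem derPair_three (hn : n ≤ 6) {A : GA n} (hA : Hom 3 A) :
    DerPair (a3G A) (w3G A) (a3N A) (w3N A) where
  dotE u v := by
    simp only [dotE, pr1_a3G, pr2_a3G _ hA, pr5_a3G _ hA, pr1_w3G _ hA, pr2_w3G _ hA, pr5_w3G,
      dotG_zero_left, dotG_zero_right]
    rw [dotG_con (hom_pr2 u) (hom_pr1 v), dotG_comm (pr5 u), dotG_mul_left, dotG_comm (pr1 v),
      dotG_comm (pr2 v)]
    norm_num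
  pairN u v := by
    simp only [pairN_eq, qr1_a3N, qr4_a3N _ hA, qr6_a3N _ hA, qr1_w3N _ hA, qr4_w3N _ hA, qr6_w3N,
      dotG_zero_left, dotG_zero_right, Finset.sum_const_zero, add_zero, zero_add, dotG_neg_left,
      dotG_neg_right]
    congr 1
    · rw [dotG_comm (qr4 u), dotG_mul_left, dotG_comm]
    · rw [dotG_comm, dotG_sum_right]
      refine Finset.sum_congr rfl fun i _ => ?_
      rw [dotG_comm, dotG_mul_left, dotG_comm (qr6 i u), dotG_mul_left, dotG_comm]
  toN u v := by
    refine toN_polarize (fun u => ?_) u v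
    have hx := hom_pr1 u; have hs := hom_pr2 u; have ht := hom_pr5 u
    refine N.ext' ?_ ?_ fun i => ?_
    · simp only [map_smul, qr1_toN, pr1_a3G, pr2_a3G _ hA, con_con_self hx, qr1_a3N]
      simp [con_zero]
    · simp only [map_smul, qr4_toN, pr1_a3G, pr2_a3G _ hA, pr5_a3G _ hA, qr4_a3N _ hA, qr1_toN,
        con_zero, con_one_mul hx hA]
      simp only [LinearMap.zero_apply, zero_add, ← two_smul ℝ (con (pr1 u) (pr2 u)), mul_smul_comm]
      norm_num
    -- In the `T* ⊗ ⋀⁶` component the terms match after contracting two products of degree seven,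
    -- which vanish.
    · have z : ∀ {k l : ℕ} {f g : GA n}, Hom k f → Hom l g → k + l = 7 → f * g = 0 :=
        fun hf hg h => (hf.mul hg).eq_zero (by omega)
      have hxA : Hom 2 (con (pr1 u) A) := hx.contraction (l := 2) hA
      have hxt : Hom 4 (con (pr1 u) (pr5 u)) := hx.contraction (l := 4) ht
      have hAi := hom_con_gen hA i
      have e1 : con (gen i) (con (pr1 u) A) * pr5 u = A * con (gen i) (con (pr1 u) (pr5 u)) := by
        have f1 := congrArg (con (pr1 u)) (z hAi ht rfl)
        have f2 := congrArg (con (gen i)) (z hA hxt rfl)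
        rw [con_one_mul hx hAi, map_zero] at f1
        rw [con_gen_mul_odd (by decide) i hA, map_zero, sub_eq_zero] at f2
        rw [con_swap (hom_gen i) hx, neg_mul, ← f2]
        norm_num at f1
        exact neg_eq_of_add_eq_zero_right f1
      have e2 : con (gen i) (pr2 u) * (A * pr2 u) = -(A * (con (gen i) (pr2 u) * pr2 u)) := by
        rw [← mul_assoc, (hom_con_gen hs i).comm_odd hA (by decide), neg_mul, mul_assoc]
      have e3 : pr2 u * con (gen i) (pr2 u) = con (gen i) (pr2 u) * pr2 u :=
        hs.comm_even (hom_con_gen hs i) (by decide)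
      simp only [qr6_toN, pr2_a3G _ hA, pr5_a3G _ hA, qr6_a3N _ hA, qr4_toN, map_sub,
        map_add, con_gen_mul_even (k := 2) (by decide) i hs, e1, e2, e3, mul_add, mul_sub, two_smul]
      abel
  toN' u v := by
    refine toN_polarize (fun u => ?_) u v
    have hx := hom_pr1 u; have hs := hom_pr2 u; have ht := hom_pr5 u
    have sw : con (pr1 u) (con A (pr5 u)) = -con A (con (pr1 u) (pr5 u)) := by
      rw [← con_mul, ← con_mul, hA.comm_odd hx (by decide), con_neg]; rfl
    have hWt : Hom 2 (con A (pr5 u)) := hA.contraction (l := 2) ht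
    refine N.ext' ?_ ?_ fun i => ?_
    · simp only [map_smul, qr1_toN, pr1_w3G _ hA, pr2_w3G _ hA, qr1_w3N _ hA, qr4_toN, map_sub,
        map_add, smul_add, con_con_three_self hs hA, sw]
      module
    · simp only [qr4_toN, pr1_w3G _ hA, pr2_w3G _ hA, pr5_w3G, qr4_w3N _ hA, qr6_toN,
        map_add, mul_add, Finset.sum_add_distrib, sum_gen_mul_con_mul hn hs ht hA, map_zero,
        add_zero, two_smul]
    · simp only [map_smul, qr6_toN, pr2_w3G _ hA, pr5_w3G, con_three_mul_self hn ht hA, mul_zero,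
        qr6_w3N, add_zero, smul_zero]

theorem isDer_a3G (hn : n ≤ 6) {A : GA n} (hA : Hom 3 A) : IsDer (a3G A) :=
  ⟨_, _, _, derPair_three hn hA⟩

theorem isDer_w3G (hn : n ≤ 6) {A : GA n} (hA : Hom 3 A) : IsDer (w3G A) :=
  ⟨_, _, _, (derPair_three hn hA).symm⟩

/-- Only the block `T → ⋀⁵` survives. There the two orders of composition are the two terms of the
antiderivation rule for `con (pr1 u) (A * A')`. -/
theorem a3G_comm {A A' : GA n} (hA : Hom 3 A) (hA' : Hom 3 A') :
    a3G A ∘ₗ a3G A' - a3G A' ∘ₗ a3G A = -a6G (A * A') := by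
  refine LinearMap.ext fun u => ?_
  simp only [LinearMap.sub_apply, LinearMap.comp_apply, LinearMap.neg_apply]
  have h6 : Hom 6 (A * A') := hA.mul hA'
  refine E.ext' ?_ ?_ ?_
  · simp [pr1_a3G, pr1_a6G]
  · simp [pr2_a3G _ hA, pr2_a3G _ hA', pr1_a3G, pr2_a6G, con_zero]
  · simp only [map_sub, map_neg, pr5_a3G _ hA, pr5_a3G _ hA', pr2_a3G _ hA, pr2_a3G _ hA',
      pr5_a6G _ h6]
    rw [con_one_mul (hom_pr1 u) hA,
      ((hom_pr1 u).contraction (l := 2) hA).comm_even hA' (by decide)]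
    norm_num
    abel

theorem a6G_add (A A' : GA n) : a6G (A + A') = a6G A + a6G A' := by
  have : conL (A + A') = conL A + conL A' := by ext1 f; simp
  refine LinearMap.ext fun u => ?_
  simp only [a6G, this, LinearMap.add_comp, mkE]
  refine Prod.ext ?_ (Prod.ext ?_ ?_) <;> simp

theorem a6G_smul (c : ℝ) (A : GA n) : a6G (c • A) = c • a6G A := by
  have : conL (c • A) = c • conL A := by ext1 f; simp
  refine LinearMap.ext fun u => ?_
  simp only [a6G, this, LinearMap.smul_comp, mkE]
  refine Prod.ext ?_ (Prod.ext ?_ ?_) <;> simp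

/-- Commutators of derivations are derivations, and those of the 3-form actions span the 6-form
actions. -/
theorem isDer_a6G (hn : n ≤ 6) {A : GA n} (hA : Hom 6 A) : IsDer (a6G A) := by
  refine Hom.induction_six (p := fun A => IsDer (a6G A)) ?_ ?_ ?_ ?_ hA
  · have := a6G_smul 0 (0 : GA n)
    rw [zero_smul, zero_smul] at this
    rw [this]; exact IsDer.zero
  · intro x y hx hy; rw [a6G_add]; exact hx.add hy
  · intro c x hx; rw [a6G_smul]; exact hx.smul c
  · intro f g hf hg
    rw [← neg_neg (a6G (f * g)), ← a3G_comm hf hg]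
    exact ((isDer_a3G hn hf).comm (isDer_a3G hn hg)).neg

/-- A transpose of a derivation is again one, and the transpose of the 6-form action is the 6-vector
action. The minus sign in `w6G` comes from exchanging a 5-form with a vector. -/
theorem isDer_w6G (hn : n ≤ 6) {A : GA n} (hA : Hom 6 A) : IsDer (w6G A) := by
  obtain ⟨B, P, Q, h⟩ := isDer_a6G hn hA
  have : B = w6G A := by
    refine LinearMap.ext fun u => ?_
    refine eq_of_dotE fun v => ?_
    rw [dotE_comm, h.dotE]
    simp only [dotE, pr1_a6G, pr2_a6G, pr5_a6G _ hA, pr1_w6G _ hA, pr2_w6G, pr5_w6G,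
      dotG_zero_right, dotG_con (hom_pr5 u) (hom_pr1 v), dotG_neg_right]
    norm_num
  exact this ▸ ⟨_, _, _, h.symm⟩

/-! ### The action of `gl(T)` and the passage from `𝔤` to derivations. -/

/-- The coefficient of a generator. -/
def coeffL (j : Fin n) : GA n →ₗ[ℝ] ℝ := ⟨⟨fun f => f {j}, fun _ _ => rfl⟩, fun _ _ => rfl⟩

@[simp] theorem coeffL_apply (j : Fin n) (f : GA n) : coeffL j f = f {j} := rfl

/-- The elementary derivation of the Grassmann algebra. -/
def glG (i j : Fin n) : GA n →ₗ[ℝ] GA n := -(LinearMap.mulLeft ℝ (gen j) ∘ₗ con (gen i))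

theorem glG_apply (i j : Fin n) (f : GA n) : glG i j f = -(gen j * con (gen i) f) := rfl

theorem hom_glG {k : ℕ} (i j : Fin n) {f : GA n} (hf : Hom (k + 1) f) : Hom (k + 1) (glG i j f) := by
  rw [add_comm] at *
  exact ((hom_gen j).mul ((hom_gen i).contraction (l := k) (by rwa [add_comm]))).neg

theorem glG_mul {k : ℕ} (i j : Fin n) {f : GA n} (hf : Hom k f) (g : GA n) :
    glG i j (f * g) = glG i j f * g + f * glG i j g := by
  simp only [glG_apply, con_gen_mul i hf, mul_add, neg_mul, mul_assoc, neg_add, mul_neg]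
  congr 2
  rw [mul_smul_comm, ← mul_assoc, ← mul_assoc, (hom_gen j).comm hf, smul_mul_assoc, smul_smul,
    one_mul, ← mul_pow]
  simp

theorem con_glG (i j : Fin n) {X : GA n} (hX : Hom 1 X) (f : GA n) :
    con X (glG i j f) = glG i j (con X f) - X {j} • con (gen i) f := by
  have h : con X (gen j) = X {j} • (1 : GA n) := by
    simp only [con_eq_sum hX, con_gen_gen, smul_ite, smul_zero]
    simp
  rw [glG_apply, glG_apply, map_neg, con_one_mul hX (hom_gen j), h, con_swap hX (hom_gen i)]
  simp [sub_eq_add_neg]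

/-- The action of an elementary matrix on `E`. -/
def glE (i j : Fin n) : E n →ₗ[ℝ] E n :=
  mkE ((coeffL j ∘ₗ pr1).smulRight (gen i)) (glG i j ∘ₗ pr2) (glG i j ∘ₗ pr5)

/-- The action of an elementary matrix on `N`. -/
def glN (i j : Fin n) : N n →ₗ[ℝ] N n :=
  mkN (glG i j ∘ₗ qr1) (glG i j ∘ₗ qr4) fun k => glG i j ∘ₗ qr6 k - (if k = j then qr6 i else 0)

section
variable (i j k : Fin n) (u : E n) (ν : N n)
theorem pr1_glE : pr1 (glE i j u) = (pr1 u) {j} • gen i :=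
  pr1_mkE (f1 := (coeffL j ∘ₗ pr1).smulRight (gen i)) ((hom_gen i).smul _)
theorem pr2_glE : pr2 (glE i j u) = glG i j (pr2 u) := pr2_mkE (hom_glG i j (hom_pr2 u))
theorem pr5_glE : pr5 (glE i j u) = glG i j (pr5 u) := pr5_mkE (hom_glG i j (hom_pr5 u))
theorem qr1_glN : qr1 (glN i j ν) = glG i j (qr1 ν) := qr1_mkN (hom_glG i j (hom_qr1 ν))
theorem qr4_glN : qr4 (glN i j ν) = glG i j (qr4 ν) := qr4_mkN (hom_glG i j (hom_qr4 ν))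
theorem qr6_glN : qr6 k (glN i j ν) = glG i j (qr6 k ν) - if k = j then qr6 i ν else 0 := by
  have e : (glG i j ∘ₗ qr6 k - (if k = j then qr6 i else 0)) ν
      = glG i j (qr6 k ν) - if k = j then qr6 i ν else 0 := by split_ifs <;> simp
  rw [← e]
  refine qr6_mkN (f6 := fun k => glG i j ∘ₗ qr6 k - (if k = j then qr6 i else 0)) k ?_
  rw [e]
  refine (hom_glG i j (hom_qr6 k ν)).sub ?_
  split_ifs
  · exact hom_qr6 i ν
  · exact Hom.zero
end

theorem dotG_glG (i j : Fin n) (f g : GA n) : dotG (glG j i f) g = dotG f (glG i j g) := by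
  rw [glG_apply, glG_apply, dotG_neg_left, dotG_neg_right, dotG_mul_left, dotG_comm f,
    dotG_mul_left, dotG_comm]

/-- Transposition exchanges `i` and `j`, so one computation for arbitrary indices gives equivariance
on both `E` and `E*`. The case distinction on `k = j` is the action on the factor `T*` of `T* ⊗
⋀⁶T*`. -/
theorem derPair_glE (i j : Fin n) : DerPair (glE i j) (glE j i) (glN i j) (glN j i) := by
  have key : ∀ (i j : Fin n) (u v : E n),
      toN (glE i j u) v + toN u (glE i j v) = glN i j (toN u v) := by
    intro i j u v
    refine N.ext' ?_ ?_ fun k => ?_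
    · simp only [map_add, qr1_toN, qr1_glN, pr1_glE, pr2_glE, con_glG i j (hom_pr1 _), con_smul,
        LinearMap.smul_apply]
      abel
    · simp only [map_add, map_sub, qr4_toN, qr4_glN, pr1_glE, pr2_glE, pr5_glE,
        con_glG i j (hom_pr1 _), con_smul, LinearMap.smul_apply, glG_mul i j (hom_pr2 _)]
      abel
    · have h1 : ∀ u : E n, Hom 1 (con (gen k) (pr2 u)) := fun u => hom_con_gen (hom_pr2 u) k
      have h2 : ∀ x : GA n, (gen k) {j} • x = if k = j then x else 0 := by
        intro x
        rw [gen_apply]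
        simp only [Finset.singleton_inj, eq_comm (a := j)]
        split_ifs <;> simp
      simp only [map_add, qr6_toN, qr6_glN, pr2_glE, pr5_glE, con_glG i j (hom_gen k), h2,
        glG_mul i j (h1 _), sub_mul]
      split_ifs
      · abel
      · simp only [zero_mul]; abel
  refine ⟨fun u v => ?_, fun u v => ?_, key i j, key j i⟩
  · simp only [dotE, pr1_glE, pr2_glE, pr5_glE, dotG_glG, dotG_smul_left, dotG_smul_right,
      dotG_gen, dotG_comm _ (gen i), mul_comm]
  · simp only [pairN_eq, qr1_glN, qr4_glN, qr6_glN, dotG_glG, dotG_sub_left, dotG_sub_right,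
      Finset.sum_sub_distrib]
    congr 2
    have : ∀ (p : Prop) [Decidable p] (f g : GA n), dotG (if p then f else 0) g
        = if p then dotG f g else 0 := by
      intro p _ f g; split_ifs <;> simp
    have h' : ∀ (p : Prop) [Decidable p] (f g : GA n), dotG f (if p then g else 0)
        = if p then dotG f g else 0 := by
      intro p _ f g; split_ifs <;> simp
    simp only [this, h', Finset.sum_ite_eq', Finset.mem_univ, if_true]

theorem derPair_id : DerPair (n := n) LinearMap.id LinearMap.id ((2 : ℝ) • LinearMap.id)
    ((2 : ℝ) • LinearMap.id) := by
  refine ⟨fun _ _ => rfl, fun u v => ?_, fun u v => ?_, fun u v => ?_⟩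
  · simp [pairN_smul_left, pairN_smul_right]
  · simp [two_smul]
  · simp [two_smul]

/-- The action of an element of `𝔤`, as a linear map. -/
def gLin (c : ℝ) (L : Matrix (Idx n 1) (Idx n 1) ℝ) (a₃ : Ext n 3) (a₆ : Ext n 6)
    (w₃ : Ext n 3) (w₆ : Ext n 6) : E n →ₗ[ℝ] E n :=
  c • LinearMap.id + ∑ i, ∑ j, L (ix i) (ix j) • glE i j + a3G (toGA 3 a₃) + a6G (toGA 6 a₆)
    + w3G (toGA 3 w₃) + w6G (toGA 6 w₆)

theorem toGA_glForm2 (L : Matrix (Idx n 1) (Idx n 1) ℝ) (s : Ext n 2) :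
    toGA 2 (glForm L s) = ∑ i, ∑ j, L (ix i) (ix j) • glG i j (toGA 2 s) := by
  change toGA (1 + 1) (glForm (k := 1) L s) = _
  rw [glForm, map_neg, map_sum, sum_ix, ← Finset.sum_neg_distrib]
  refine Finset.sum_congr rfl fun i _ => ?_
  rw [map_sum, sum_ix, ← Finset.sum_neg_distrib]
  refine Finset.sum_congr rfl fun j _ => ?_
  rw [map_smul, toGA_wedge, toGA_contract, toGA_basisVec, toGA_basisVec, glG_apply, smul_neg]

theorem toGA_glForm5 (L : Matrix (Idx n 1) (Idx n 1) ℝ) (s : Ext n 5) :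
    toGA 5 (glForm (k := 4) L s) = ∑ i, ∑ j, L (ix i) (ix j) • glG i j (toGA 5 s) := by
  change toGA (1 + 4) (glForm (k := 4) L s) = _
  rw [glForm, map_neg, map_sum, sum_ix, ← Finset.sum_neg_distrib]
  refine Finset.sum_congr rfl fun i _ => ?_
  rw [map_sum, sum_ix, ← Finset.sum_neg_distrib]
  refine Finset.sum_congr rfl fun j _ => ?_
  rw [map_smul, toGA_wedge, toGA_contract, toGA_basisVec, toGA_basisVec, glG_apply, smul_neg]

theorem toGA_mulVec (L : Matrix (Idx n 1) (Idx n 1) ℝ) (X : Ext n 1) :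
    toGA 1 (L.mulVec X) = ∑ i, ∑ j, L (ix i) (ix j) • toGA 1 X {j} • gen i := by
  rw [(hom_toGA (L.mulVec X)).eq_sum_gen]
  refine Finset.sum_congr rfl fun i _ => ?_
  have h : ∀ (Y : Ext n 1) (j : Fin n), toGA 1 Y {j} = Y (ix j) := fun Y j => toGA_apply_coe Y (ix j)
  simp only [h, Matrix.mulVec, dotProduct, sum_ix, Finset.sum_smul, smul_smul]

theorem gLin_apply (c : ℝ) (L : Matrix (Idx n 1) (Idx n 1) ℝ) (a₃ : Ext n 3) (a₆ : Ext n 6)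
    (w₃ : Ext n 3) (w₆ : Ext n 6) (u : E n) :
    gLin c L a₃ a₆ w₃ w₆ u = gAct c L a₃ a₆ w₃ w₆ u := by
  have h3 : ∀ a : Ext n 3, Hom 3 (toGA 3 a) := hom_toGA
  have h6 : ∀ a : Ext n 6, Hom 6 (toGA 6 a) := hom_toGA
  refine E.ext' ?_ ?_ ?_
  · simp only [gLin, LinearMap.add_apply, LinearMap.smul_apply, LinearMap.sum_apply, map_add,
      map_sum, map_smul, pr1_glE, pr1_a3G, pr1_a6G, pr1_w3G _ (h3 _), pr1_w6G _ (h6 _),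
      LinearMap.id_apply]
    change _ = toGA 1 (c • u.1 + L.mulVec u.1 + contract (l := 1) u.2.1 w₃
      - contract (l := 1) u.2.2 w₆)
    have e1 := toGA_contract (l := 1) u.2.1 w₃
    have e2 := toGA_contract (l := 1) u.2.2 w₆
    rw [map_sub, map_add, map_add, map_smul, toGA_mulVec, e1, e2]
    simp only [add_zero, sub_eq_add_neg]
    rfl
  · simp only [gLin, LinearMap.add_apply, LinearMap.smul_apply, LinearMap.sum_apply, map_add,
      map_sum, map_smul, pr2_glE, pr2_a3G _ (h3 _), pr2_a6G, pr2_w3G _ (h3 _), pr2_w6G,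
      LinearMap.id_apply]
    change _ = toGA 2 (c • u.2.1 + glForm (k := 1) L u.2.1 + contract (l := 2) w₃ u.2.2
      + contract (l := 2) u.1 a₃)
    have e1 := toGA_contract (l := 2) w₃ u.2.2
    have e2 := toGA_contract (l := 2) u.1 a₃
    have e3 := toGA_glForm2 L u.2.1
    rw [map_add, map_add, map_add, map_smul, e1, e2]
    erw [e3]
    simp only [add_zero]
    rw [add_right_comm]
    rfl
  · simp only [gLin, LinearMap.add_apply, LinearMap.smul_apply, LinearMap.sum_apply, map_add,
      map_sum, map_smul, pr5_glE, pr5_a3G _ (h3 _), pr5_a6G _ (h6 _), pr5_w3G, pr5_w6G,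
      LinearMap.id_apply]
    change _ = toGA 5 (c • u.2.2 + glForm (k := 4) L u.2.2 + wedge a₃ u.2.1
      + contract (l := 5) u.1 a₆)
    have e1 := toGA_wedge a₃ u.2.1
    have e2 := toGA_contract (l := 5) u.1 a₆
    have e3 := toGA_glForm5 L u.2.2
    rw [map_add, map_add, map_add, map_smul, e2]
    erw [e3, e1]
    simp only [add_zero]
    rfl

theorem isDer_gLin (hn : n ≤ 6) (c : ℝ) (L : Matrix (Idx n 1) (Idx n 1) ℝ) (a₃ : Ext n 3)
    (a₆ : Ext n 6) (w₃ : Ext n 3) (w₆ : Ext n 6) : IsDer (gLin c L a₃ a₆ w₃ w₆) :=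
  (((((IsDer.smul c ⟨_, _, _, derPair_id⟩).add
    (IsDer.sum _ _ fun i _ => IsDer.sum _ _ fun j _ => IsDer.smul _ ⟨_, _, _, derPair_glE i j⟩)).add
    (isDer_a3G hn (hom_toGA _))).add (isDer_a6G hn (hom_toGA _))).add
    (isDer_w3G hn (hom_toGA _))).add (isDer_w6G hn (hom_toGA _))

theorem InG.isDer (hn : n ≤ 6) {A : E n →ₗ[ℝ] E n} (h : InG A) : IsDer A := by
  obtain ⟨c, L, a₃, a₆, w₃, w₆, h⟩ := h
  have : A = gLin c L a₃ a₆ w₃ w₆ := by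
    refine LinearMap.ext fun u => ?_
    rw [h, gLin_apply]
  exact this ▸ isDer_gLin hn c L a₃ a₆ w₃ w₆

/-! ### Derivations belong to `𝔤` -/

/-- The inclusion of `T`. -/
def in1 : GA n →ₗ[ℝ] E n := mkE LinearMap.id 0 0
/-- The inclusion of `⋀² T*`. -/
def in2 : GA n →ₗ[ℝ] E n := mkE 0 LinearMap.id 0
/-- The inclusion of `⋀⁵ T*`. -/
def in5 : GA n →ₗ[ℝ] E n := mkE 0 0 LinearMap.id
/-- The inclusion of `T*`. -/
def jn1 : GA n →ₗ[ℝ] N n := mkN LinearMap.id 0 0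
/-- The inclusion of `⋀⁴ T*`. -/
def jn4 : GA n →ₗ[ℝ] N n := mkN 0 LinearMap.id 0
/-- The inclusions of `⋀⁶ T*`. -/
def jn6 (i : Fin n) : GA n →ₗ[ℝ] N n := mkN 0 0 (Pi.single i LinearMap.id)

section
variable {f : GA n}
theorem pr1_in1 (h : Hom 1 f) : pr1 (in1 f) = f := pr1_mkE (f1 := LinearMap.id) h
theorem pr2_in2 (h : Hom 2 f) : pr2 (in2 f) = f := pr2_mkE (f2 := LinearMap.id) h
theorem pr5_in5 (h : Hom 5 f) : pr5 (in5 f) = f := pr5_mkE (f5 := LinearMap.id) h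
@[simp] theorem pr1_in2 : pr1 (in2 f) = 0 := pr1_mkE Hom.zero
@[simp] theorem pr1_in5 : pr1 (in5 f) = 0 := pr1_mkE Hom.zero
@[simp] theorem pr2_in1 : pr2 (in1 f) = 0 := pr2_mkE Hom.zero
@[simp] theorem pr2_in5 : pr2 (in5 f) = 0 := pr2_mkE Hom.zero
@[simp] theorem pr5_in1 : pr5 (in1 f) = 0 := pr5_mkE Hom.zero
@[simp] theorem pr5_in2 : pr5 (in2 f) = 0 := pr5_mkE Hom.zero
theorem qr1_jn1 (h : Hom 1 f) : qr1 (jn1 f) = f := qr1_mkN (f1 := LinearMap.id) h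
theorem qr4_jn4 (h : Hom 4 f) : qr4 (jn4 f) = f := qr4_mkN (f4 := LinearMap.id) h
theorem qr6_jn6 (i j : Fin n) (h : Hom 6 f) : qr6 j (jn6 i f) = if j = i then f else 0 := by
  have e : (Pi.single i LinearMap.id : Fin n → GA n →ₗ[ℝ] GA n) j f = if j = i then f else 0 := by
    rw [Pi.single_apply]; split_ifs <;> rfl
  rw [← e]
  refine qr6_mkN j ?_
  rw [e]; split_ifs
  · exact h
  · exact Hom.zero
@[simp] theorem qr1_jn4 : qr1 (jn4 f) = 0 := qr1_mkN Hom.zero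
@[simp] theorem qr1_jn6 (i : Fin n) : qr1 (jn6 i f) = 0 := qr1_mkN Hom.zero
@[simp] theorem qr4_jn1 : qr4 (jn1 f) = 0 := qr4_mkN Hom.zero
@[simp] theorem qr4_jn6 (i : Fin n) : qr4 (jn6 i f) = 0 := qr4_mkN Hom.zero
@[simp] theorem qr6_jn1 (i : Fin n) : qr6 i (jn1 f) = 0 := qr6_mkN (f6 := 0) i Hom.zero
@[simp] theorem qr6_jn4 (i : Fin n) : qr6 i (jn4 f) = 0 := qr6_mkN (f6 := 0) i Hom.zero
end

theorem eq_in (u : E n) : u = in1 (pr1 u) + in2 (pr2 u) + in5 (pr5 u) := by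
  refine E.ext' ?_ ?_ ?_
  · simp [pr1_in1 (hom_pr1 u)]
  · simp [pr2_in2 (hom_pr2 u)]
  · simp [pr5_in5 (hom_pr5 u)]

theorem eq_jn (ν : N n) : ν = jn1 (qr1 ν) + jn4 (qr4 ν) + ∑ i, jn6 i (qr6 i ν) := by
  refine N.ext' ?_ ?_ fun i => ?_
  · simp [qr1_jn1 (hom_qr1 ν)]
  · simp [qr4_jn4 (hom_qr4 ν)]
  · simp [qr6_jn6 _ _ (hom_qr6 _ ν)]

theorem toN_in1_in1 {X Y : GA n} : toN (in1 X) (in1 Y) = 0 := by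
  refine N.ext' ?_ ?_ fun i => ?_
  · simp [qr1_toN]
  · simp [qr4_toN]
  · simp [qr6_toN]

theorem toN_in1_in2 {X s : GA n} (hX : Hom 1 X) (hs : Hom 2 s) :
    toN (in1 X) (in2 s) = jn1 (con X s) := by
  refine N.ext' ?_ ?_ fun i => ?_
  · simp [qr1_toN, pr1_in1 hX, pr2_in2 hs, qr1_jn1 (hX.contraction (l := 1) hs)]
  · simp [qr4_toN, con_zero]
  · simp [qr6_toN]

theorem toN_in1_in5 {X t : GA n} (hX : Hom 1 X) (ht : Hom 5 t) :
    toN (in1 X) (in5 t) = jn4 (con X t) := by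
  refine N.ext' ?_ ?_ fun i => ?_
  · simp [qr1_toN, con_zero]
  · simp [qr4_toN, pr1_in1 hX, pr5_in5 ht, con_zero, qr4_jn4 (hX.contraction (l := 4) ht)]
  · simp [qr6_toN]

theorem toN_in2_in2 {s s' : GA n} (hs : Hom 2 s) (hs' : Hom 2 s') :
    toN (in2 s) (in2 s') = -jn4 (s * s') := by
  refine N.ext' ?_ ?_ fun i => ?_
  · simp [qr1_toN, con_zero]
  · simp [qr4_toN, pr2_in2 hs, pr2_in2 hs', con_zero, qr4_jn4 (hs.mul hs')]
  · simp [qr6_toN]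

theorem toN_in2_in5 {s t : GA n} (hs : Hom 2 s) (ht : Hom 5 t) :
    toN (in2 s) (in5 t) = ∑ i, jn6 i (con (gen i) s * t) := by
  have h : ∀ i, Hom 6 (con (gen i) s * t) := fun i => (hom_con_gen hs i).mul ht
  refine N.ext' ?_ ?_ fun i => ?_
  · simp [qr1_toN, con_zero]
  · simp [qr4_toN, con_zero]
  · simp [qr6_toN, pr2_in2 hs, pr5_in5 ht, qr6_jn6 _ _ (h _)]

theorem toN_in5_in5 {t t' : GA n} : toN (in5 t) (in5 t') = 0 := by
  refine N.ext' ?_ ?_ fun i => ?_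
  · simp [qr1_toN, con_zero]
  · simp [qr4_toN, con_zero]
  · simp [qr6_toN]

/-- An antisymmetric block `T → ⋀ᵏ T*` is given by a form. -/
theorem exists_con_of_antisymm {k : ℕ} (φ : GA n → GA n) (h : ∀ i, Hom (k + 1) (φ (gen i)))
    (anti : ∀ i j, con (gen i) (φ (gen j)) + con (gen j) (φ (gen i)) = 0) :
    ∃ a, Hom (k + 2) a ∧ ∀ i, φ (gen i) = con (gen i) a := by
  have hs : Hom (k + 2) (∑ j, gen j * φ (gen j)) := Hom.sum fun j _ => by
    have := (hom_gen j).mul (h j)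
    rwa [show k + 2 = 1 + (k + 1) by omega]
  -- By antisymmetry, contracting the sum by `gen i` gives `φ (gen i)` once from the generator and
  -- `k + 1` times from the number operator.
  refine ⟨((k + 2 : ℕ) : ℝ)⁻¹ • ∑ j, gen j * φ (gen j), hs.smul _, fun i => ?_⟩
  have e : con (gen i) (∑ j, gen j * φ (gen j)) = ((k + 2 : ℕ) : ℝ) • φ (gen i) := by
    rw [map_sum]
    have : ∀ j, con (gen i) (gen j * φ (gen j))
        = (if i = j then φ (gen j) else 0) + gen j * con (gen j) (φ (gen i)) := by
      intro j
      rw [con_gen_mul_odd (by decide) i (hom_gen j), con_gen_gen, ite_mul, one_mul, zero_mul,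
        eq_neg_of_add_eq_zero_left (anti i j), mul_neg, sub_neg_eq_add]
    simp only [this, Finset.sum_add_distrib, sum_gen_mul_con (h i), Finset.sum_ite_eq,
      Finset.mem_univ, if_true]
    push_cast
    module
  rw [map_smul, e, smul_smul, inv_mul_cancel₀ (by positivity), one_smul]

theorem Hom.linear_ext {W : Type*} [AddCommGroup W] [Module ℝ W] {F G : GA n →ₗ[ℝ] W}
    (h : ∀ i, F (gen i) = G (gen i)) {X : GA n} (hX : Hom 1 X) : F X = G X := by
  rw [hX.eq_sum_gen, map_sum, map_sum]
  exact Finset.sum_congr rfl fun i _ => by rw [map_smul, map_smul, h]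

theorem Hom.ext_one {f g : GA n} (hf : Hom 1 f) (hg : Hom 1 g) (h : ∀ i, f {i} = g {i}) :
    f = g := by
  rw [hf.eq_sum_gen, hg.eq_sum_gen]
  exact Finset.sum_congr rfl fun i _ => by rw [h]

/-- Since `T` is isotropic for `E ⊗ E → N`, the derivation rule on `T ⊗ T` says that the blocks into
`⋀²` and `⋀⁵` are antisymmetric, hence contractions of forms. Applied to the transpose, the same
lemma yields the multivectors. -/
theorem DerPair.exists_forms {A B : E n →ₗ[ℝ] E n} {P Q : N n →ₗ[ℝ] N n} (h : DerPair A B P Q) :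
    ∃ a₃ a₆, Hom 3 a₃ ∧ Hom 6 a₆ ∧ ∀ X, Hom 1 X → pr2 (A (in1 X)) = con X a₃ ∧
      pr5 (A (in1 X)) = con X a₆ := by
  have key : ∀ i j, Elg.toN (A (in1 (gen i))) (in1 (gen j))
      + Elg.toN (in1 (gen i)) (A (in1 (gen j))) = 0 :=
    fun i j => by rw [h.toN, toN_in1_in1, map_zero]
  obtain ⟨a, ha, ha'⟩ := exists_con_of_antisymm (k := 1) (fun X => pr2 (A (in1 X)))
    (fun i => hom_pr2 _) (fun i j => by
      have := congrArg qr1 (key i j)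
      rw [add_comm]
      simpa [qr1_toN, pr1_in1 (hom_gen _)] using this)
  obtain ⟨b, hb, hb'⟩ := exists_con_of_antisymm (k := 4) (fun X => pr5 (A (in1 X)))
    (fun i => hom_pr5 _) (fun i j => by
      have := congrArg qr4 (key i j)
      rw [add_comm]
      simpa [qr4_toN, pr1_in1 (hom_gen _)] using this)
  refine ⟨a, b, ha, hb, fun X hX => ⟨?_, ?_⟩⟩
  · exact Hom.linear_ext (F := pr2 ∘ₗ A ∘ₗ in1) (G := conL a) ha' hX
  · exact Hom.linear_ext (F := pr5 ∘ₗ A ∘ₗ in1) (G := conL b) hb' hX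

theorem eq_zero_of_con_gen {k : ℕ} {f : GA n} (hf : Hom (k + 1) f) (h : ∀ i, con (gen i) f = 0) :
    f = 0 :=
  hf.eq_of_con Hom.zero fun i => by rw [h, map_zero]

/-- The test form is `gen i * gen j`, whose contractions are `gen j` and `-gen i`. The hypotheses
then say that the array of contractions of `Q (gen j)` looks like a scalar matrix. -/
theorem diag_of_con {Q : GA n →ₗ[ℝ] GA n}
    (h : ∀ i s, Hom 2 s → con (gen i) (Q (con (gen i) s)) = 0)
    (h' : ∀ i j s, Hom 2 s →
      con (gen i) (Q (con (gen j) s)) + con (gen j) (Q (con (gen i) s)) = 0) :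
    (∀ i j, i ≠ j → con (gen i) (Q (gen j)) = 0) ∧
      ∀ i j, con (gen i) (Q (gen i)) = con (gen j) (Q (gen j)) := by
  have hg : ∀ i j : Fin n, Hom 2 (gen i * gen j) := fun i j => (hom_gen i).mul (hom_gen j)
  have e : ∀ i j : Fin n, i ≠ j → con (gen i) (gen i * gen j) = gen j ∧
      con (gen j) (gen i * gen j) = -gen i := by
    intro i j hij
    constructor
    · rw [con_gen_mul_odd (by decide) i (hom_gen i), con_gen_gen, con_gen_gen]; simp [hij]
    · rw [con_gen_mul_odd (by decide) j (hom_gen i), con_gen_gen, con_gen_gen]; simp [hij.symm]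
  refine ⟨fun i j hij => ?_, fun i j => ?_⟩
  · have := h i _ (hg i j)
    rwa [(e i j hij).1] at this
  · rcases eq_or_ne i j with rfl | hij
    · rfl
    have := h' i j _ (hg i j)
    rw [(e i j hij).1, (e i j hij).2, map_neg, map_neg] at this
    exact (neg_add_eq_zero.1 this)

/-- The derivation which acts by `0`, `l` and `2 l` on the three summands. -/
theorem eq_diag_of_der {A B : E n →ₗ[ℝ] E n} {P Q : N n →ₗ[ℝ] N n} (h : DerPair A B P Q)
    (h1 : ∀ X, Hom 1 X → A (in1 X) = 0) (h2 : ∀ s, Hom 2 s → pr1 (A (in2 s)) = 0)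
    (h5 : ∀ t, Hom 5 t → pr1 (A (in5 t)) = 0) (hn : 0 < n) :
    ∃ l : ℝ, ∀ u, pr1 (A u) = 0 ∧ pr2 (A u) = l • pr2 u ∧ pr5 (A u) = (2 * l) • pr5 u := by
  -- As `A` kills `T`, pairing with `T` expresses the remaining blocks of `A` through `P`.
  have k2 : ∀ X s, Hom 1 X → Hom 2 s → toN (in1 X) (A (in2 s)) = P (jn1 (con X s)) := by
    intro X s hX hs
    rw [← toN_in1_in2 hX hs, ← h.toN, h1 X hX, toN_zero_left, zero_add]
  have k5 : ∀ X s, Hom 1 X → Hom 5 s → toN (in1 X) (A (in5 s)) = P (jn4 (con X s)) := by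
    intro X s hX hs
    rw [← toN_in1_in5 hX hs, ← h.toN, h1 X hX, toN_zero_left, zero_add]
  have q1 : ∀ X s, Hom 1 X → Hom 2 s → con X (pr2 (A (in2 s))) = qr1 (P (jn1 (con X s))) := by
    intro X s hX hs
    rw [← k2 X s hX hs, qr1_toN]; simp [pr1_in1 hX]
  have q4 : ∀ X s, Hom 1 X → Hom 2 s → con X (pr5 (A (in2 s))) = qr4 (P (jn1 (con X s))) := by
    intro X s hX hs
    rw [← k2 X s hX hs, qr4_toN]; simp [pr1_in1 hX]
  have aux : ∀ (Q : GA n →ₗ[ℝ] GA n) (f : GA n → GA n),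
      (∀ X s, Hom 1 X → Hom 2 s → con X (f s) = Q (con X s)) →
      (∀ i j, i ≠ j → con (gen i) (Q (gen j)) = 0) ∧
      ∀ i j, con (gen i) (Q (gen i)) = con (gen j) (Q (gen j)) := by
    intro Q f hf
    refine diag_of_con (fun i s hs => ?_) (fun i j s hs => ?_)
    · rw [← hf _ _ (hom_gen i) hs, con_con_self (hom_gen i)]
    · rw [← hf _ _ (hom_gen i) hs, ← hf _ _ (hom_gen j) hs, con_swap (hom_gen i) (hom_gen j)]
      simp
  obtain ⟨a1, a2⟩ := aux (qr1 ∘ₗ P ∘ₗ jn1) (fun s => pr2 (A (in2 s))) q1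
  obtain ⟨b1, b2⟩ := aux (qr4 ∘ₗ P ∘ₗ jn1) (fun s => pr5 (A (in2 s))) q4
  simp only [LinearMap.comp_apply] at a1 a2 b1 b2
  -- the block `T* → ⋀⁴ T*` of `P` vanishes
  have c1 : ∀ j, qr4 (P (jn1 (gen j))) = 0 := by
    intro j
    refine eq_zero_of_con_gen (k := 3) (hom_qr4 _) fun i => ?_
    rcases eq_or_ne i j with rfl | hij
    · refine eq_zero_of_con_gen (k := 2) (hom_con_gen (hom_qr4 _) i) fun m => ?_
      rcases eq_or_ne m i with rfl | hm
      · rw [con_con_self (hom_gen m)]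
      · rw [con_swap (hom_gen m) (hom_gen i), b1 m i hm, map_zero, neg_zero]
    · exact b1 i j hij
  have c2 : ∀ s, Hom 2 s → pr5 (A (in2 s)) = 0 := by
    intro s hs
    refine eq_zero_of_con_gen (k := 4) (hom_pr5 _) fun i => ?_
    rw [q4 _ _ (hom_gen i) hs]
    exact Hom.linear_ext (F := qr4 ∘ₗ P ∘ₗ jn1) (G := 0) c1 (hom_con_gen hs i)
  -- the block `T* → T*` is a scalar
  let l : ℝ := (con (gen ⟨0, hn⟩) (qr1 (P (jn1 (gen ⟨0, hn⟩))))) ∅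
  have d1 : ∀ j, qr1 (P (jn1 (gen j))) = l • gen j := by
    intro j
    refine (hom_qr1 _).eq_of_con (k := 0) ((hom_gen j).smul l) fun i => ?_
    rw [map_smul, con_gen_gen]
    rcases eq_or_ne i j with rfl | hij
    · rw [a2 i ⟨0, hn⟩, (hom_con_gen (k := 0) (hom_qr1 _) _).eq_smul_one]; simp [l]
    · rw [a1 i j hij]; simp [hij]
  have d2 : ∀ s, Hom 2 s → pr2 (A (in2 s)) = l • s := by
    intro s hs
    refine (hom_pr2 _).eq_of_con (k := 1) (hs.smul l) fun i => ?_
    rw [q1 _ _ (hom_gen i) hs, map_smul]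
    exact Hom.linear_ext (F := qr1 ∘ₗ P ∘ₗ jn1) (G := l • LinearMap.id) d1 (hom_con_gen hs i)
  have d : ∀ s, Hom 2 s → A (in2 s) = l • in2 s := by
    intro s hs
    refine E.ext' ?_ ?_ ?_
    · rw [h2 s hs, map_smul, pr1_in2, smul_zero]
    · rw [d2 s hs, map_smul, pr2_in2 hs]
    · rw [c2 s hs, map_smul, pr5_in2, smul_zero]
  -- Products of 2-forms span `⋀⁴`. Each factor is scaled by `l`, so `P` acts there by `2 * l`, and
  -- pairing with `T` passes this scalar on to `⋀⁵`.
  have e1 : ∀ f, Hom 4 f → P (jn4 f) = (2 * l) • jn4 f := by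
    intro f hf
    refine Hom.induction_mul (k := 3) (p := fun f => P (jn4 f) = (2 * l) • jn4 f) ?_ ?_ ?_ ?_ hf
    · simp
    · intro x y hx hy; rw [map_add, map_add, hx, hy, smul_add]
    · intro c x hx; rw [map_smul, map_smul, hx, smul_comm]
    intro i g hg
    refine Hom.induction_mul (k := 2) (p := fun g => P (jn4 (gen i * g)) = (2 * l) • jn4 (gen i * g))
      ?_ ?_ ?_ ?_ hg
    · simp
    · intro x y hx hy; rw [mul_add, map_add, map_add, hx, hy, smul_add]
    · intro c x hx; rw [mul_smul_comm, map_smul, map_smul, hx, smul_comm]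
    intro j s hs
    have hg : Hom 2 (gen i * gen j) := (hom_gen i).mul (hom_gen j)
    have := h.toN (in2 (gen i * gen j)) (in2 s)
    rw [d _ hg, d _ hs, toN_smul_left, toN_smul_right, toN_in2_in2 hg hs, map_neg, mul_assoc] at this
    rw [← neg_inj, ← this]; module
  have f5 : ∀ t, Hom 5 t → A (in5 t) = (2 * l) • in5 t := by
    intro t ht
    refine E.ext' ?_ ?_ ?_
    · rw [h5 t ht, map_smul, pr1_in5, smul_zero]
    · rw [map_smul, pr2_in5, smul_zero]
      refine eq_zero_of_con_gen (k := 1) (hom_pr2 _) fun i => ?_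
      have := congrArg qr1 (k5 _ _ (hom_gen i) ht)
      rw [e1 _ (hom_con_gen ht i), qr1_toN] at this
      simpa [pr1_in1 (hom_gen i)] using this
    · rw [map_smul, pr5_in5 ht]
      refine (hom_pr5 _).eq_of_con (k := 4) (ht.smul _) fun i => ?_
      have := congrArg qr4 (k5 _ _ (hom_gen i) ht)
      rw [e1 _ (hom_con_gen ht i), qr4_toN] at this
      simpa [pr1_in1 (hom_gen i), qr4_jn4 (hom_con_gen ht i)] using this
  refine ⟨l, fun u => ?_⟩
  have hu : A u = l • in2 (pr2 u) + (2 * l) • in5 (pr5 u) := by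
    conv_lhs => rw [eq_in u]
    rw [map_add, map_add, h1 _ (hom_pr1 u), d _ (hom_pr2 u), f5 _ (hom_pr5 u), zero_add]
  rw [hu]
  simp [pr2_in2 (hom_pr2 u), pr5_in5 (hom_pr5 u)]

theorem sum_glG {k : ℕ} {f : GA n} (hf : Hom k f) : ∑ i, glG i i f = -(k : ℝ) • f := by
  simp only [glG_apply, Finset.sum_neg_distrib, sum_gen_mul_con hf, neg_smul]

theorem in_glE (i j : Fin n) {X : GA n} (hX : Hom 1 X) : glE i j (in1 X) = X {j} • in1 (gen i) := by
  refine E.ext' ?_ ?_ ?_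
  · rw [pr1_glE, map_smul, pr1_in1 hX, pr1_in1 (hom_gen i)]
  · rw [pr2_glE, map_smul, pr2_in1, pr2_in1, map_zero, smul_zero]
  · rw [pr5_glE, map_smul, pr5_in1, pr5_in1, map_zero, smul_zero]

/-- A derivation of the structure maps belongs to `𝔤`. -/
theorem IsDer.inG (hn0 : 0 < n) (hn : n ≤ 6) {A : E n →ₗ[ℝ] E n} (hA : IsDer A) : InG A := by
  obtain ⟨B, P, Q, h⟩ := hA
  obtain ⟨a₃, a₆, ha3, ha6, ha⟩ := h.exists_forms
  obtain ⟨w₃, w₆, hw3, hw6, hw⟩ := h.symm.exists_forms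
  -- The component in `T` is the transpose of a block of `B`, which was already identified with
  -- contraction of a form.
  have p2 : ∀ s, Hom 2 s → pr1 (A (in2 s)) = con s w₃ := by
    intro s hs
    refine (hom_pr1 _).ext_one (hs.contraction (l := 1) hw3) fun i => ?_
    have := h.dotE (in1 (gen i)) (in2 s)
    simp only [dotE, pr1_in2, pr5_in2, pr2_in1, pr5_in1, pr1_in1 (hom_gen i), pr2_in2 hs,
      dotG_zero_left, dotG_zero_right, (hw _ (hom_gen i)).1, dotG_comm _ s,
      dotG_con hs (hom_gen i), dotG_gen] at this
    norm_num at this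
    exact this.symm
  have p5 : ∀ t, Hom 5 t → pr1 (A (in5 t)) = -con t w₆ := by
    intro t ht
    refine (hom_pr1 _).ext_one (ht.contraction (l := 1) hw6).neg fun i => ?_
    have := h.dotE (in1 (gen i)) (in5 t)
    simp only [dotE, pr1_in5, pr2_in5, pr2_in1, pr5_in1, pr1_in1 (hom_gen i), pr5_in5 ht,
      dotG_zero_left, dotG_zero_right, (hw _ (hom_gen i)).2, dotG_comm _ t,
      dotG_con ht (hom_gen i), dotG_gen] at this
    norm_num at this
    exact this.symm
  let L : Fin n → Fin n → ℝ := fun i j => pr1 (A (in1 (gen j))) {i}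
  -- Removing these blocks and then the `T → T` block leaves a derivation covered by
  -- `eq_diag_of_der`.
  let A1 := A - a3G a₃ - a6G a₆ - w3G w₃ - w6G w₆
  let A2 := A1 - ∑ i, ∑ j, L i j • glE i j
  have hA2 : IsDer A2 := (((((IsDer.sub ⟨B, P, Q, h⟩ (isDer_a3G hn ha3)).sub (isDer_a6G hn ha6)).sub
    (isDer_w3G hn hw3)).sub (isDer_w6G hn hw6)).sub
      (IsDer.sum _ _ fun i _ => IsDer.sum _ _ fun j _ => IsDer.smul _ ⟨_, _, _, derPair_glE i j⟩))
  obtain ⟨B2, P2, Q2, h2⟩ := hA2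
  have g1 : ∀ X, Hom 1 X → A2 (in1 X) = 0 := by
    intro X hX
    have e : (∑ i, ∑ j, L i j • glE i j (in1 X)) = in1 (pr1 (A (in1 X))) := by
      have e' : pr1 (A (in1 X)) = ∑ j, X {j} • pr1 (A (in1 (gen j))) := by
        conv_lhs => rw [hX.eq_sum_gen]
        simp only [map_sum, map_smul]
      rw [e', map_sum, Finset.sum_comm]
      refine Finset.sum_congr rfl fun j _ => ?_
      rw [map_smul, (hom_pr1 (A (in1 (gen j)))).eq_sum_gen, map_sum, Finset.smul_sum]
      refine Finset.sum_congr rfl fun i _ => ?_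
      rw [in_glE i j hX, map_smul, smul_comm]
    simp only [A2, A1, LinearMap.sub_apply, LinearMap.sum_apply, LinearMap.smul_apply, e]
    refine E.ext' ?_ ?_ ?_
    · simp [pr1_a3G, pr1_a6G, pr1_w3G _ hw3, pr1_w6G _ hw6, con_zero, pr1_in1 (hom_pr1 _)]
    · simp [pr2_a3G _ ha3, pr2_a6G, pr2_w3G _ hw3, pr2_w6G, pr1_in1 hX, (ha X hX).1]
    · simp [pr5_a3G _ ha3, pr5_a6G _ ha6, pr5_w3G, pr5_w6G, pr1_in1 hX, (ha X hX).2]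
  have g2 : ∀ s, Hom 2 s → pr1 (A2 (in2 s)) = 0 := by
    intro s hs
    simp [A2, A1, pr1_a3G, pr1_a6G, pr1_w3G _ hw3, pr1_w6G _ hw6, con_zero, p2 s hs, pr2_in2 hs,
      pr1_glE]
  have g5 : ∀ s, Hom 5 s → pr1 (A2 (in5 s)) = 0 := by
    intro s hs
    simp [A2, A1, pr1_a3G, pr1_a6G, pr1_w3G _ hw3, pr1_w6G _ hw6, con_zero, p5 s hs, pr5_in5 hs,
      pr1_glE]
  obtain ⟨l, hl⟩ := eq_diag_of_der h2 g1 g2 g5 hn0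
  -- The remainder with weights `0, l, 2 l` is `l / 3` times the identity minus the Euler element of
  -- `gl(T)`. The latter acts by `1` on `T` and by `-k` on `k`-forms, so the weights are `(1 - 1, 1
  -- + 2, 1 + 5)` times `l / 3`.
  refine ⟨l / 3, Matrix.of (fun I J => L (ixEquiv.symm I) (ixEquiv.symm J)
    - if I = J then l / 3 else 0), ofGA 3 a₃, ofGA 6 a₆, ofGA 3 w₃, ofGA 6 w₆, fun u => ?_⟩
  rw [← gLin_apply]
  have e : A u = A2 u + ((∑ i, ∑ j, L i j • glE i j u) + a3G a₃ u + a6G a₆ u + w3G w₃ u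
      + w6G w₆ u) := by
    simp only [A2, A1, LinearMap.sub_apply, LinearMap.sum_apply, LinearMap.smul_apply]; abel
  have e2 : A2 u = (l / 3) • u - ∑ i, (l / 3) • glE i i u := by
    refine E.ext' ?_ ?_ ?_
    · simp only [(hl u).1, map_sub, map_smul, map_sum, pr1_glE, ← Finset.smul_sum,
        ← (hom_pr1 u).eq_sum_gen, sub_self]
    · simp only [(hl u).2.1, map_sub, map_smul, map_sum, pr2_glE, ← Finset.smul_sum,
        sum_glG (hom_pr2 u)]
      push_cast; module
    · simp only [(hl u).2.2, map_sub, map_smul, map_sum, pr5_glE, ← Finset.smul_sum,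
        sum_glG (hom_pr5 u)]
      push_cast; module
  have e3 : ∀ i : Fin n, ixEquiv.symm (ix i) = i := fun i => ixEquiv.symm_apply_apply i
  rw [e, e2, gLin]
  simp only [LinearMap.add_apply, LinearMap.smul_apply, LinearMap.sum_apply, LinearMap.id_apply,
    toGA_ofGA ha3, toGA_ofGA ha6, toGA_ofGA hw3, toGA_ofGA hw6, Matrix.of_apply, e3, ix_inj, sub_smul,
    Finset.sum_sub_distrib, ite_smul, zero_smul, Finset.sum_ite_eq, Finset.mem_univ, if_true]
  abel

/-! ### The maps `E* ⊗ N → E` and `π` in coordinates -/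

theorem dotE_eq_sum (u v : E n) :
    dotE u v = ∑ i, u.1 i * v.1 i + (∑ i, u.2.1 i * v.2.1 i + ∑ i, u.2.2 i * v.2.2 i) := by
  rw [sum_mul_eq_dotG, sum_mul_eq_dotG, sum_mul_eq_dotG, ← add_assoc]
  rfl

theorem dotE_basisE_right (u : E n) (i) : dotE u (basisE n i) = (basisE n).coord i u := by
  rw [dotE_eq_sum]
  rcases i with i | i | i <;> simp [basisE, Pi.single_apply]

theorem dotE_basisE_left (i) (u : E n) : dotE (basisE n i) u = (basisE n).coord i u := by
  rw [dotE_comm, dotE_basisE_right]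

theorem sum_coord_smul (u : E n) : ∑ i, (basisE n).coord i u • basisE n i = u :=
  (basisE n).sum_repr u

theorem covec_coord (i) : covec ((basisE n).coord i) = basisE n i := by
  refine Eq.trans ?_ (sum_coord_smul (basisE n i))
  refine Finset.sum_congr rfl fun j _ => ?_
  rw [← dotE_basisE_left, ← dotE_basisE_left, dotE_comm]

theorem dotE_covec (ξ : Module.Dual ℝ (E n)) (u : E n) : dotE (covec ξ) u = ξ u := by
  conv_rhs => rw [← sum_coord_smul u]
  rw [covec, ← dotEB_apply, map_sum, map_sum, LinearMap.sum_apply]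
  refine Finset.sum_congr rfl fun i _ => ?_
  rw [map_smul, map_smul, LinearMap.smul_apply, dotEB_apply, dotE_basisE_left, smul_eq_mul,
    smul_eq_mul, mul_comm]

theorem covec_dotEB (x : E n) : covec (dotEB x) = x :=
  eq_of_dotE fun y => by rw [dotE_comm, dotE_covec, dotEB_apply, dotE_comm]

theorem dotEB_covec (ξ : Module.Dual ℝ (E n)) : dotEB (covec ξ) = ξ :=
  LinearMap.ext fun u => dotE_covec ξ u

/-- The map `E* ⊗ N → E` in coordinates. -/
def tE : E n →ₗ[ℝ] N n →ₗ[ℝ] E n :=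
  LinearMap.mk₂ ℝ (fun x ν => ∑ i, pairN (toN x (basisE n i)) ν • basisE n i)
    (fun x x' ν => by simp only [toN_add_left, pairN_add_left, add_smul, Finset.sum_add_distrib])
    (fun c x ν => by simp only [toN_smul_left, pairN_smul_left, mul_smul, Finset.smul_sum])
    (fun x ν ν' => by simp only [pairN_add_right, add_smul, Finset.sum_add_distrib])
    (fun c x ν => by simp only [pairN_smul_right, mul_smul, Finset.smul_sum])

theorem tE_apply (x : E n) (ν : N n) :
    tE x ν = ∑ i, pairN (toN x (basisE n i)) ν • basisE n i := rfl

theorem toE_eq (ξ : Module.Dual ℝ (E n)) (ν : N n) : toE ξ ν = tE (covec ξ) ν := by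
  simp only [toE, toNStar, covec_coord, tE_apply]

theorem dotE_tE (x y : E n) (ν : N n) : dotE y (tE x ν) = pairN (toN x y) ν := by
  rw [tE_apply, ← dotEB_apply, map_sum]
  conv_rhs => rw [← sum_coord_smul y]
  rw [← toNB_apply, map_sum, ← pairNB_apply, map_sum, LinearMap.sum_apply]
  refine Finset.sum_congr rfl fun i _ => ?_
  rw [map_smul, map_smul, map_smul, LinearMap.smul_apply, dotEB_apply, dotE_basisE_right,
    pairNB_apply, toNB_apply, smul_eq_mul, smul_eq_mul, mul_comm]

theorem DerPair.tE {A B : E n →ₗ[ℝ] E n} {P Q : N n →ₗ[ℝ] N n} (h : DerPair A B P Q) (x : E n)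
    (ν : N n) : A (tE x ν) = Elg.tE x (P ν) - Elg.tE (B x) ν := by
  refine eq_of_dotE fun y => ?_
  rw [← h.dotE, dotE_tE, ← dotEB_apply, map_sub, dotEB_apply, dotEB_apply, dotE_tE, dotE_tE,
    ← h.pairN, ← h.toN', pairN_add_left]
  ring

/-- `π(x ⊗ u)` in coordinates. -/
def piC : E n →ₗ[ℝ] E n →ₗ[ℝ] E n →ₗ[ℝ] E n :=
  LinearMap.mk₂ ℝ (fun x u => (dotEB x).smulRight u - tE x ∘ₗ toNB u)
    (fun x x' u => LinearMap.ext fun v => by simp [add_smul]; abel)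
    (fun c x u => LinearMap.ext fun v => by simp [mul_smul, smul_sub])
    (fun x u u' => LinearMap.ext fun v => by simp; abel)
    (fun c x u => LinearMap.ext fun v => by
      simp [smul_sub, smul_comm (dotE x v) c])

theorem piC_apply (x u v : E n) : piC x u v = dotE x v • u - tE x (toN u v) := rfl

theorem piMap_eq (B : E n →ₗ[ℝ] E n) (v : E n) :
    piMap B v = ∑ i, piC (basisE n i) (B (basisE n i)) v := by
  simp only [piC_apply, Finset.sum_sub_distrib, piMap, homToE, toE_eq, covec_coord]
  congr 1
  conv_lhs => rw [← sum_coord_smul v]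
  simp only [map_sum, map_smul, dotE_basisE_left]

/-- `π` as a linear map. -/
def piL : (E n →ₗ[ℝ] E n) →ₗ[ℝ] E n →ₗ[ℝ] E n where
  toFun B := ∑ i, piC (basisE n i) (B (basisE n i))
  map_add' B B' := by simp [Finset.sum_add_distrib]
  map_smul' c B := by simp [Finset.smul_sum]

theorem piMap_eq_piL (B : E n →ₗ[ℝ] E n) (v : E n) : piMap B v = piL B v := by
  simp [piMap_eq, piL]

theorem piL_smulRight (x u : E n) : piL ((dotEB x).smulRight u) = piC x u := by
  conv_rhs => rw [← sum_coord_smul x]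
  simp only [piL, LinearMap.coe_mk, AddHom.coe_mk, LinearMap.smulRight_apply, dotEB_apply,
    dotE_basisE_right, map_smul, map_sum, LinearMap.sum_apply, LinearMap.smul_apply]

/-- Equivariance of `π`, with `-B` as the action on `E*`. It spreads `IsDer` over all of `E*` and
later makes the Jacobiator linear over functions in its middle argument. -/
theorem DerPair.piC {A B : E n →ₗ[ℝ] E n} {P Q : N n →ₗ[ℝ] N n} (h : DerPair A B P Q) (x u : E n) :
    A ∘ₗ Elg.piC x u - Elg.piC x u ∘ₗ A = Elg.piC x (A u) - Elg.piC (B x) u := by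
  refine LinearMap.ext fun v => ?_
  simp only [LinearMap.sub_apply, LinearMap.comp_apply, piC_apply, map_sub, map_smul, h.tE, h.dotE,
    ← h.toN, map_add]
  module

theorem tE_in1 {X : GA n} (hX : Hom 1 X) (ν : N n) :
    tE (in1 X) ν = in2 (X * qr1 ν) + in5 (X * qr4 ν) := by
  have h2 : Hom 2 (X * qr1 ν) := hX.mul (hom_qr1 ν)
  have h5 : Hom 5 (X * qr4 ν) := hX.mul (hom_qr4 ν)
  refine eq_of_dotE fun y => ?_
  rw [dotE_tE, pairN_eq, dotE]
  simp only [qr1_toN, qr4_toN, qr6_toN, pr1_in1 hX, pr2_in1, pr5_in1, map_add, pr1_in2, pr1_in5,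
    pr2_in2 h2, pr2_in5, pr5_in2, pr5_in5 h5, map_zero, zero_mul, mul_zero, add_zero, sub_zero,
    dotG_zero_left, dotG_zero_right, Finset.sum_const_zero, zero_add]
  rw [dotG_comm (pr2 y), dotG_comm (pr5 y), dotG_mul_left, dotG_mul_left, dotG_comm, dotG_comm (con _ _)]

theorem con_one_one {X Y : GA n} (hX : Hom 1 X) (hY : Hom 1 Y) : con X Y = dotG X Y • (1 : GA n) := by
  have h0 : Hom 0 (con X Y) := hX.contraction (l := 0) hY
  rw [h0.eq_smul_one, ← dotG_one, ← dotG_mul_left, mul_one]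

/-- For a covector `ξ ∈ T*` the image of `π` is visibly in `𝔤`: a rank-one matrix, a 3-form and a
6-form. This is the base case of `isDer_piC`. -/
theorem piC_in1 {ξ : GA n} (hξ : Hom 1 ξ) (u : E n) :
    piC (in1 ξ) u = ∑ i, ∑ j, ((pr1 u) {i} * ξ {j}) • glE i j + a3G (ξ * pr2 u)
      + a6G (ξ * pr5 u) := by
  have h3 : Hom 3 (ξ * pr2 u) := hξ.mul (hom_pr2 u)
  have h6 : Hom 6 (ξ * pr5 u) := hξ.mul (hom_pr5 u)
  have hd : ∀ v : E n, dotE (in1 ξ) v = dotG ξ (pr1 v) := fun v => by simp [dotE, pr1_in1 hξ]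
  have hgl : ∀ f : GA n, ∑ i, ∑ j, ((pr1 u) {i} * ξ {j}) • glG i j f = -(ξ * con (pr1 u) f) := by
    intro f
    rw [con_eq_sum (hom_pr1 u)]
    conv_rhs => rw [hξ.eq_sum_gen]
    simp only [glG_apply, Finset.sum_mul, Finset.mul_sum, smul_mul_smul_comm, smul_neg,
      Finset.sum_neg_distrib]
    rw [Finset.sum_comm]
    simp only [mul_comm (ξ.coeff _)]
    rw [Finset.sum_comm]
  have hc : ∀ (v : E n) (f : GA n), con (pr1 v) (ξ * f) = dotG ξ (pr1 v) • f - ξ * con (pr1 v) f := by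
    intro v f
    rw [con_one_mul (hom_pr1 v) hξ, con_one_one (hom_pr1 v) hξ, dotG_comm]
    simp [sub_eq_add_neg]
  refine LinearMap.ext fun v => ?_
  have h2 : Hom 2 (ξ * qr1 (toN u v)) := hξ.mul (hom_qr1 _)
  have h5 : Hom 5 (ξ * qr4 (toN u v)) := hξ.mul (hom_qr4 _)
  rw [piC_apply, tE_in1 hξ, hd]
  simp only [LinearMap.add_apply, LinearMap.sum_apply, LinearMap.smul_apply]
  refine E.ext' ?_ ?_ ?_
  · simp only [map_sub, map_add, map_smul, map_sum, pr1_in2, pr1_in5, pr1_a3G, pr1_a6G, pr1_glE,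
      add_zero, sub_zero]
    conv_lhs => rw [(hom_pr1 u).eq_sum_gen]
    rw [Finset.smul_sum]
    refine Finset.sum_congr rfl fun i _ => ?_
    simp only [smul_smul, ← Finset.sum_smul]
    congr 1
    rw [(hom_pr1 v).eq_sum_gen, dotG_sum_right, Finset.sum_mul]
    refine Finset.sum_congr rfl fun j _ => ?_
    rw [dotG_smul_right, dotG_comm, dotG_gen, ← (hom_pr1 v).eq_sum_gen]; ring
  · simp only [map_sub, map_add, map_smul, map_sum, pr2_in2 h2, pr2_in5, pr2_a3G _ h3, pr2_a6G,
      pr2_glE, hgl, hc, add_zero]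
    simp only [qr1_toN, mul_add]
    abel
  · simp only [map_sub, map_add, map_smul, map_sum, pr5_in2, pr5_in5 h5, pr5_a3G _ h3, pr5_a6G _ h6,
      pr5_glE, hgl, hc]
    simp only [qr4_toN, mul_add, mul_sub, mul_assoc]
    abel

theorem sum_con_gen_mul {k : ℕ} {f : GA n} (hf : Hom k f) :
    ∑ i, con (gen i) (gen i * f) = ((n : ℝ) - k) • f := by
  have : ∀ i : Fin n, con (gen i) (gen i * f) = f - gen i * con (gen i) f := fun i => by
    rw [con_gen_mul_odd (by decide) i (hom_gen i), con_gen_gen]; simp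
  simp only [this, Finset.sum_sub_distrib, sum_gen_mul_con hf, Finset.sum_const, Finset.card_univ,
    Fintype.card_fin, sub_smul, Nat.cast_smul_eq_nsmul]

/-- Starting from `T* ⊆ E*`, equivariance carries the claim along the action of 3-vectors, which
reaches `⋀²T` from `T*` and `⋀⁵T` from `⋀²T`. In coordinates on `E*` a 3-vector acts by `a3G`. -/
theorem isDer_piC (hn3 : 3 ≤ n) (hn : n ≤ 6) (x u : E n) : IsDer (piC x u) := by
  have h1 : ∀ X : GA n, Hom 1 X → ∀ u, IsDer (piC (in1 X) u) := by
    intro X hX u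
    rw [piC_in1 hX]
    exact ((IsDer.sum _ _ fun i _ => IsDer.sum _ _ fun j _ =>
      IsDer.smul _ ⟨_, _, _, derPair_glE i j⟩).add (isDer_a3G hn (hX.mul (hom_pr2 u)))).add
      (isDer_a6G hn (hX.mul (hom_pr5 u)))
  have step : ∀ x : E n, (∀ u, IsDer (piC x u)) → ∀ W, Hom 3 W → ∀ u, IsDer (piC (a3G W x) u) := by
    intro x hx W hW u
    have e := (derPair_three hn hW).symm.piC x u
    rw [eq_sub_iff_add_eq, ← eq_sub_iff_add_eq'] at e
    rw [e]
    exact (hx _).sub (IsDer.comm ⟨_, _, _, (derPair_three hn hW).symm⟩ (hx u))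
  have h2 : ∀ s : GA n, Hom 2 s → ∀ u, IsDer (piC (in2 s) u) := by
    intro s hs u
    have hW : ∀ i, Hom 3 (gen i * s) := fun i => (hom_gen i).mul hs
    -- Contracting `gen i * s` by `gen i` and summing gives `(n - 2) • s`, which is nonzero as `n ≥
    -- 3`.
    have e : in2 s = ((n : ℝ) - 2)⁻¹ • ∑ i, a3G (gen i * s) (in1 (gen i)) := by
      have : ∀ i, a3G (gen i * s) (in1 (gen i)) = in2 (con (gen i) (gen i * s)) := by
        intro i
        refine E.ext' ?_ ?_ ?_
        · simp [pr1_a3G]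
        · rw [pr2_a3G _ (hW i), pr1_in1 (hom_gen i), pr2_in2 (hom_con_gen (hW i) i)]
        · rw [pr5_a3G _ (hW i), pr2_in1, mul_zero, pr5_in2]
      simp only [this]
      rw [← map_sum, sum_con_gen_mul hs, map_smul, smul_smul, Nat.cast_ofNat, inv_mul_cancel₀,
        one_smul]
      have : (3 : ℝ) ≤ n := by exact_mod_cast hn3
      linarith
    rw [e, map_smul, LinearMap.smul_apply, map_sum, LinearMap.sum_apply]
    exact IsDer.smul _ (IsDer.sum _ _ fun i _ => step _ (h1 _ (hom_gen i)) _ (hW i) u)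
  have h5 : ∀ t : GA n, Hom 5 t → ∀ u, IsDer (piC (in5 t) u) := by
    intro t ht u
    refine Hom.induction_mul (p := fun t => IsDer (piC (in5 t) u)) ?_ ?_ ?_ ?_ ht
    · simpa using IsDer.zero
    · intro x y hx hy; rw [map_add, map_add]; exact hx.add hy
    · intro c x hx; rw [map_smul, map_smul]; exact hx.smul c
    intro i g hg
    refine Hom.induction_mul (p := fun g => IsDer (piC (in5 (gen i * g)) u)) ?_ ?_ ?_ ?_ hg
    · simpa using IsDer.zero
    · intro x y hx hy; rw [mul_add, map_add, map_add]; exact hx.add hy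
    · intro c x hx; rw [mul_smul_comm, map_smul, map_smul]; exact hx.smul c
    intro j g hg
    refine Hom.induction_mul (p := fun g => IsDer (piC (in5 (gen i * (gen j * g))) u)) ?_ ?_ ?_ ?_ hg
    · simpa using IsDer.zero
    · intro x y hx hy; rw [mul_add, mul_add, map_add, map_add]; exact hx.add hy
    · intro c x hx; rw [mul_smul_comm, mul_smul_comm, map_smul, map_smul]; exact hx.smul c
    intro k s hs
    have hW : Hom 3 (gen i * gen j * gen k) := ((hom_gen i).mul (hom_gen j)).mul (hom_gen k)
    have e : in5 (gen i * (gen j * (gen k * s))) = a3G (gen i * gen j * gen k) (in2 s) := by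
      rw [← mul_assoc, ← mul_assoc]
      refine E.ext' ?_ ?_ ?_
      · simp [pr1_a3G]
      · rw [pr2_a3G _ hW]; simp [con_zero]
      · rw [pr5_a3G _ hW, pr2_in2 hs, pr5_in5 (hW.mul hs)]
    rw [e]
    exact step _ (h2 s hs) _ hW u
  rw [eq_in x, map_add, map_add]
  exact ((h1 _ (hom_pr1 x) u).add (h2 _ (hom_pr2 x) u)).add (h5 _ (hom_pr5 x) u)

theorem isDer_piL (hn3 : 3 ≤ n) (hn : n ≤ 6) (B : E n →ₗ[ℝ] E n) : IsDer (piL B) :=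
  IsDer.sum _ _ fun _ _ => isDer_piC hn3 hn _ _

/-- The number operator contributes `6`. The cross term takes one away, because `gen k * f` has
degree seven and so `gen k * con (gen b) f` is `f` for `b = k` and zero otherwise. -/
theorem sum_toN_eq_jn6 {f : GA n} (hn : n ≤ 6) (hf : Hom 6 f) (k : Fin n) :
    ∑ b, toN (in2 (gen k * gen b)) (in5 (con (gen b) f)) = (5 : ℝ) • jn6 k f := by
  have hz : ∀ b, gen k * con (gen b) f = if b = k then f else 0 := by
    intro b
    have h0 : gen k * f = 0 := ((hom_gen k).mul hf).eq_zero (by omega)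
    have := congrArg (con (gen b)) h0
    rw [con_gen_mul_odd (by decide) b (hom_gen k), con_gen_gen, map_zero, sub_eq_zero] at this
    rw [← this]; simp
  have h : ∀ b, toN (in2 (gen k * gen b)) (in5 (con (gen b) f))
      = jn6 k (gen b * con (gen b) f) - jn6 b (gen k * con (gen b) f) := by
    intro b
    rw [toN_in2_in5 ((hom_gen k).mul (hom_gen b)) (hom_con_gen hf b)]
    have : ∀ i, con (gen i) (gen k * gen b) = (if i = k then gen b else 0)
        - if i = b then gen k else 0 := by
      intro i
      rw [con_gen_mul_odd (by decide) i (hom_gen k), con_gen_gen, con_gen_gen]; simp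
    simp only [this, sub_mul, ite_mul, zero_mul, map_sub, Finset.sum_sub_distrib]
    simp only [apply_ite (jn6 _), map_zero, Finset.sum_ite_eq', Finset.mem_univ, if_true]
  simp only [h, hz, Finset.sum_sub_distrib, apply_ite (jn6 _), map_zero, Finset.sum_ite_eq',
    Finset.mem_univ, if_true]
  rw [← map_sum, sum_gen_mul_con hf, map_smul]
  push_cast; module

/-- Hence a linear map on `N` is known from its values on the elements `toN u v`. In particular the
symmetric part of a bracket determines `𝒟`. -/
theorem span_toN (hn3 : 3 ≤ n) (hn : n ≤ 6) :
    Submodule.span ℝ {ν : N n | ∃ u v, ν = toN u v} = ⊤ := by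
  set S := Submodule.span ℝ {ν : N n | ∃ u v, ν = toN u v}
  have hS : ∀ u v, toN u v ∈ S := fun u v => Submodule.subset_span ⟨u, v, rfl⟩
  rw [eq_top_iff]
  rintro ν -
  rw [eq_jn ν]
  refine S.add_mem (S.add_mem ?_ ?_) (S.sum_mem fun k _ => ?_)
  · have h1 := hom_qr1 ν
    have h0 : (n : ℝ) - (1 : ℕ) ≠ 0 := by
      have : (3 : ℝ) ≤ n := by exact_mod_cast hn3
      push_cast; linarith
    have e := congrArg jn1 (sum_con_gen_mul h1)
    rw [map_smul, ← inv_smul_eq_iff₀ h0] at e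
    rw [← e, map_sum]
    refine S.smul_mem _ (S.sum_mem fun i _ => ?_)
    rw [← toN_in1_in2 (hom_gen i) ((hom_gen i).mul h1)]
    exact hS _ _
  · refine Hom.induction_mul (p := fun f => jn4 f ∈ S) ?_ ?_ ?_ ?_ (hom_qr4 ν)
    · simp
    · intro x y hx hy; rw [map_add]; exact S.add_mem hx hy
    · intro c x hx; rw [map_smul]; exact S.smul_mem _ hx
    intro i g hg
    refine Hom.induction_mul (p := fun g => jn4 (gen i * g) ∈ S) ?_ ?_ ?_ ?_ hg
    · simp
    · intro x y hx hy; rw [mul_add, map_add]; exact S.add_mem hx hy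
    · intro c x hx; rw [mul_smul_comm, map_smul]; exact S.smul_mem _ hx
    intro j s hs
    rw [← mul_assoc, ← S.neg_mem_iff, ← toN_in2_in2 ((hom_gen i).mul (hom_gen j)) hs]
    exact hS _ _
  · have e := sum_toN_eq_jn6 hn (hom_qr6 k ν) k
    rw [← inv_smul_eq_iff₀ (by norm_num)] at e
    rw [← e]
    exact S.smul_mem _ (S.sum_mem fun b _ => hS _ _)

theorem eq_zero_of_toN (hn3 : 3 ≤ n) (hn : n ≤ 6) {W : Type*} [AddCommGroup W] [Module ℝ W]
    {D : N n →ₗ[ℝ] W} (h : ∀ u v, D (toN u v) = 0) : D = 0 := by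
  refine LinearMap.ext_on (span_toN hn3 hn) ?_
  rintro _ ⟨u, v, rfl⟩; simpa using h u v

/-! ### Good subspaces and automorphisms -/

/-- The properties of a subspace of `E*` on which the constructions of the theorem rely. -/
structure Good (L : Submodule ℝ (E n)) : Prop where
  -- Exactness at `E` of the sequence with `L` in place of the cotangent space.
  span : ∀ v, (∀ x ∈ L, dotE x v = 0) → v ∈ Submodule.span ℝ {e | ∃ x ∈ L, ∃ ν, e = tE x ν}
  -- Makes symmetric second-order terms disappear from `π`.
  symm : ∀ x ∈ L, ∀ y ∈ L, ∀ ν, piC x (tE y ν) + piC y (tE x ν) = 0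
  -- Applied to the difference of two brackets that agree modulo the annihilator of `L`.
  gauge : ∀ (X : E n →ₗ[ℝ] E n →ₗ[ℝ] E n) (D : N n →ₗ[ℝ] E n), (∀ u, IsDer (X u)) →
    (∀ x ∈ L, ∀ u v, dotE x (X u v) = 0) → (∀ u v, X u v + X v u = D (toN u v)) →
    ∀ x ∈ L, ∀ ν, X (tE x ν) = piC x (D ν)

/-- An automorphism `g` of the structure maps, with its contragredient `g'` and the actions on `N`
and `N*`. -/
structure AutPair (g g' : E n ≃ₗ[ℝ] E n) (h h' : N n ≃ₗ[ℝ] N n) : Prop where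
  dotE : ∀ u v, dotE (g' u) (g v) = dotE u v
  pairN : ∀ μ ν, pairN (h' μ) (h ν) = pairN μ ν
  toN : ∀ u v, toN (g u) (g v) = h (toN u v)
  toN' : ∀ u v, Elg.toN (g' u) (g' v) = h' (Elg.toN u v)

namespace AutPair
variable {g g' k k' : E n ≃ₗ[ℝ] E n} {h h' l l' : N n ≃ₗ[ℝ] N n}

theorem refl : AutPair (n := n) (.refl ℝ _) (.refl ℝ _) (.refl ℝ _) (.refl ℝ _) :=
  ⟨fun _ _ => rfl, fun _ _ => rfl, fun _ _ => rfl, fun _ _ => rfl⟩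

theorem swap (a : AutPair g g' h h') : AutPair g' g h' h :=
  ⟨fun u v => by rw [dotE_comm, a.dotE, dotE_comm], fun u v => by
    rw [pairN_comm, a.pairN, pairN_comm], a.toN', a.toN⟩

theorem trans (a : AutPair g g' h h') (b : AutPair k k' l l') :
    AutPair (g.trans k) (g'.trans k') (h.trans l) (h'.trans l') :=
  ⟨fun u v => by simp [b.dotE, a.dotE], fun u v => by simp [b.pairN, a.pairN],
    fun u v => by simp [b.toN, a.toN], fun u v => by simp [b.toN', a.toN']⟩

theorem inv (a : AutPair g g' h h') : AutPair g.symm g'.symm h.symm h'.symm :=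
  ⟨fun u v => by rw [← a.dotE]; simp, fun u v => by rw [← a.pairN]; simp,
    fun u v => by rw [LinearEquiv.eq_symm_apply, ← a.toN]; simp,
    fun u v => by rw [LinearEquiv.eq_symm_apply, ← a.toN']; simp⟩

theorem tE (a : AutPair g g' h h') (x : E n) (ν : N n) : Elg.tE (g' x) (h ν) = g (Elg.tE x ν) := by
  refine eq_of_dotE fun y => ?_
  obtain ⟨y, rfl⟩ := g'.surjective y
  rw [dotE_tE, a.toN', a.pairN, a.dotE, dotE_tE]

theorem piC (a : AutPair g g' h h') (x u v : E n) :
    Elg.piC (g' x) (g u) (g v) = g (Elg.piC x u v) := by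
  rw [piC_apply, piC_apply, a.dotE, a.toN, a.tE, map_sub, map_smul]

theorem conj (a : AutPair g g' h h') {A B : E n →ₗ[ℝ] E n} {P Q : N n →ₗ[ℝ] N n}
    (d : DerPair A B P Q) :
    DerPair (g.symm ∘ₗ A ∘ₗ g : E n →ₗ[ℝ] E n) (g'.symm ∘ₗ B ∘ₗ g' : E n →ₗ[ℝ] E n)
      (h.symm ∘ₗ P ∘ₗ h : N n →ₗ[ℝ] N n) (h'.symm ∘ₗ Q ∘ₗ h' : N n →ₗ[ℝ] N n) where
  dotE u v := by
    rw [← a.dotE, ← a.dotE u]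
    simp [d.dotE]
  pairN u v := by
    rw [← a.pairN, ← a.pairN u]
    simp [d.pairN]
  toN u v := by
    refine h.injective ?_
    rw [map_add, ← a.toN, ← a.toN]
    simp [d.toN, a.toN]
  toN' u v := by
    refine h'.injective ?_
    rw [map_add, ← a.toN', ← a.toN']
    simp [d.toN', a.toN']

theorem good (a : AutPair g g' h h') {L : Submodule ℝ (E n)} (hL : Good L) :
    Good (L.map (g' : E n →ₗ[ℝ] E n)) where
  span v hv := by
    have h1 := hL.span (g.symm v) fun x hx => by
      have := hv (g' x) ⟨x, hx, rfl⟩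
      rwa [← g.apply_symm_apply v, a.dotE] at this
    have h2 := Submodule.mem_map_of_mem (f := (g : E n →ₗ[ℝ] E n)) h1
    rw [Submodule.map_span] at h2
    simp only [LinearEquiv.coe_coe, LinearEquiv.apply_symm_apply] at h2
    refine Submodule.span_mono ?_ h2
    rintro _ ⟨_, ⟨x, hx, ν, rfl⟩, rfl⟩
    exact ⟨g' x, ⟨x, hx, rfl⟩, h ν, (a.tE x ν).symm⟩
  symm := by
    rintro _ ⟨x, hx, rfl⟩ _ ⟨y, hy, rfl⟩ ν
    obtain ⟨ν, rfl⟩ := h.surjective ν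
    refine LinearMap.ext fun v => ?_
    obtain ⟨v, rfl⟩ := g.surjective v
    have := LinearMap.congr_fun (hL.symm x hx y hy ν) v
    simp only [LinearMap.add_apply, LinearMap.zero_apply, LinearEquiv.coe_coe, a.tE, a.piC] at this ⊢
    rw [← map_add, this, map_zero]
  gauge X D hX hV hs := by
    rintro _ ⟨x, hx, rfl⟩ ν
    obtain ⟨ν, rfl⟩ := h.surjective ν
    let X' : E n →ₗ[ℝ] E n →ₗ[ℝ] E n :=
      LinearMap.mk₂ ℝ (fun u v => g.symm (X (g u) (g v))) (by intros; simp) (by intros; simp)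
        (by intros; simp) (by intros; simp)
    let D' : N n →ₗ[ℝ] E n := g.symm ∘ₗ D ∘ₗ h
    have key := hL.gauge X' D' (fun u => by
      obtain ⟨B, P, Q, d⟩ := hX (g u)
      exact ⟨_, _, _, a.conj d⟩) (fun x hx u v => by
        rw [← a.dotE]
        simpa [X'] using hV (g' x) ⟨x, hx, rfl⟩ (g u) (g v))
      (fun u v => by simp [X', D', ← map_add, hs, a.toN]) x hx ν
    refine LinearMap.ext fun v => ?_
    obtain ⟨v, rfl⟩ := g.surjective v
    have := congrArg g (LinearMap.congr_fun key v)
    rw [← a.piC] at this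
    simpa [X', D', a.tE] using this

end AutPair

/-- `g` is an automorphism of the structure maps. -/
def IsAut (g : E n ≃ₗ[ℝ] E n) : Prop := ∃ g' h h', AutPair g g' h h'

theorem IsAut.refl : IsAut (.refl ℝ (E n)) := ⟨_, _, _, AutPair.refl⟩

theorem IsAut.trans {g k : E n ≃ₗ[ℝ] E n} (hg : IsAut g) (hk : IsAut k) : IsAut (g.trans k) := by
  obtain ⟨_, _, _, a⟩ := hg
  obtain ⟨_, _, _, b⟩ := hk
  exact ⟨_, _, _, a.trans b⟩

theorem IsAut.good_of_map {g : E n ≃ₗ[ℝ] E n} (hg : IsAut g) {L : Submodule ℝ (E n)}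
    (hL : Good (L.map (g : E n →ₗ[ℝ] E n))) : Good L := by
  obtain ⟨_, _, _, a⟩ := hg
  have := a.inv.swap.good hL
  rwa [← Submodule.map_comp, LinearEquiv.comp_coe, LinearEquiv.self_trans_symm,
    LinearEquiv.refl_toLinearMap, Submodule.map_id] at this

theorem IsAut.toN_eq_zero {g : E n ≃ₗ[ℝ] E n} (hg : IsAut g) {u v : E n} (h : toN u v = 0) :
    toN (g u) (g v) = 0 := by
  obtain ⟨_, _, _, a⟩ := hg
  rw [a.toN, h, map_zero]

/-- The equivalence `1 + A` for `A² = 0`. -/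
def oneAdd (A : E n →ₗ[ℝ] E n) (h : ∀ u, A (A u) = 0) : E n ≃ₗ[ℝ] E n :=
  LinearEquiv.ofLinearMap (LinearMap.id + A) (LinearMap.id - A)
    (LinearMap.ext fun u => by simp [h]) (LinearMap.ext fun u => by simp [h])

@[simp] theorem oneAdd_apply (A : E n →ₗ[ℝ] E n) (h : ∀ u, A (A u) = 0) (u : E n) :
    oneAdd A h u = u + A u := rfl

/-- The exponential of the derivation. On `E` it stops at first order. On `N` the square of `P`
sends `toN u v` to `2 • toN (A u) (A v)` and the cube vanishes, so the exponential is `1 + P + P² /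
2`. The contragredient uses `-B` and `-Q`. -/
theorem isAut_oneAdd (hn3 : 3 ≤ n) (hn : n ≤ 6) {A : E n →ₗ[ℝ] E n} (hA : IsDer A)
    (h : ∀ u, A (A u) = 0) : IsAut (oneAdd A h) := by
  obtain ⟨B, P, Q, d⟩ := hA
  have hB : ∀ u, B (B u) = 0 := fun u => eq_of_dotE fun v => by
    rw [dotE_comm, d.dotE, d.dotE, h, ← dotEB_apply, ← dotEB_apply, map_zero, map_zero]
  have sq : ∀ {A : E n →ₗ[ℝ] E n} {P : N n →ₗ[ℝ] N n} (_ : ∀ u, A (A u) = 0)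
      (_ : ∀ u v, toN (A u) v + toN u (A v) = P (toN u v)) (u v : E n),
      P (P (toN u v)) = (2 : ℝ) • toN (A u) (A v) := by
    intro A P h d u v
    rw [← d, map_add, ← d, ← d, h, h, toN_zero_left, toN_zero_right]; module
  have cub : ∀ {A : E n →ₗ[ℝ] E n} {P : N n →ₗ[ℝ] N n} (_ : ∀ u, A (A u) = 0)
      (_ : ∀ u v, toN (A u) v + toN u (A v) = P (toN u v)) (ν : N n), P (P (P ν)) = 0 := by
    intro A P h d
    refine fun ν => LinearMap.congr_fun (eq_zero_of_toN hn3 hn (D := P ∘ₗ P ∘ₗ P) fun u v => ?_) ν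
    simp only [LinearMap.comp_apply]
    rw [sq h d, map_smul, ← d, h, h, toN_zero_left, toN_zero_right]; simp
  let ex : ∀ P : N n →ₗ[ℝ] N n, (∀ ν, P (P (P ν)) = 0) → N n ≃ₗ[ℝ] N n := fun P hP =>
    LinearEquiv.ofLinearMap (LinearMap.id + P + (2⁻¹ : ℝ) • (P ∘ₗ P))
      (LinearMap.id - P + (2⁻¹ : ℝ) • (P ∘ₗ P))
      (LinearMap.ext fun u => by
        simp only [LinearMap.comp_apply, LinearMap.add_apply, LinearMap.sub_apply,
          LinearMap.smul_apply, LinearMap.id_apply, map_add, map_sub, map_smul, hP, map_zero, smul_zero]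
        module)
      (LinearMap.ext fun u => by
        simp only [LinearMap.comp_apply, LinearMap.add_apply, LinearMap.sub_apply,
          LinearMap.smul_apply, LinearMap.id_apply, map_add, map_smul, hP, map_zero, smul_zero]
        module)
  have hB' : ∀ u, (-B) ((-B) u) = 0 := fun u => by simp [hB]
  have cP := cub h d.toN
  have cQ : ∀ ν, (-Q) ((-Q) ((-Q) ν)) = 0 := fun ν => by
    simp only [LinearMap.neg_apply, map_neg, neg_neg, cub hB d.toN' ν, neg_zero]
  refine ⟨oneAdd (-B) hB', ex P cP, ex (-Q) cQ, ?_, ?_, ?_, ?_⟩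
  · intro u v
    simp only [oneAdd_apply, LinearMap.neg_apply, dotE_add_left, dotE_add_right]
    simp only [← dotEB_apply, map_neg, LinearMap.neg_apply]
    simp only [dotEB_apply, d.dotE, h]
    simp only [← dotEB_apply, map_zero]
    ring
  · intro μ ν
    have e : ∀ ν, ex (-Q) cQ ν = ν - Q ν + (2⁻¹ : ℝ) • Q (Q ν) := fun ν => by
      change ν + (-Q) ν + (2⁻¹ : ℝ) • (-Q) ((-Q) ν) = _
      rw [LinearMap.neg_apply, LinearMap.neg_apply, map_neg, neg_neg, sub_eq_add_neg]
    have e' : ∀ ν, ex P cP ν = ν + P ν + (2⁻¹ : ℝ) • P (P ν) := fun ν => rfl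
    have l : ∀ ν, pairN (μ - Q μ + (2⁻¹ : ℝ) • Q (Q μ)) ν
        = pairN μ (ν - P ν + (2⁻¹ : ℝ) • P (P ν)) := by
      intro ν
      simp only [sub_eq_add_neg, pairN_add_left, pairN_add_right, pairN_smul_left,
        pairN_smul_right, d.pairN]
      simp only [← pairNB_apply, map_neg, LinearMap.neg_apply]
      simp only [pairNB_apply, d.pairN]
    rw [e, e', l]
    congr 1
    simp only [map_add, map_smul, cP, map_zero, smul_zero]
    module
  · intro u v
    change _ = toN u v + P (toN u v) + (2⁻¹ : ℝ) • P (P (toN u v))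
    rw [sq h d.toN, ← d.toN]
    simp only [oneAdd_apply, toN_add_left, toN_add_right]
    module
  · intro u v
    change _ = toN u v + -Q (toN u v) + (2⁻¹ : ℝ) • -Q (-Q (toN u v))
    rw [map_neg, sq hB d.toN', ← d.toN']
    simp only [oneAdd_apply, toN_add_left, toN_add_right, LinearMap.neg_apply, toN_neg_left,
      toN_neg_right]
    module

/-! ### The standard subspace is good -/

/-- The annihilator `T*` of `⋀² T* ⊕ ⋀⁵ T*`. -/
def stdL (n : ℕ) : Submodule ℝ (E n) := LinearMap.ker pr2 ⊓ LinearMap.ker pr5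

theorem mem_stdL {x : E n} : x ∈ stdL n ↔ pr2 x = 0 ∧ pr5 x = 0 := Iff.rfl

theorem eq_in1_of_mem {x : E n} (hx : x ∈ stdL n) : x = in1 (pr1 x) := by
  rw [mem_stdL] at hx
  conv_lhs => rw [eq_in x, hx.1, hx.2]
  simp

theorem in1_mem_stdL (X : GA n) : in1 X ∈ stdL n := ⟨pr2_in1, pr5_in1⟩

theorem con_one (f : GA n) : con 1 f = f :=
  eq_of_dotG fun x => by rw [← dotG_mul_left, one_mul]

theorem eq_zero_of_con_hom {k : ℕ} {W : GA n} (hW : Hom (k + 1) W)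
    (h : ∀ s, Hom k s → con s W = 0) : W = 0 := by
  induction k generalizing W with
  | zero =>
    rw [← con_one W]
    exact h 1 fun A hA => by
      rw [GA.one_apply, if_neg (fun e => hA (by rw [e, Finset.card_empty]))]
  | succ k ih =>
    refine eq_zero_of_con_gen hW fun i => ih (hom_con_gen hW i) fun s hs => ?_
    rw [← con_mul]
    exact h _ (by rw [add_comm]; exact (hom_gen i).mul hs)

/-- Derivations with image in `⋀² T* ⊕ ⋀⁵ T*`. -/
theorem IsDer.eq_of_pr1 (hn3 : 3 ≤ n) (hn : n ≤ 6) {A : E n →ₗ[ℝ] E n} (hA : IsDer A)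
    (h1 : ∀ u, pr1 (A u) = 0) : ∃ (c : ℝ) (a b : GA n), Hom 3 a ∧ Hom 6 b ∧
      ∀ u, pr2 (A u) = (3 * c) • pr2 u + con (pr1 u) a ∧
        pr5 (A u) = (6 * c) • pr5 u + a * pr2 u + con (pr1 u) b := by
  obtain ⟨c, L, a₃, a₆, w₃, w₆, h⟩ := hA.inG (by omega) hn
  simp only [← gLin_apply] at h
  have H3 : ∀ a : Ext n 3, Hom 3 (toGA 3 a) := hom_toGA
  have H6 : ∀ a : Ext n 6, Hom 6 (toGA 6 a) := hom_toGA
  have p1 : ∀ u, c • pr1 u + (∑ i, ∑ j, L (ix i) (ix j) • (pr1 u) {j} • gen i)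
      + con (pr2 u) (toGA 3 w₃) - con (pr5 u) (toGA 6 w₆) = 0 := by
    intro u
    rw [← h1 u, h]
    simp only [gLin, LinearMap.add_apply, LinearMap.smul_apply, LinearMap.sum_apply, map_add,
      map_sum, map_smul, pr1_glE, pr1_a3G, pr1_a6G, pr1_w3G _ (H3 _), pr1_w6G _ (H6 _),
      LinearMap.id_apply]
    abel
  -- The component in `T` of the image of a 2-form or of a 5-form comes only from the 3-vector or
  -- the 6-vector, so both are zero.
  have hw3 : toGA 3 w₃ = 0 := by
    refine eq_zero_of_con_hom (H3 _) fun s hs => ?_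
    simpa [pr2_in2 hs, con_zero] using p1 (in2 s)
  have hw6 : toGA 6 w₆ = 0 := by
    refine eq_zero_of_con_hom (H6 _) fun s hs => ?_
    simpa [pr5_in5 hs, con_zero] using p1 (in5 s)
  have hL : ∀ i j, L (ix i) (ix j) = if i = j then -c else 0 := by
    intro i j
    have e : c • gen j + ∑ i, L (ix i) (ix j) • gen i = 0 := by
      have := p1 (in1 (gen j))
      simpa [pr1_in1 (hom_gen j), con_zero, gen_apply] using this
    have := congrArg (fun f => dotG (gen i) f) e
    simp only [dotG_add_right, dotG_smul_right, dotG_sum_right, dotG_zero_right] at this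
    simp only [dotG_gen, gen_apply, Finset.singleton_inj, mul_ite, mul_one, mul_zero,
      Finset.sum_ite_eq, Finset.mem_univ, if_true] at this
    split_ifs at this ⊢ <;> linarith
  have hgl : ∀ {k : ℕ} {f : GA n}, Hom k f →
      ∑ i, ∑ j, L (ix i) (ix j) • glG i j f = (c * k) • f := by
    intro k f hf
    simp only [hL, ite_smul, zero_smul, Finset.sum_ite_eq, Finset.mem_univ, if_true,
      ← Finset.smul_sum, sum_glG hf, smul_smul]
    ring_nf
  -- The matrix part is `-c` times the identity, which acts on `k`-forms by `k * c`. Adding the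
  -- scalar `c` gives `3 * c` and `6 * c` for `k = 2` and `k = 5`.
  refine ⟨c, toGA 3 a₃, toGA 6 a₆, H3 _, H6 _, fun u => ⟨?_, ?_⟩⟩
  · rw [h]
    simp only [gLin, LinearMap.add_apply, LinearMap.smul_apply, LinearMap.sum_apply, map_add,
      map_sum, map_smul, pr2_glE, pr2_a3G _ (H3 _), pr2_a6G, pr2_w3G _ (H3 _), pr2_w6G,
      LinearMap.id_apply, hgl (hom_pr2 u)]
    simp only [hw3, con_zero, LinearMap.zero_apply, add_zero]
    push_cast; module
  · rw [h]
    simp only [gLin, LinearMap.add_apply, LinearMap.smul_apply, LinearMap.sum_apply, map_add,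
      map_sum, map_smul, pr5_glE, pr5_a3G _ (H3 _), pr5_a6G _ (H6 _), pr5_w3G, pr5_w6G,
      LinearMap.id_apply, hgl (hom_pr5 u)]
    push_cast; module

/-- By `diag_of_con` the off-diagonal contractions vanish and the diagonal ones share a common
value. Every generator annihilates that value by contraction, and its degree is positive, so it is
zero. -/
theorem zero_of_con {k : ℕ} {Q : GA n →ₗ[ℝ] GA n} (hQ : ∀ i, Hom (k + 2) (Q (gen i)))
    (h : ∀ i s, Hom 2 s → con (gen i) (Q (con (gen i) s)) = 0)
    (h' : ∀ i j s, Hom 2 s →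
      con (gen i) (Q (con (gen j) s)) + con (gen j) (Q (con (gen i) s)) = 0) {β : GA n}
    (hβ : Hom 1 β) : Q β = 0 := by
  obtain ⟨b1, b2⟩ := diag_of_con h h'
  refine Hom.linear_ext (F := Q) (G := 0) (fun j => ?_) hβ
  refine eq_zero_of_con_gen (k := k + 1) (hQ j) fun i => ?_
  rcases eq_or_ne i j with rfl | hij
  · refine eq_zero_of_con_gen (k := k) (hom_con_gen (hQ i) i) fun m => ?_
    rw [b2 i m, con_con_self (hom_gen m)]
  · exact b1 i j hij

theorem good_stdL_span (v : E n) (hv : ∀ x ∈ stdL n, dotE x v = 0) :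
    v ∈ Submodule.span ℝ {e | ∃ x ∈ stdL n, ∃ ν, e = tE x ν} := by
  set S := Submodule.span ℝ {e : E n | ∃ x ∈ stdL n, ∃ ν, e = tE x ν}
  have hS : ∀ i ν, tE (in1 (gen i)) ν ∈ S := fun i ν =>
    Submodule.subset_span ⟨_, in1_mem_stdL _, ν, rfl⟩
  have h1 : pr1 v = 0 := by
    refine (hom_pr1 v).ext_one Hom.zero fun i => ?_
    have := hv _ (in1_mem_stdL (gen i))
    rw [dotE, pr1_in1 (hom_gen i), pr2_in1, pr5_in1, dotG_zero_left, dotG_zero_left, dotG_gen] at this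
    simpa using this
  rw [eq_in v, h1, map_zero, zero_add]
  refine S.add_mem ?_ ?_
  · refine Hom.induction_mul (k := 1) (p := fun f => in2 f ∈ S) (by simp) (fun x y hx hy => ?_)
      (fun c x hx => ?_) (fun i g hg => ?_) (hom_pr2 v)
    · rw [map_add]; exact S.add_mem hx hy
    · rw [map_smul]; exact S.smul_mem _ hx
    · have := hS i (jn1 g)
      rwa [tE_in1 (hom_gen i), qr1_jn1 hg, qr4_jn1, mul_zero, map_zero, add_zero] at this
  · refine Hom.induction_mul (k := 4) (p := fun f => in5 f ∈ S) (by simp) (fun x y hx hy => ?_)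
      (fun c x hx => ?_) (fun i g hg => ?_) (hom_pr5 v)
    · rw [map_add]; exact S.add_mem hx hy
    · rw [map_smul]; exact S.smul_mem _ hx
    · have := hS i (jn4 g)
      rwa [tE_in1 (hom_gen i), qr4_jn4 hg, qr1_jn4, mul_zero, map_zero, zero_add] at this

theorem gen_mul_self (i : Fin n) : gen i * gen i = 0 := by
  have h : (2 : ℝ) • (gen i * gen i) = 0 := by
    rw [two_smul]; nth_rewrite 1 [gen_mul_gen]; exact neg_add_cancel _
  exact (smul_eq_zero.1 h).resolve_left two_ne_zero

theorem piC_in1_of_pr1 {ξ : GA n} (hξ : Hom 1 ξ) {u : E n} (hu : pr1 u = 0) :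
    piC (in1 ξ) u = a3G (ξ * pr2 u) + a6G (ξ * pr5 u) := by
  rw [piC_in1 hξ, hu]; simp

theorem a3G_smul (c : ℝ) (A : GA n) : a3G (c • A) = c • a3G A := by
  have : conL (c • A) = c • conL A := LinearMap.ext fun f => by simp
  have h2 : LinearMap.mulLeft ℝ (c • A) = c • LinearMap.mulLeft ℝ A :=
    LinearMap.ext fun f => by simp [smul_mul_assoc]
  refine LinearMap.ext fun u => ?_
  simp only [a3G, this, h2, LinearMap.smul_comp, mkE]
  refine Prod.ext ?_ (Prod.ext ?_ ?_) <;> simp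

theorem a6G_zero : a6G (0 : GA n) = 0 := by simpa using a6G_smul 0 (0 : GA n)
theorem a3G_neg (A : GA n) : a3G (-A) = -a3G A := by
  rw [← neg_one_smul ℝ A, a3G_smul]; module
theorem a6G_neg (A : GA n) : a6G (-A) = -a6G A := by
  rw [← neg_one_smul ℝ A, a6G_smul]; module

/-- Both terms are actions of 3- and 6-forms divisible by the product of the two covectors, and this
product is antisymmetric. -/
theorem good_stdL_symm (x : E n) (hx : x ∈ stdL n) (y : E n) (hy : y ∈ stdL n) (ν : N n) :
    piC x (tE y ν) + piC y (tE x ν) = 0 := by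
  have h1 := hom_pr1 x
  have h2 := hom_pr1 y
  have hm : ∀ {X Y : GA n}, Hom 1 X → Hom 1 Y → X * Y = -(Y * X) := fun hX hY =>
    hX.comm_odd hY (by decide)
  have pr : ∀ {X : GA n}, Hom 1 X → pr1 (tE (in1 X) ν) = 0 ∧ pr2 (tE (in1 X) ν) = X * qr1 ν ∧
      pr5 (tE (in1 X) ν) = X * qr4 ν := by
    intro X hX
    rw [tE_in1 hX]
    simp [pr2_in2 (hX.mul (hom_qr1 ν)), pr5_in5 (hX.mul (hom_qr4 ν))]
  rw [eq_in1_of_mem hx, eq_in1_of_mem hy, piC_in1_of_pr1 h1 (pr h2).1, piC_in1_of_pr1 h2 (pr h1).1,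
    (pr h1).2.1, (pr h1).2.2, (pr h2).2.1, (pr h2).2.2]
  simp only [← mul_assoc]
  rw [hm h1 h2, neg_mul, neg_mul, a3G_neg, a6G_neg]
  abel

/-- Each `X u` consists of a scale `c u`, a 3-form `a u` and a 6-form `b u`. The symmetry equation,
taken block by block, leaves only a 1-form `φ` and a 4-form `F` that matter for the conclusion. On
`⋀² ⊕ ⋀⁵` the map `X` and on `N` the map `D` are wedge products with these, and the claim reduces to
commuting `φ` and `F` past a covector. -/
theorem good_stdL_gauge (hn3 : 3 ≤ n) (hn : n ≤ 6) (X : E n →ₗ[ℝ] E n →ₗ[ℝ] E n)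
    (D : N n →ₗ[ℝ] E n) (hX : ∀ u, IsDer (X u)) (hV : ∀ x ∈ stdL n, ∀ u v, dotE x (X u v) = 0)
    (hs : ∀ u v, X u v + X v u = D (toN u v)) (x : E n) (hx : x ∈ stdL n) (ν : N n) :
    X (tE x ν) = piC x (D ν) := by
  have hX1 : ∀ u v, pr1 (X u v) = 0 := by
    intro u v
    refine (hom_pr1 _).ext_one Hom.zero fun i => ?_
    have := hV _ (in1_mem_stdL (gen i)) u v
    rw [dotE, pr1_in1 (hom_gen i), pr2_in1, pr5_in1, dotG_zero_left, dotG_zero_left, dotG_gen] at this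
    simpa using this
  have hD1 : ∀ ν, pr1 (D ν) = 0 := fun ν => by
    refine LinearMap.congr_fun (eq_zero_of_toN hn3 hn (D := pr1 ∘ₗ D) fun u v => ?_) ν
    simp [← hs, hX1]
  choose c a b ha hb hab using fun u => (hX u).eq_of_pr1 hn3 hn (hX1 u)
  have e2 : ∀ u v, pr2 (X u v) = (3 * c u) • pr2 v + con (pr1 v) (a u) := fun u v => (hab u v).1
  have e5 : ∀ u v, pr5 (X u v) = (6 * c u) • pr5 v + a u * pr2 v + con (pr1 v) (b u) :=
    fun u v => (hab u v).2
  have s2 : ∀ u v, pr2 (X u v) + pr2 (X v u) = pr2 (D (toN u v)) := fun u v => by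
    rw [← map_add, hs]
  have s5 : ∀ u v, pr5 (X u v) + pr5 (X v u) = pr5 (D (toN u v)) := fun u v => by
    rw [← map_add, hs]
  -- two arguments in `T`
  obtain ⟨F, hF, hF'⟩ := exists_con_of_antisymm (k := 2) (fun X => a (in1 X)) (fun i => ha _)
    (fun i j => by
      have := s2 (in1 (gen j)) (in1 (gen i))
      rw [toN_in1_in1, map_zero, map_zero, e2, e2] at this
      simpa [pr1_in1 (hom_gen _)] using this)
  obtain ⟨F7, hF7, hF7'⟩ := exists_con_of_antisymm (k := 5) (fun X => b (in1 X)) (fun i => hb _)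
    (fun i j => by
      have := s5 (in1 (gen j)) (in1 (gen i))
      rw [toN_in1_in1, map_zero, map_zero, e5, e5] at this
      simpa [pr1_in1 (hom_gen _)] using this)
  -- The form `F7` has degree seven.
  have hb1 : ∀ i, b (in1 (gen i)) = 0 := fun i => by
    rw [hF7' i, hF7.eq_zero (by omega), map_zero]
  -- The scales attached to basis vectors of `T`, collected into a 1-form.
  let φ : GA n := ∑ i, c (in1 (gen i)) • gen i
  have hφ : Hom 1 φ := Hom.sum fun i _ => (hom_gen i).smul _
  have hφi : ∀ i, con (gen i) φ = c (in1 (gen i)) • (1 : GA n) := by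
    intro i
    simp only [φ, map_sum, map_smul, con_gen_gen, smul_ite, smul_zero, Finset.sum_ite_eq,
      Finset.mem_univ, if_true]
  have hφm : ∀ i f, con (gen i) (φ * f) = c (in1 (gen i)) • f - φ * con (gen i) f := by
    intro i f
    rw [con_gen_mul_odd (by decide) i hφ, hφi, smul_mul_assoc, one_mul]
  -- one argument in `T` and one in `⋀² T*`
  have A2 : ∀ i s, Hom 2 s → (3 * c (in1 (gen i))) • s + con (gen i) (a (in2 s))
      = pr2 (D (jn1 (con (gen i) s))) := by
    intro i s hs
    have := s2 (in1 (gen i)) (in2 s)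
    rw [toN_in1_in2 (hom_gen i) hs, e2, e2] at this
    simpa [pr1_in1 (hom_gen _), pr2_in2 hs, con_zero] using this
  have B2 : ∀ i s, Hom 2 s → con (gen i) F * s + con (gen i) (b (in2 s))
      = pr5 (D (jn1 (con (gen i) s))) := by
    intro i s hs
    have := s5 (in1 (gen i)) (in2 s)
    rw [toN_in1_in2 (hom_gen i) hs, e5, e5] at this
    rw [← hF']
    simpa [pr1_in1 (hom_gen _), pr2_in2 hs, con_zero] using this
  -- The unknown `a (in2 s)` is eliminated by antisymmetry of repeated contractions, and
  -- `zero_of_con` then kills the difference from the expected value.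
  have D21 : ∀ β, Hom 1 β → pr2 (D (jn1 β)) = (3 : ℝ) • (φ * β) := by
    intro β hβ
    rw [← sub_eq_zero]
    refine zero_of_con (k := 0) (Q := pr2 ∘ₗ D ∘ₗ jn1 - (3 : ℝ) • LinearMap.mulLeft ℝ φ)
      (fun i => (hom_pr2 _).sub ((hφ.mul (hom_gen i)).smul _)) ?_ ?_ hβ
    · intro i s hs
      simp only [LinearMap.sub_apply, LinearMap.comp_apply, LinearMap.smul_apply,
        LinearMap.mulLeft_apply, map_sub, map_add, map_smul, ← A2 i s hs, hφm,
        con_con_self (hom_gen i), mul_zero]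
      module
    · intro i j s hs
      simp only [LinearMap.sub_apply, LinearMap.comp_apply, LinearMap.smul_apply,
        LinearMap.mulLeft_apply, map_sub, map_add, map_smul, ← A2 _ s hs, hφm,
        con_swap (hom_gen i) (hom_gen j), mul_neg]
      module
  have D51 : ∀ β, Hom 1 β → pr5 (D (jn1 β)) = -(F * β) := by
    intro β hβ
    rw [← sub_eq_zero, sub_neg_eq_add]
    refine zero_of_con (k := 3) (Q := pr5 ∘ₗ D ∘ₗ jn1 + LinearMap.mulLeft ℝ F)
      (fun i => (hom_pr5 _).add (hF.mul (hom_gen i))) ?_ ?_ hβ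
    · intro i s hs
      simp only [LinearMap.add_apply, LinearMap.comp_apply, LinearMap.mulLeft_apply, map_add,
        ← B2 i s hs, con_gen_mul_even (k := 4) (by decide) i hF,
        con_gen_mul_odd (k := 3) (by decide) i (hom_con_gen hF i), con_con_self (hom_gen i)]
      simp
    · intro i j s hs
      simp only [LinearMap.add_apply, LinearMap.comp_apply, LinearMap.mulLeft_apply, map_add,
        ← B2 _ s hs, con_gen_mul_even (k := 4) (by decide) _ hF,
        con_gen_mul_odd (k := 3) (by decide) _ (hom_con_gen hF _),
        con_swap (hom_gen i) (hom_gen j), neg_mul, mul_neg]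
      abel
  have a2 : ∀ s, Hom 2 s → a (in2 s) = -((3 : ℝ) • (φ * s)) := by
    intro s hs
    refine (ha _).eq_of_con (k := 2) ((hφ.mul hs).smul _).neg fun i => ?_
    have := A2 i s hs
    rw [D21 _ (hom_con_gen hs i)] at this
    rw [map_neg, map_smul, hφm, eq_sub_of_add_eq' this]
    module
  have b2 : ∀ s, Hom 2 s → b (in2 s) = -(F * s) := by
    intro s hs
    refine (hb _).eq_of_con (k := 5) (hF.mul hs).neg fun i => ?_
    have := B2 i s hs
    rw [D51 _ (hom_con_gen hs i)] at this
    rw [map_neg, con_gen_mul_even (k := 4) (by decide) i hF, eq_sub_of_add_eq' this]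
    abel
  -- two arguments in `⋀² T*`
  have C2 : ∀ s, Hom 2 s → ∀ s', Hom 2 s' → pr2 (X (in2 s) (in2 s')) = 0 := by
    intro s hs s' hs'
    refine Hom.induction_mul (k := 1) (p := fun s => pr2 (X (in2 s) (in2 s')) = 0) (by simp)
      (fun x y hx hy => by simp [hx, hy]) (fun c x hx => by simp [hx]) (fun i g hg => ?_) hs
    refine Hom.induction_mul (k := 0) (p := fun g => pr2 (X (in2 (gen i * g)) (in2 s')) = 0)
      (by simp) (fun x y hx hy => by simp [mul_add, hx, hy])
      (fun c x hx => by simp [mul_smul_comm, hx])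
      (fun j g hg => ?_) hg
    rw [hg.mul_scalar, mul_smul_comm, map_smul, map_smul, LinearMap.smul_apply, map_smul]
    -- A decomposable 2-form squares to zero, so the symmetry equation forces its scale to vanish or
    -- the form itself to be zero. Such forms span.
    set s := gen i * gen j with hsd
    have hs : Hom 2 s := (hom_gen i).mul (hom_gen j)
    have hss : s * s = 0 := by
      rw [hsd, mul_assoc, ← mul_assoc (gen j), gen_mul_gen j i, neg_mul, mul_neg, mul_assoc,
        ← mul_assoc (gen i), gen_mul_self, zero_mul, neg_zero]
    have h := s2 (in2 s) (in2 s)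
    rw [toN_in2_in2 hs hs, hss, map_zero, neg_zero, map_zero, map_zero, e2, pr2_in2 hs, pr1_in2,
      con_zero, LinearMap.zero_apply, add_zero, ← add_smul, smul_eq_zero] at h
    rcases h with h | h
    · rw [e2, pr1_in2, con_zero, LinearMap.zero_apply, add_zero, show c (in2 s) = 0 by linarith]
      simp
    · simp [h]
  have D54 : ∀ f, Hom 4 f → pr2 (D (jn4 f)) = 0 ∧ pr5 (D (jn4 f)) = (6 : ℝ) • (φ * f) := by
    intro f hf
    refine Hom.induction_mul (k := 3) (p := fun f => pr2 (D (jn4 f)) = 0 ∧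
      pr5 (D (jn4 f)) = (6 : ℝ) • (φ * f)) (by simp)
      (fun x y hx hy => by simp [hx, hy, mul_add]) (fun c x hx => by
        simp [hx, mul_smul_comm, smul_comm c])
      (fun i g hg => ?_) hf
    refine Hom.induction_mul (k := 2) (p := fun g => pr2 (D (jn4 (gen i * g))) = 0 ∧
      pr5 (D (jn4 (gen i * g))) = (6 : ℝ) • (φ * (gen i * g))) (by simp)
      (fun x y hx hy => by simp [hx, hy, mul_add]) (fun c x hx => by
        simp [hx, mul_smul_comm, smul_comm c])
      (fun j s' hs' => ?_) hg
    rw [← mul_assoc (gen i)]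
    set s := gen i * gen j with hsd
    have hs : Hom 2 s := (hom_gen i).mul (hom_gen j)
    have h2 := s2 (in2 s) (in2 s')
    have h5 := s5 (in2 s) (in2 s')
    rw [toN_in2_in2 hs hs', map_neg, map_neg, C2 s hs s' hs', C2 s' hs' s hs] at h2
    rw [toN_in2_in2 hs hs', map_neg, map_neg, e5, e5, a2 s hs, a2 s' hs', pr2_in2 hs,
      pr2_in2 hs', pr5_in2, pr5_in2, pr1_in2, pr1_in2, con_zero] at h5
    refine ⟨by simpa using h2.symm, ?_⟩
    rw [← neg_inj, ← h5]
    simp only [neg_mul, smul_mul_assoc, mul_assoc, hs'.comm_even hs (by decide)]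
    simp only [smul_zero, LinearMap.zero_apply]
    module
  -- one argument in `T` and one in `⋀⁵ T*`
  have a5 : ∀ t, Hom 5 t → a (in5 t) = 0 := by
    intro t ht
    refine eq_zero_of_con_gen (k := 2) (ha _) fun i => ?_
    have := s2 (in1 (gen i)) (in5 t)
    rw [toN_in1_in5 (hom_gen i) ht, (D54 _ (hom_con_gen ht i)).1, e2, e2] at this
    simpa [pr1_in1 (hom_gen _), con_zero] using this
  have b5 : ∀ t, Hom 5 t → b (in5 t) = -((6 : ℝ) • (φ * t)) := by
    intro t ht
    refine (hb _).eq_of_con (k := 5) ((hφ.mul ht).smul _).neg fun i => ?_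
    have := s5 (in1 (gen i)) (in5 t)
    rw [toN_in1_in5 (hom_gen i) ht, (D54 _ (hom_con_gen ht i)).2, e5, e5, pr5_in5 ht, pr5_in1,
      pr2_in1, pr2_in5, pr1_in5, pr1_in1 (hom_gen i), con_zero] at this
    rw [map_neg, map_smul, hφm]
    simp only [mul_zero, smul_zero, add_zero, zero_add, LinearMap.zero_apply] at this
    rw [eq_sub_of_add_eq' this]
    module
  -- two arguments in `⋀⁵ T*`
  have c5 : ∀ t, Hom 5 t → c (in5 t) = 0 ∨ t = 0 := by
    intro t ht
    have h := s5 (in5 t) (in5 t)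
    rw [toN_in5_in5, map_zero, map_zero, e5, pr5_in5 ht, pr2_in5, pr1_in5, con_zero, mul_zero,
      LinearMap.zero_apply, add_zero, add_zero, ← add_smul, smul_eq_zero] at h
    rcases h with h | h
    · left; linarith
    · exact Or.inr h
  have X5 : ∀ t, Hom 5 t → X (in5 t) = a6G (-((6 : ℝ) • (φ * t))) := by
    intro t ht
    have h6 : Hom 6 (-((6 : ℝ) • (φ * t))) := ((hφ.mul ht).smul _).neg
    rcases c5 t ht with h | h
    · refine LinearMap.ext fun v => E.ext' ?_ ?_ ?_
      · rw [hX1, pr1_a6G]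
      · rw [e2, h, a5 t ht, pr2_a6G]; simp
      · rw [e5, h, a5 t ht, b5 t ht, pr5_a6G _ h6]; simp
    · subst h; simp [a6G_zero]
  have X2 : ∀ s, Hom 2 s → X (in2 s) = a3G (-((3 : ℝ) • (φ * s))) + a6G (-(F * s)) := by
    intro s hs
    have h3 : Hom 3 (-((3 : ℝ) • (φ * s))) := ((hφ.mul hs).smul _).neg
    have h6 : Hom 6 (-(F * s)) := (hF.mul hs).neg
    -- The same scale multiplies every 2-form, and one nonzero 2-form exists.
    have hc : c (in2 s) = 0 := by
      have h0 : ∃ s' : GA n, Hom 2 s' ∧ s' ≠ 0 := by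
        refine ⟨gen ⟨0, by omega⟩ * gen ⟨1, by omega⟩, (hom_gen _).mul (hom_gen _), fun h => ?_⟩
        have := congrArg (con (gen ⟨0, by omega⟩)) h
        rw [con_gen_mul_odd (by decide) _ (hom_gen _), con_gen_gen, con_gen_gen] at this
        simp at this
        have := congrArg (con (gen ⟨1, by omega⟩)) this
        rw [con_gen_gen] at this
        have := congrArg (fun f : GA n => f ∅) this
        simp [GA.one_apply] at this
      obtain ⟨s', hs', h0⟩ := h0
      have := C2 s hs s' hs'
      rw [e2, pr1_in2, con_zero, LinearMap.zero_apply, add_zero, pr2_in2 hs', smul_eq_zero] at this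
      rcases this with h | h
      · linarith
      · exact absurd h h0
    refine LinearMap.ext fun v => E.ext' ?_ ?_ ?_
    · rw [hX1, LinearMap.add_apply, map_add, pr1_a3G, pr1_a6G, add_zero]
    · rw [e2, hc, a2 s hs, LinearMap.add_apply, map_add, pr2_a3G _ h3, pr2_a6G]; simp
    · rw [e5, hc, a2 s hs, b2 s hs, LinearMap.add_apply, map_add, pr5_a3G _ h3, pr5_a6G _ h6]; simp
  -- The summand `T* ⊗ ⋀⁶` comes from pairs in `⋀² ⊗ ⋀⁵`, on which `X` vanishes in both orders.
  have D6 : ∀ k f, Hom 6 f → D (jn6 k f) = 0 := by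
    intro k f hf
    have e := congrArg D (sum_toN_eq_jn6 hn hf k)
    rw [map_smul, eq_comm, ← eq_inv_smul_iff₀ (by norm_num)] at e
    rw [e, map_sum]
    refine (congrArg _ (Finset.sum_eq_zero fun i _ => ?_)).trans (smul_zero _)
    have hg : Hom 2 (gen k * gen i) := (hom_gen k).mul (hom_gen i)
    have ht : Hom 5 (con (gen i) f) := hom_con_gen hf i
    rw [← hs, X2 _ hg, X5 _ ht]
    have h3 : Hom 3 (-((3 : ℝ) • (φ * (gen k * gen i)))) := ((hφ.mul hg).smul _).neg
    have h6 : Hom 6 (-(F * (gen k * gen i))) := (hF.mul hg).neg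
    have h6' : Hom 6 (-((6 : ℝ) • (φ * con (gen i) f))) := ((hφ.mul ht).smul _).neg
    refine E.ext' ?_ ?_ ?_
    · simp [pr1_a3G, pr1_a6G]
    · simp [pr2_a3G _ h3, pr2_a6G, con_zero]
    · simp [pr5_a3G _ h3, pr5_a6G _ h6, pr5_a6G _ h6', con_zero]
  have hD2 : pr2 (D ν) = (3 : ℝ) • (φ * qr1 ν) := by
    rw [eq_jn ν]
    simp only [map_add, map_sum, D21 _ (hom_qr1 ν), (D54 _ (hom_qr4 ν)).1, D6 _ _ (hom_qr6 _ ν)]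
    simp [qr1_jn1 (hom_qr1 ν)]
  have hD5 : pr5 (D ν) = -(F * qr1 ν) + (6 : ℝ) • (φ * qr4 ν) := by
    rw [eq_jn ν]
    simp only [map_add, map_sum, D51 _ (hom_qr1 ν), (D54 _ (hom_qr4 ν)).2, D6 _ _ (hom_qr6 _ ν)]
    simp [qr1_jn1 (hom_qr1 ν), qr4_jn4 (hom_qr4 ν)]
  have h1 := hom_pr1 x
  rw [eq_in1_of_mem hx, piC_in1_of_pr1 h1 (hD1 ν), tE_in1 h1, map_add, X2 _ (h1.mul (hom_qr1 ν)),
    X5 _ (h1.mul (hom_qr4 ν)), hD2, hD5, add_assoc, ← a6G_add]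
  have r1 : φ * (pr1 x * qr1 ν) = -(pr1 x * (φ * qr1 ν)) := by
    rw [← mul_assoc, hφ.comm_odd h1 (by decide), neg_mul, mul_assoc]
  have r2 : φ * (pr1 x * qr4 ν) = -(pr1 x * (φ * qr4 ν)) := by
    rw [← mul_assoc, hφ.comm_odd h1 (by decide), neg_mul, mul_assoc]
  have r3 : F * (pr1 x * qr1 ν) = pr1 x * (F * qr1 ν) := by
    rw [← mul_assoc, hF.comm_even h1 (by decide), mul_assoc]
  rw [r1, r2, r3, mul_add, mul_neg, mul_smul_comm, mul_smul_comm, smul_neg, smul_neg, neg_neg,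
    neg_neg]

theorem good_stdL (hn3 : 3 ≤ n) (hn : n ≤ 6) : Good (stdL n) :=
  ⟨good_stdL_span, good_stdL_symm, good_stdL_gauge hn3 hn⟩

/-! ### Isotropic subspaces of dimension `n` -/

/-- Modulo `S` every vector is a combination of `gen i` and `gen j`, which repeat in the threefold
contraction. -/
theorem con_eq_zero_of_codim {i j : Fin n} {S : Submodule ℝ (GA n)} (hS : ∀ X ∈ S, Hom 1 X)
    (hT : ∀ z, ∃ a b : ℝ, gen z - a • gen i - b • gen j ∈ S) {f : GA n}
    (hf : ∀ X ∈ S, con X f = 0) (z : Fin n) : con (gen z) (con (gen j) (con (gen i) f)) = 0 := by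
  obtain ⟨a, b, hz⟩ := hT z
  have h1 : con (gen z - a • gen i - b • gen j) (con (gen j) (con (gen i) f)) = 0 := by
    rw [con_swap (hS _ hz) (hom_gen j), con_swap (hS _ hz) (hom_gen i), hf _ hz]; simp
  rw [con_sub, con_sub, con_smul, con_smul] at h1
  simp only [LinearMap.sub_apply, LinearMap.smul_apply, con_con_self (hom_gen j)] at h1
  rw [con_swap (hom_gen i) (hom_gen j), con_con_self (hom_gen i)] at h1
  simpa using h1

/-- Such an `f` lives on the quotient spanned by `gen i` and `gen j`, of dimension at most two.
There a form of degree at least two is detected by its double contraction. -/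
theorem eq_zero_of_codim {k : ℕ} {i j : Fin n} {S : Submodule ℝ (GA n)} (hS : ∀ X ∈ S, Hom 1 X)
    (hT : ∀ z, ∃ a b : ℝ, gen z - a • gen i - b • gen j ∈ S) {f : GA n} (hfk : Hom (k + 2) f)
    (hf : ∀ X ∈ S, con X f = 0) (h0 : con (gen j) (con (gen i) f) = 0) : f = 0 := by
  have key : ∀ g : GA n, (∀ X ∈ S, con X g = 0) → ∀ z, ∃ a b : ℝ,
      con (gen z) g = a • con (gen i) g + b • con (gen j) g := by
    intro g hg z
    obtain ⟨a, b, hz⟩ := hT z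
    have h1 := hg _ hz
    rw [con_sub, con_sub, con_smul, con_smul] at h1
    simp only [LinearMap.sub_apply, LinearMap.smul_apply] at h1
    refine ⟨a, b, ?_⟩
    rw [← sub_eq_zero, ← h1]; abel
  have hi : con (gen i) f = 0 := by
    refine eq_zero_of_con_gen (k := k) (hom_con_gen hfk i) fun z => ?_
    obtain ⟨a, b, h⟩ := key _ (fun X hX => by
      rw [con_swap (hS _ hX) (hom_gen i), hf _ hX, map_zero, neg_zero]) z
    rw [h, con_con_self (hom_gen i), h0]; simp
  have hj : con (gen j) f = 0 := by
    refine eq_zero_of_con_gen (k := k) (hom_con_gen hfk j) fun z => ?_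
    obtain ⟨a, b, h⟩ := key _ (fun X hX => by
      rw [con_swap (hS _ hX) (hom_gen j), hf _ hX, map_zero, neg_zero]) z
    rw [h, con_con_self (hom_gen j), con_swap (hom_gen i) (hom_gen j), h0]; simp
  refine eq_zero_of_con_gen (k := k + 1) hfk fun z => ?_
  obtain ⟨a, b, h⟩ := key f hf z
  rw [h, hi, hj]; simp

/-- The projection to `T`. -/
def prT : E n →ₗ[ℝ] Ext n 1 := LinearMap.fst ℝ _ _

theorem toGA_prT (u : E n) : toGA 1 (prT u) = pr1 u := rfl

theorem prT_mem_iff {L : Submodule ℝ (E n)} {u : E n} :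
    prT u ∈ L.map prT ↔ pr1 u ∈ L.map pr1 := by
  constructor
  · rintro ⟨l, hl, h⟩; exact ⟨l, hl, congrArg (toGA 1) h⟩
  · rintro ⟨l, hl, h⟩; exact ⟨l, hl, toGA_injective 1 h⟩

/-- The rank of the projection of `L` to `T`. -/
def rk (L : Submodule ℝ (E n)) : ℕ := Module.finrank ℝ (L.map prT)

theorem card_idx_one : Fintype.card (Idx n 1) = n := by
  rw [← Fintype.card_congr (ixEquiv (n := n)), Fintype.card_fin]

theorem finrank_ext_one : Module.finrank ℝ (Ext n 1) = n := by
  rw [Module.finrank_fintype_fun_eq_card, card_idx_one]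

theorem rk_le (L : Submodule ℝ (E n)) : rk L ≤ n :=
  (Submodule.finrank_le _).trans finrank_ext_one.le

/-- Among the images of `L` under automorphisms, some have maximal rank over `T`. -/
theorem exists_max_rk (L : Submodule ℝ (E n)) : ∃ e : E n ≃ₗ[ℝ] E n, IsAut e ∧
    ∀ k : E n ≃ₗ[ℝ] E n, IsAut k → rk ((L.map (e : E n →ₗ[ℝ] E n)).map (k : E n →ₗ[ℝ] E n))
      ≤ rk (L.map (e : E n →ₗ[ℝ] E n)) := by
  let S : Set ℕ := {m | ∃ e : E n ≃ₗ[ℝ] E n, IsAut e ∧ rk (L.map (e : E n →ₗ[ℝ] E n)) = m}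
  have hb : BddAbove S := ⟨n, by rintro _ ⟨e, _, rfl⟩; exact rk_le _⟩
  have hne : S.Nonempty := ⟨_, .refl ℝ _, IsAut.refl, rfl⟩
  obtain ⟨e, he, hm⟩ := Nat.sSup_mem hne hb
  refine ⟨e, he, fun k hk => ?_⟩
  rw [hm, ← Submodule.map_comp]
  exact le_csSup hb ⟨e.trans k, he.trans hk, rfl⟩

/-- If the rank of `L` over `T` is maximal, then infinitesimal automorphisms cannot increase it. -/
theorem mem_of_max_rk (hn3 : 3 ≤ n) (hn : n ≤ 6) {L : Submodule ℝ (E n)}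
    (hmax : ∀ k : E n ≃ₗ[ℝ] E n, IsAut k → rk (L.map (k : E n →ₗ[ℝ] E n)) ≤ rk L)
    {B : E n →ₗ[ℝ] E n} (hB : IsDer B) (hB2 : ∀ u, B (B u) = 0) {u : E n} (hu : u ∈ L)
    (hu0 : pr1 u = 0) : pr1 (B u) ∈ L.map pr1 := by
  rw [← prT_mem_iff]
  by_contra hz
  have hu0' : prT u = 0 := toGA_injective 1 (by rw [toGA_prT, hu0, map_zero])
  let b := Module.finBasis ℝ (L.map prT)
  have hb : ∀ i, ∃ l ∈ L, prT l = b i := fun i => (b i).2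
  choose l hl hlb using hb
  -- For `t ≠ 0` these vectors lie in the projection of `(1 + t B) L`. The first is the image of
  -- `t⁻¹ • u`, because `u` has no component in `T`. They are independent at `t = 0`, and
  -- independence is an open condition, so the rank would rise.
  let f : ℝ → Fin (rk L + 1) → Ext n 1 := fun t =>
    Fin.cons (prT (B u)) fun i => (b i : Ext n 1) + t • prT (B (l i))
  have hf0 : LinearIndependent ℝ (f 0) := by
    simp only [f, zero_smul, add_zero]
    rw [linearIndependent_finCons]
    refine ⟨b.linearIndependent.map' (L.map prT).subtype (Submodule.ker_subtype _), fun h => hz ?_⟩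
    refine Submodule.span_le.2 ?_ h
    rintro _ ⟨i, rfl⟩; exact (b i).2
  have hfc : Continuous f := by
    refine continuous_pi fun i => ?_
    refine Fin.cases ?_ (fun i => ?_) i
    · simp only [f, Fin.cons_zero]; fun_prop
    · simp only [f, Fin.cons_succ]; fun_prop
  have hopen : IsOpen {t | LinearIndependent ℝ (f t)} :=
    isOpen_setOfPred_linearIndependent.preimage hfc
  have hev : ∀ᶠ t in nhdsWithin (0 : ℝ) {0}ᶜ, LinearIndependent ℝ (f t) :=
    nhdsWithin_le_nhds (hopen.mem_nhds hf0)
  obtain ⟨t, ht, ht0⟩ := (hev.and self_mem_nhdsWithin).exists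
  have h2 : ∀ u, (t • B) ((t • B) u) = 0 := fun u => by simp [hB2]
  have hk := hmax _ (isAut_oneAdd hn3 hn (hB.smul t) h2)
  have hspan : Submodule.span ℝ (Set.range (f t)) ≤
      (L.map (oneAdd (t • B) h2 : E n →ₗ[ℝ] E n)).map prT := by
    rw [Submodule.span_le]
    rintro _ ⟨i, rfl⟩
    refine Fin.cases ?_ (fun i => ?_) i
    · refine ⟨_, ⟨t⁻¹ • u, L.smul_mem _ hu, rfl⟩, ?_⟩
      have : t ≠ 0 := ht0
      simp [f, hu0', this]
    · refine ⟨_, ⟨l i, hl i, rfl⟩, ?_⟩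
      have := hlb i
      simp only [f, Fin.cons_succ, ← this]
      simp
  have h3 := Submodule.finrank_mono hspan
  rw [finrank_span_eq_card ht, Fintype.card_fin] at h3
  exact absurd (h3.trans hk) (by simp)

theorem rk_add (L : Submodule ℝ (E n)) :
    rk L + Module.finrank ℝ (LinearMap.ker (prT.domRestrict L)) = Module.finrank ℝ L := by
  rw [← LinearMap.finrank_range_add_finrank_ker (prT.domRestrict L), LinearMap.range_domRestrict, rk]

/-- A functional which is injective on `L ∩ ker pr1` bounds the corank. -/
theorem finrank_le_rk_add_one {L : Submodule ℝ (E n)} (φ : E n →ₗ[ℝ] ℝ)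
    (h : ∀ u ∈ L, pr1 u = 0 → φ u = 0 → u = 0) : Module.finrank ℝ L ≤ rk L + 1 := by
  rw [← rk_add]
  refine Nat.add_le_add_left ?_ _
  refine le_of_le_of_eq ?_ (Module.finrank_self ℝ)
  refine LinearMap.finrank_le_finrank_of_injective
    (f := φ ∘ₗ L.subtype ∘ₗ (LinearMap.ker (prT.domRestrict L)).subtype) ?_
  refine (injective_iff_map_eq_zero _).2 ?_
  rintro ⟨⟨u, hu⟩, hu0⟩ h0
  have : u = 0 := h u hu (by
    rw [← toGA_prT, show prT u = 0 from hu0, map_zero]) h0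
  subst this; rfl

/-- For a monomial `A` every product `A * con (gen i) A` repeats a generator. Monomials therefore
exponentiate to `1 + a3G A`. -/
theorem a3G_sq (x y z : Fin n) (u : E n) :
    a3G (gen x * gen y * gen z) (a3G (gen x * gen y * gen z) u) = 0 := by
  set A := gen x * gen y * gen z with hA
  have hA3 : Hom 3 A := ((hom_gen x).mul (hom_gen y)).mul (hom_gen z)
  have hx : A * gen x = 0 := by
    rw [hA, mul_assoc (gen x), mul_assoc (gen x),
      ((hom_gen y).mul (hom_gen z)).comm_even (hom_gen x) (by decide), ← mul_assoc, gen_mul_self,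
      zero_mul]
  have hy : A * gen y = 0 := by
    rw [hA, mul_assoc, gen_mul_gen z y, mul_neg, ← mul_assoc, mul_assoc (gen x), gen_mul_self]
    simp
  have hz : ∀ i, A * con (gen i) A = 0 := by
    intro i
    conv_lhs => rw [hA, mul_assoc (gen x) (gen y) (gen z)]
    rw [con_gen_mul_odd (by decide) i (hom_gen x), con_gen_gen, mul_sub,
      ← mul_assoc (gen x) (gen y) (gen z), ← hA, ← mul_assoc A (gen x), hx, zero_mul, sub_zero,
      ite_mul, one_mul, zero_mul, mul_ite, ← mul_assoc A, hy]
    simp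
  refine E.ext' ?_ ?_ ?_
  · rw [pr1_a3G, map_zero]
  · rw [pr2_a3G _ hA3, pr1_a3G, con_zero]; simp
  · rw [pr5_a3G _ hA3, pr2_a3G _ hA3, con_eq_sum (hom_pr1 u), Finset.mul_sum]
    simp [mul_smul_comm, hz]

theorem w3G_sq (hn : n ≤ 6) (x y z : Fin n) (u : E n) :
    w3G (gen x * gen y * gen z) (w3G (gen x * gen y * gen z) u) = 0 := by
  have d := derPair_three hn (((hom_gen x).mul (hom_gen y)).mul (hom_gen z))
  refine eq_of_dotE fun v => ?_
  rw [dotE_comm, d.dotE, d.dotE, a3G_sq, ← dotEB_apply, ← dotEB_apply, map_zero, map_zero]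

theorem a6G_sq {A : GA n} (hA : Hom 6 A) (u : E n) : a6G A (a6G A u) = 0 := by
  refine E.ext' ?_ ?_ ?_
  · rw [pr1_a6G, map_zero]
  · rw [pr2_a6G, map_zero]
  · rw [pr5_a6G _ hA, pr1_a6G, con_zero]; simp

theorem w6G_sq {A : GA n} (hA : Hom 6 A) (u : E n) : w6G A (w6G A u) = 0 := by
  refine E.ext' ?_ ?_ ?_
  · rw [pr1_w6G _ hA, pr5_w6G, con_zero]; simp
  · rw [pr2_w6G, map_zero]
  · rw [pr5_w6G, map_zero]

theorem isotropic_left {L : Submodule ℝ (E n)} (hL : ∀ u ∈ L, ∀ v ∈ L, toN u v = 0) {u v : E n}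
    (hu : u ∈ L) (hv : v ∈ L) (h0 : pr1 u = 0) :
    con (pr1 v) (pr2 u) = 0 ∧ con (pr1 v) (pr5 u) = pr2 u * pr2 v := by
  have h := hL u hu v hv
  have h1 := congrArg qr1 h
  have h4 := congrArg qr4 h
  rw [qr1_toN, h0, con_zero, map_zero] at h1
  rw [qr4_toN, h0, con_zero, map_zero] at h4
  refine ⟨by simpa using h1, ?_⟩
  rw [← sub_eq_zero]; simpa using h4

/-- If `L ∩ ker pr1` has an element with a non-zero component in `⋀² T*`, the rank can be
increased. -/
theorem pr2_eq_zero_of_max (hn3 : 3 ≤ n) (hn : n ≤ 6) {L : Submodule ℝ (E n)}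
    (hL : ∀ u ∈ L, ∀ v ∈ L, toN u v = 0) (hd : Module.finrank ℝ L = n)
    (hmax : ∀ k : E n ≃ₗ[ℝ] E n, IsAut k → rk (L.map (k : E n →ₗ[ℝ] E n)) ≤ rk L)
    {u : E n} (hu : u ∈ L) (hu0 : pr1 u = 0) : pr2 u = 0 := by
  by_contra hne
  have hs := hom_pr2 u
  have hS : ∀ X ∈ L.map pr1, Hom 1 X := by rintro _ ⟨l, _, rfl⟩; exact hom_pr1 l
  have hk : ∀ X ∈ L.map pr1, con X (pr2 u) = 0 := by
    rintro _ ⟨l, hl, rfl⟩; exact (isotropic_left hL hu hl hu0).1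
  obtain ⟨i, j, hij⟩ : ∃ i j, (con (gen j) (con (gen i) (pr2 u))) ∅ ≠ 0 := by
    by_contra! h
    refine hne (eq_zero_of_con_gen (k := 1) hs fun i => ?_)
    refine eq_zero_of_con_gen (k := 0) (hom_con_gen hs i) fun j => ?_
    rw [(hom_con_gen (k := 0) (hom_con_gen hs i) j).eq_smul_one, h i j, zero_smul]
  set c := (con (gen j) (con (gen i) (pr2 u))) ∅ with hc
  -- Maximality for the trivector `gen i * gen j * gen z` puts its contraction with the 2-form into
  -- the projection of `L`. In that contraction `gen z` has the nonzero coefficient `c`, so the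
  -- projection has codimension at most two.
  have hT : ∀ z, ∃ a b : ℝ, gen z - a • gen i - b • gen j ∈ L.map pr1 := by
    intro z
    have h3 : Hom 3 (gen i * gen j * gen z) := ((hom_gen i).mul (hom_gen j)).mul (hom_gen z)
    have h := mem_of_max_rk hn3 hn hmax (isDer_w3G hn h3) (w3G_sq hn i j z) hu hu0
    rw [pr1_w3G _ h3, con_two_gen_three hs, ← hc] at h
    refine ⟨-(c⁻¹ * (con (gen z) (con (gen j) (pr2 u))) ∅),
      c⁻¹ * (con (gen z) (con (gen i) (pr2 u))) ∅, ?_⟩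
    have h' := Submodule.smul_mem _ c⁻¹ h
    rw [smul_add, smul_sub, smul_smul, smul_smul, smul_smul, inv_mul_cancel₀ hij, one_smul] at h'
    convert h' using 1
    module
  -- `L ∩ ker pr1` is at most one-dimensional
  have h1 : n ≤ rk L + 1 := by
    refine hd.symm.le.trans ?_
    refine finrank_le_rk_add_one ⟨⟨fun u => (con (gen j) (con (gen i) (pr2 u))) ∅, fun _ _ => by
      simp⟩, fun _ _ => by simp⟩ fun v hv hv0 hφ => ?_
    have hv2 : pr2 v = 0 := eq_zero_of_codim hS hT (k := 0) (hom_pr2 v) (by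
      rintro _ ⟨l, hl, rfl⟩; exact (isotropic_left hL hv hl hv0).1) (by
      rw [(hom_con_gen (k := 0) (hom_con_gen (hom_pr2 v) i) j).eq_smul_one]
      change (con (gen j) (con (gen i) (pr2 v))) ∅ = 0 at hφ
      rw [hφ, zero_smul])
    have hk5 : ∀ X ∈ L.map pr1, con X (pr5 v) = 0 := by
      rintro _ ⟨l, hl, rfl⟩
      rw [(isotropic_left hL hv hl hv0).2, hv2, zero_mul]
    have hv5 : pr5 v = 0 := eq_zero_of_codim hS hT (k := 3) (hom_pr5 v) hk5
      (eq_zero_of_con_gen (k := 2) (hom_con_gen (hom_con_gen (hom_pr5 v) i) j)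
        (con_eq_zero_of_codim hS hT hk5))
    refine E.ext' ?_ ?_ ?_
    · rw [hv0, map_zero]
    · rw [hv2, map_zero]
    · rw [hv5, map_zero]
  -- the kernel of a non-zero two-form has codimension at least two
  let ψ : Ext n 1 →ₗ[ℝ] (Fin 2 → ℝ) := LinearMap.pi
    ![⟨⟨fun X => (con (gen i) (con (toGA 1 X) (pr2 u))) ∅, fun X Y => by simp [con_add]⟩,
        fun r X => by simp [con_smul]⟩,
      ⟨⟨fun X => (con (gen j) (con (toGA 1 X) (pr2 u))) ∅, fun X Y => by simp [con_add]⟩,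
        fun r X => by simp [con_smul]⟩]
  have hψ : Function.Surjective ψ := by
    intro y
    -- On the span of `gen i` and `gen j` the 2-form is antisymmetric with entry `c`, so this is the
    -- inverse of a two by two matrix.
    refine ⟨ofGA 1 ((y 1 * c⁻¹) • gen i - (y 0 * c⁻¹) • gen j), ?_⟩
    have e : toGA 1 (ofGA 1 ((y 1 * c⁻¹) • gen i - (y 0 * c⁻¹) • gen j))
        = (y 1 * c⁻¹) • gen i - (y 0 * c⁻¹) • gen j :=
      toGA_ofGA (((hom_gen i).smul _).sub ((hom_gen j).smul _))
    have e' : (con (gen i) (con (gen j) (pr2 u))) ∅ = -c := by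
      rw [con_swap (hom_gen i) (hom_gen j)]; rfl
    funext m
    fin_cases m
    · change (con (gen i) (con (toGA 1 (ofGA 1 ((y 1 * c⁻¹) • gen i - (y 0 * c⁻¹) • gen j)))
        (pr2 u))) ∅ = y 0
      rw [e, con_sub, con_smul, con_smul]
      simp only [LinearMap.sub_apply, LinearMap.smul_apply, map_sub, map_smul,
        con_con_self (hom_gen i), GA.sub_apply, GA.smul_apply, e', GA.zero_apply]
      field_simp; ring
    · change (con (gen j) (con (toGA 1 (ofGA 1 ((y 1 * c⁻¹) • gen i - (y 0 * c⁻¹) • gen j)))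
        (pr2 u))) ∅ = y 1
      rw [e, con_sub, con_smul, con_smul]
      simp only [LinearMap.sub_apply, LinearMap.smul_apply, map_sub, map_smul,
        con_con_self (hom_gen j), GA.sub_apply, GA.smul_apply, ← hc, GA.zero_apply]
      field_simp; ring
  have h2 : L.map prT ≤ LinearMap.ker ψ := by
    rintro _ ⟨l, hl, rfl⟩
    have := hk _ ⟨l, hl, rfl⟩
    rw [LinearMap.mem_ker]
    funext m
    fin_cases m
    · change (con (gen i) (con (toGA 1 (prT l)) (pr2 u))) ∅ = 0
      rw [toGA_prT, this]; simp
    · change (con (gen j) (con (toGA 1 (prT l)) (pr2 u))) ∅ = 0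
      rw [toGA_prT, this]; simp
  have h3 := Submodule.finrank_mono h2
  have h4 := LinearMap.finrank_range_add_finrank_ker ψ
  rw [LinearMap.range_eq_top.2 hψ, finrank_top, Module.finrank_fintype_fun_eq_card,
    Fintype.card_fin, finrank_ext_one] at h4
  change rk L ≤ _ at h3
  omega

theorem hom_six_eq_zero (hn : n ≤ 6) {f : GA n} (hf : Hom 6 f) (h : f Finset.univ = 0) : f = 0 := by
  ext A
  by_cases hA : A.card = 6
  · have : A = Finset.univ := by
      apply Finset.eq_univ_of_card
      have := Finset.card_le_univ A
      rw [Fintype.card_fin] at *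
      omega
    rw [this, h]; rfl
  · rw [hf A hA]; rfl

/-- A subspace of maximal rank projects onto `T`. -/
theorem rk_eq_of_max (hn3 : 3 ≤ n) (hn : n ≤ 6) {L : Submodule ℝ (E n)}
    (hL : ∀ u ∈ L, ∀ v ∈ L, toN u v = 0) (hd : Module.finrank ℝ L = n)
    (hmax : ∀ k : E n ≃ₗ[ℝ] E n, IsAut k → rk (L.map (k : E n →ₗ[ℝ] E n)) ≤ rk L) : rk L = n := by
  have h2 : ∀ u ∈ L, pr1 u = 0 → pr2 u = 0 := fun u hu h =>
    pr2_eq_zero_of_max hn3 hn hL hd hmax hu h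
  have h5 : ∀ u ∈ L, pr1 u = 0 → ∀ X ∈ L.map pr1, con X (pr5 u) = 0 := by
    rintro u hu h0 _ ⟨l, hl, rfl⟩
    rw [(isotropic_left hL hu hl h0).2, h2 u hu h0, zero_mul]
  have hS : ∀ X ∈ L.map pr1, Hom 1 X := by rintro _ ⟨l, _, rfl⟩; exact hom_pr1 l
  have hz : ∀ u ∈ L, pr1 u = 0 → pr5 u = 0 → u = 0 := by
    intro u hu h0 h
    refine E.ext' ?_ ?_ ?_
    · rw [h0, map_zero]
    · rw [h2 u hu h0, map_zero]
    · rw [h, map_zero]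
  -- it suffices to show that the rank is at least `n - 1`
  suffices hs : n ≤ rk L + 1 by
    have key : ∀ u ∈ L, pr1 u = 0 → u = 0 := by
      intro u hu h0
      refine hz u hu h0 ?_
      -- The projection of `L` has codimension at most one, so one generator complements it. Using
      -- it in place of both generators in `eq_zero_of_codim` kills `pr5 u`.
      obtain ⟨i, hi⟩ : ∃ i, ∀ z, ∃ a b : ℝ, gen z - a • gen i - b • gen i ∈ L.map pr1 := by
        by_cases hall : ∀ z, gen z ∈ L.map pr1
        · exact ⟨⟨0, by omega⟩, fun z => ⟨0, 0, by simpa using hall z⟩⟩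
        push Not at hall
        obtain ⟨i, hi⟩ := hall
        refine ⟨i, fun z => ?_⟩
        set g : Ext n 1 := ofGA 1 (gen i) with hg
        have hgg : toGA 1 g = gen i := toGA_ofGA (hom_gen i)
        have hgn : g ∉ L.map prT := by
          rintro ⟨l, hl, h⟩
          exact hi ⟨l, hl, by rw [← toGA_prT, h, hgg]⟩
        have htop : L.map prT ⊔ Submodule.span ℝ {g} = ⊤ := by
          refine Submodule.eq_top_of_finrank_eq ?_
          have h1 : L.map prT < L.map prT ⊔ Submodule.span ℝ {g} := by
            refine lt_of_le_of_ne le_sup_left fun h => hgn ?_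
            rw [h]; exact Submodule.mem_sup_right (Submodule.mem_span_singleton_self g)
          have h3 := Submodule.finrank_lt_finrank_of_lt h1
          have h4 := Submodule.finrank_le (L.map prT ⊔ Submodule.span ℝ {g})
          rw [finrank_ext_one] at h4 ⊢
          change rk L < _ at h3
          omega
        have hzm : ofGA 1 (gen z) ∈ L.map prT ⊔ Submodule.span ℝ {g} := by rw [htop]; trivial
        obtain ⟨y, ⟨l, hl, rfl⟩, w, hw, hyw⟩ := Submodule.mem_sup.1 hzm
        obtain ⟨a, rfl⟩ := Submodule.mem_span_singleton.1 hw
        refine ⟨a, 0, l, hl, ?_⟩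
        have := congrArg (toGA 1) hyw
        rw [map_add, map_smul, hgg, toGA_prT, toGA_ofGA (hom_gen z)] at this
        rw [← this]; module
      refine eq_zero_of_codim hS hi (k := 3) (hom_pr5 u) (h5 u hu h0) ?_
      rw [con_con_self (hom_gen i)]
    have hker : LinearMap.ker (prT.domRestrict L) = ⊥ := by
      rw [LinearMap.ker_eq_bot']
      rintro ⟨u, hu⟩ h
      have := key u hu (by rw [← toGA_prT]; exact (congrArg (toGA 1) h).trans (map_zero _))
      subst this; rfl
    have := rk_add L
    rw [hker, finrank_bot, hd] at this
    exact this
  by_cases h0 : ∀ l ∈ L, pr1 l = 0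
  · -- the rank is zero
    -- Maximality for the 6-vector `gen i * pr5 u` makes its contraction with `pr5 u` vanish.
    -- Pairing this with `gen i` gives, up to sign, the squared norm of `gen i * pr5 u`.
    have hw : ∀ u ∈ L, ∀ i, gen i * pr5 u = 0 := by
      intro u hu i
      have h6 : Hom 6 (gen i * pr5 u) := (hom_gen i).mul (hom_pr5 u)
      obtain ⟨l, hl, h⟩ := mem_of_max_rk hn3 hn hmax (isDer_w6G hn h6) (w6G_sq h6) hu (h0 u hu)
      rw [h0 l hl, pr1_w6G _ h6, eq_comm, neg_eq_zero] at h
      have : dotG (gen i) (con (pr5 u) (gen i * pr5 u)) = 0 := by rw [h, dotG_zero_right]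
      rw [← dotG_mul_left, (hom_pr5 u).comm_odd (hom_gen i) (by decide), dotG_neg_left,
        neg_eq_zero] at this
      ext A
      have := (Finset.sum_eq_zero_iff_of_nonneg fun A _ => mul_self_nonneg ((gen i * pr5 u) A)).1
        this A (Finset.mem_univ _)
      simpa using this
    -- For `n = 5` the products with generators vanish anyway, but `⋀⁵` is a line. Otherwise the
    -- factor `n - 5` is invertible and `L` would be zero.
    by_cases hn5 : n = 5
    · refine hd.symm.le.trans ?_
      refine finrank_le_rk_add_one ⟨⟨fun u => (pr5 u) Finset.univ, fun _ _ => by simp⟩,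
        fun _ _ => by simp⟩ fun u hu hu0 hφ => hz u hu hu0 (GA.ext fun A => ?_)
      by_cases hA : A.card = 5
      · have : A = Finset.univ := Finset.eq_univ_of_card _ (by rw [hA, Fintype.card_fin, hn5])
        rw [this]; exact hφ
      · exact hom_pr5 u A hA
    · exfalso
      have hL0 : L = ⊥ := by
        rw [eq_bot_iff]
        intro u hu
        refine hz u hu (h0 u hu) ?_
        have h := sum_con_gen_mul (hom_pr5 u)
        simp only [hw u hu, map_zero, Finset.sum_const_zero] at h
        refine (smul_eq_zero.1 h.symm).resolve_left ?_
        exact sub_ne_zero.2 (by exact_mod_cast hn5)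
      rw [hL0, finrank_bot] at hd
      omega
  · push Not at h0
    obtain ⟨l, hl, hl0⟩ := h0
    obtain ⟨i, hi⟩ : ∃ i, (pr1 l) {i} ≠ 0 := by
      by_contra! h
      exact hl0 ((hom_pr1 l).ext_one Hom.zero fun i => by rw [h i]; rfl)
    -- If `gen i * pr5 u` vanishes, contracting it by `pr1 l`, which annihilates `pr5 u`, leaves the
    -- nonzero multiple `(pr1 l) {i}` of `pr5 u`.
    refine hd.symm.le.trans ?_
    refine finrank_le_rk_add_one ⟨⟨fun u => (gen i * pr5 u) Finset.univ, fun _ _ => by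
      simp [mul_add]⟩, fun _ _ => by simp [mul_smul_comm]⟩ fun u hu hu0 hφ => ?_
    refine hz u hu hu0 ?_
    have h6 := hom_six_eq_zero hn ((hom_gen i).mul (hom_pr5 u)) hφ
    have h := congrArg (con (pr1 l)) h6
    rw [con_one_mul (hom_pr1 l) (hom_gen i), h5 u hu hu0 _ ⟨l, hl, rfl⟩,
      con_one_one (hom_pr1 l) (hom_gen i), dotG_comm, dotG_gen] at h
    simp at h
    exact h.resolve_left hi

/-- The shear along a 3-form is realised by an automorphism. -/
theorem exists_shear (hn3 : 3 ≤ n) (hn : n ≤ 6) {a : GA n} (ha : Hom 3 a) (r : ℝ) :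
    ∃ e : E n ≃ₗ[ℝ] E n, IsAut e ∧
      ∀ u, pr1 (e u) = pr1 u ∧ pr2 (e u) = pr2 u + con (pr1 u) (r • a) := by
  revert r
  refine Hom.induction_three (p := fun a => ∀ r : ℝ, ∃ e : E n ≃ₗ[ℝ] E n, IsAut e ∧
      ∀ u, pr1 (e u) = pr1 u ∧ pr2 (e u) = pr2 u + con (pr1 u) (r • a)) ?_ ?_ ?_ ?_ ha
  · exact fun r => ⟨_, IsAut.refl, fun u => by simp⟩
  · intro x y hx hy r
    obtain ⟨e, he, h⟩ := hx r
    obtain ⟨k, hk, h'⟩ := hy r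
    refine ⟨e.trans k, he.trans hk, fun u => ⟨?_, ?_⟩⟩
    · rw [LinearEquiv.trans_apply, (h' _).1, (h u).1]
    · rw [LinearEquiv.trans_apply, (h' _).2, (h u).1, (h u).2, smul_add, map_add, add_assoc]
  · intro c x hx r
    rw [smul_smul]; exact hx _
  · intro x y z r
    have h3 : Hom 3 (gen x * gen y * gen z) := ((hom_gen x).mul (hom_gen y)).mul (hom_gen z)
    have hsq : ∀ u, (r • a3G (gen x * gen y * gen z)) ((r • a3G (gen x * gen y * gen z)) u) = 0 := by
      intro u
      rw [LinearMap.smul_apply, LinearMap.smul_apply, map_smul, a3G_sq, smul_zero, smul_zero]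
    refine ⟨_, isAut_oneAdd hn3 hn ((isDer_a3G hn h3).smul r) hsq, fun u => ⟨?_, ?_⟩⟩
    · simp [pr1_a3G]
    · simp [pr2_a3G _ h3]

/-- A maximal isotropic subspace which projects onto `T` is the image of `T*`. -/
theorem exists_map_eq_std (hn3 : 3 ≤ n) (hn : n ≤ 6) {L : Submodule ℝ (E n)}
    (hL : ∀ u ∈ L, ∀ v ∈ L, toN u v = 0) (hd : Module.finrank ℝ L = n) :
    ∃ e : E n ≃ₗ[ℝ] E n, IsAut e ∧ L.map (e : E n →ₗ[ℝ] E n) = stdL n := by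
  have iso : ∀ (L : Submodule ℝ (E n)), (∀ u ∈ L, ∀ v ∈ L, toN u v = 0) →
      ∀ {k : E n ≃ₗ[ℝ] E n}, IsAut k → ∀ u ∈ L.map (k : E n →ₗ[ℝ] E n),
        ∀ v ∈ L.map (k : E n →ₗ[ℝ] E n), toN u v = 0 := by
    rintro L hL k hk _ ⟨u, hu, rfl⟩ _ ⟨v, hv, rfl⟩
    exact hk.toN_eq_zero (hL u hu v hv)
  obtain ⟨e, he, hmax⟩ := exists_max_rk L
  set L1 := L.map (e : E n →ₗ[ℝ] E n) with hL1
  have iso1 := iso L hL he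
  have hd1 : Module.finrank ℝ L1 = n := by rw [hL1, LinearEquiv.finrank_map_eq, hd]
  have hr := rk_eq_of_max hn3 hn iso1 hd1 hmax
  have hsur : ∀ i, ∃ l ∈ L1, pr1 l = gen i := by
    intro i
    have htop : L1.map prT = ⊤ := by
      refine Submodule.eq_top_of_finrank_eq ?_
      rw [finrank_ext_one]; exact hr
    have : ofGA 1 (gen i) ∈ L1.map prT := by rw [htop]; trivial
    obtain ⟨l, hl, h⟩ := this
    exact ⟨l, hl, by rw [← toGA_prT, h, toGA_ofGA (hom_gen i)]⟩
  have hsur' : ∀ X : GA n, ∃ l : E n, (∃ i, X = gen i) → l ∈ L1 ∧ pr1 l = X := by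
    intro X
    by_cases h : ∃ i, X = gen i
    · obtain ⟨i, rfl⟩ := h
      obtain ⟨l, hl, h⟩ := hsur i
      exact ⟨l, fun _ => ⟨hl, h⟩⟩
    · exact ⟨0, fun h' => absurd h' h⟩
  choose l hl using hsur'
  have hlm : ∀ i, l (gen i) ∈ L1 := fun i => (hl _ ⟨i, rfl⟩).1
  have hlp : ∀ i, pr1 (l (gen i)) = gen i := fun i => (hl _ ⟨i, rfl⟩).2
  -- remove the component in `⋀² T*`
  obtain ⟨a, ha, ha'⟩ := exists_con_of_antisymm (k := 1) (fun X => pr2 (l X)) (fun i => hom_pr2 _)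
    (fun i j => by
      have := congrArg qr1 (iso1 _ (hlm i) _ (hlm j))
      rwa [qr1_toN, hlp, hlp, map_zero] at this)
  have h2 : ∀ u ∈ L1, pr2 u = con (pr1 u) a := by
    intro u hu
    refine (hom_pr2 u).eq_of_con (k := 1) ((hom_pr1 u).contraction (l := 2) ha) fun i => ?_
    have := congrArg qr1 (iso1 _ (hlm i) _ hu)
    rw [qr1_toN, hlp, ha', map_zero, con_swap (hom_pr1 u) (hom_gen i), ← sub_eq_add_neg,
      sub_eq_zero] at this
    exact this
  obtain ⟨k, hk, hk'⟩ := exists_shear hn3 hn ha (-1)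
  set L2 := L1.map (k : E n →ₗ[ℝ] E n) with hL2
  have iso2 := iso L1 iso1 hk
  have hd2 : Module.finrank ℝ L2 = n := by rw [hL2, LinearEquiv.finrank_map_eq, hd1]
  have h20 : ∀ u ∈ L2, pr2 u = 0 := by
    rintro _ ⟨u, hu, rfl⟩
    rw [LinearEquiv.coe_coe, (hk' u).2, h2 u hu]; simp
  -- remove the component in `⋀⁵ T*`
  obtain ⟨b, hb, hb'⟩ := exists_con_of_antisymm (k := 4) (fun X => pr5 (k (l X)))
    (fun i => hom_pr5 _) (fun i j => by
      have := congrArg qr4 (iso2 _ ⟨_, hlm i, rfl⟩ _ ⟨_, hlm j, rfl⟩)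
      rw [qr4_toN, h20 _ ⟨_, hlm i, rfl⟩, zero_mul, sub_zero, LinearEquiv.coe_coe, (hk' _).1,
        (hk' _).1, hlp, hlp, map_zero] at this
      exact this)
  have h5 : ∀ u ∈ L2, pr5 u = con (pr1 u) b := by
    intro u hu
    refine (hom_pr5 u).eq_of_con (k := 4) ((hom_pr1 u).contraction (l := 5) hb) fun i => ?_
    have := congrArg qr4 (iso2 _ ⟨_, hlm i, rfl⟩ _ hu)
    rw [qr4_toN, h20 _ hu, mul_zero, sub_zero, LinearEquiv.coe_coe, (hk' _).1, hlp, hb', map_zero,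
      con_swap (hom_pr1 u) (hom_gen i), ← sub_eq_add_neg, sub_eq_zero] at this
    exact this
  have hm := isAut_oneAdd hn3 hn (isDer_a6G hn hb.neg) (a6G_sq hb.neg)
  refine ⟨(e.trans k).trans _, (he.trans hk).trans hm, ?_⟩
  have hle : L2.map (oneAdd _ (a6G_sq hb.neg) : E n →ₗ[ℝ] E n) ≤ stdL n := by
    rintro _ ⟨u, hu, rfl⟩
    refine mem_stdL.2 ⟨?_, ?_⟩
    · simp [h20 u hu, pr2_a6G]
    · simp [h5 u hu, pr5_a6G _ hb.neg]
  have hfin : Module.finrank ℝ (stdL n) ≤ n := by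
    have hinj : Function.Injective (prT ∘ₗ (stdL n).subtype) := by
      refine (injective_iff_map_eq_zero _).2 ?_
      rintro ⟨u, hu⟩ h
      refine Subtype.ext ?_
      change u = 0
      rw [eq_in1_of_mem hu, ← toGA_prT, show prT u = 0 from h]; simp
    exact (LinearMap.finrank_le_finrank_of_injective hinj).trans finrank_ext_one.le
  have := Submodule.eq_of_le_of_finrank_le hle (by
    rw [LinearEquiv.finrank_map_eq, hd2]; exact hfin)
  rw [← this, hL2, hL1, ← Submodule.map_comp, ← Submodule.map_comp]
  rfl

/-- Isotropic subspaces of dimension `n` are good. -/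
theorem good_of_isotropic (hn3 : 3 ≤ n) (hn : n ≤ 6) {L : Submodule ℝ (E n)}
    (hL : ∀ u ∈ L, ∀ v ∈ L, toN u v = 0) (hd : Module.finrank ℝ L = n) : Good L := by
  obtain ⟨e, he, h⟩ := exists_map_eq_std hn3 hn hL hd
  exact he.good_of_map (h ▸ good_stdL hn3 hn)

/-! ### Elgebras near a co-Lagrangian subspace -/

/-- The annihilator of a subspace of `E`, in coordinates. -/
def ann (V : Submodule ℝ (E n)) : Submodule ℝ (E n) where
  carrier := {x | ∀ v ∈ V, dotE x v = 0}
  add_mem' ha hb v hv := by rw [dotE_add_left, ha v hv, hb v hv, add_zero]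
  zero_mem' v _ := by rw [← dotEB_apply, map_zero, LinearMap.zero_apply]
  smul_mem' c x hx v hv := by rw [dotE_smul_left, hx v hv, mul_zero]

/-- The identification of `E*` with `E` by coordinates. -/
def dualEquiv : E n ≃ₗ[ℝ] Module.Dual ℝ (E n) :=
  LinearEquiv.ofBijective dotEB ⟨fun x y h => by
    rw [← covec_dotEB x, ← covec_dotEB y, h], fun ξ => ⟨covec ξ, dotEB_covec ξ⟩⟩

theorem finrank_ann (V : Submodule ℝ (E n)) :
    Module.finrank ℝ (ann V) = Module.finrank ℝ (E n ⧸ V) := by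
  have h : (ann V).map (dualEquiv (n := n)).toLinearMap = V.dualAnnihilator := by
    ext ξ
    constructor
    · rintro ⟨x, hx, rfl⟩
      rw [Submodule.mem_dualAnnihilator]; exact hx
    · intro hξ
      rw [Submodule.mem_dualAnnihilator] at hξ
      exact ⟨covec ξ, fun v hv => by rw [dotE_covec, hξ v hv], dotEB_covec ξ⟩
  have h2 := LinearEquiv.finrank_map_eq (dualEquiv (n := n)) (ann V)
  refine h2.symm.trans ?_
  refine Eq.trans (congrArg (fun S : Submodule ℝ (Module.Dual ℝ (E n)) => Module.finrank ℝ S) h) ?_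
  rw [← LinearEquiv.finrank_eq V.dualQuotEquivDualAnnihilator, Subspace.dual_finrank_eq]

/-- The transpose of an endomorphism in coordinates. -/
def tr (A : E n →ₗ[ℝ] E n) (x : E n) : E n := covec (dotEB x ∘ₗ A)

theorem dotE_tr (A : E n →ₗ[ℝ] E n) (x u : E n) : dotE (tr A x) u = dotE x (A u) := by
  rw [tr, dotE_covec]; rfl

theorem sum_dotE_smul (u : E n) : ∑ i, dotE (basisE n i) u • basisE n i = u := by
  simp only [dotE_basisE_left]; exact sum_coord_smul u

/-- A linear map which factors through `p`, as a sum of decomposable ones. -/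
theorem eq_sum_of_factor {W : Type*} [AddCommGroup W] [Module ℝ W] {p : E n →ₗ[ℝ] E n}
    (K : E n →ₗ[ℝ] W) (hK : ∀ e, K e = K (p e)) (e : E n) :
    K e = ∑ i, dotE (tr p (basisE n i)) e • K (basisE n i) := by
  simp only [dotE_tr]
  rw [hK]
  conv_lhs => rw [← sum_dotE_smul (p e)]
  simp

/-- When `p` kills `V`, the covectors `tr p (basisE n i)` lie in `V°`. This brings `π K` within
reach of the conditions of `Good`. -/
theorem piL_eq_sum {p : E n →ₗ[ℝ] E n} (K : E n →ₗ[ℝ] E n) (hK : ∀ e, K e = K (p e)) :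
    piL K = ∑ i, piC (tr p (basisE n i)) (K (basisE n i)) := by
  have : K = ∑ i, (dotEB (tr p (basisE n i))).smulRight (K (basisE n i)) := by
    refine LinearMap.ext fun e => ?_
    rw [eq_sum_of_factor K hK e, LinearMap.sum_apply]; rfl
  conv_lhs => rw [this]
  simp only [map_sum, piL_smulRight]

theorem exists_proj (V : Submodule ℝ (E n)) :
    ∃ p : E n →ₗ[ℝ] E n, (∀ v ∈ V, p v = 0) ∧ ∀ e, e - p e ∈ V := by
  obtain ⟨W, hW⟩ := V.exists_isCompl
  refine ⟨W.subtype ∘ₗ Submodule.projectionOnto W V hW.symm, fun v hv => ?_, fun e => ?_⟩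
  · rw [LinearMap.comp_apply, (Submodule.projectionOnto_apply_eq_zero_iff hW.symm).2 hv, map_zero]
  · rw [← Submodule.projectionOnto_apply_eq_zero_iff hW.symm, map_sub, LinearMap.comp_apply,
      Submodule.subtype_apply, Submodule.projectionOnto_apply_left, sub_self]

/-- If `K` is symmetric and factors through `p`, then `∑ i, α i ⊗ K e_i` is symmetric. -/
theorem sum_swap {p K : E n →ₗ[ℝ] E n} (Kp : ∀ e, K e = K (p e))
    (Ksymm : ∀ e e', dotE (K e) e' = dotE (K e') e) {W : Type*} [AddCommGroup W] [Module ℝ W]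
    (Φ : E n →ₗ[ℝ] E n →ₗ[ℝ] W) :
    ∑ i, Φ (tr p (basisE n i)) (K (basisE n i)) = ∑ i, Φ (K (basisE n i)) (tr p (basisE n i)) := by
  have e0 : ∀ (Ψ : E n →ₗ[ℝ] W) (x : E n), Ψ x = ∑ j, dotE (basisE n j) x • Ψ (basisE n j) := by
    intro Ψ x
    conv_lhs => rw [← sum_dotE_smul x]
    simp only [map_sum, map_smul]
  have e1 : ∀ x y, Φ x y = ∑ j, dotE (basisE n j) x • Φ (basisE n j) y := fun x y => e0 (Φ.flip y) x
  have e3 : ∀ j, ∑ i, dotE (basisE n j) (tr p (basisE n i)) • K (basisE n i) = K (basisE n j) := by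
    intro j
    rw [eq_sum_of_factor K Kp (basisE n j)]
    exact Finset.sum_congr rfl fun i _ => by rw [dotE_comm]
  have e4 : ∑ j, Φ (basisE n j) (K (basisE n j)) = ∑ j, Φ (K (basisE n j)) (basisE n j) := by
    rw [Finset.sum_congr rfl fun j _ => e0 (Φ (basisE n j)) (K (basisE n j)),
      Finset.sum_congr rfl fun j _ => e1 (K (basisE n j)) (basisE n j), Finset.sum_comm]
    refine Finset.sum_congr rfl fun k _ => Finset.sum_congr rfl fun j _ => ?_
    rw [dotE_comm (basisE n k), Ksymm, dotE_comm]
  have e5 : ∑ i, Φ (tr p (basisE n i)) (K (basisE n i)) = ∑ j, Φ (basisE n j) (K (basisE n j)) := by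
    rw [Finset.sum_congr rfl fun i _ => e1 (tr p (basisE n i)) (K (basisE n i)),
      Finset.sum_comm]
    refine Finset.sum_congr rfl fun j _ => ?_
    conv_rhs => rw [← e3 j, map_sum]
    simp only [map_smul]
  have e6 : ∑ i, Φ (K (basisE n i)) (tr p (basisE n i)) = ∑ j, Φ (K (basisE n j)) (basisE n j) := by
    rw [Finset.sum_congr rfl fun i _ => e0 (Φ (K (basisE n i))) (tr p (basisE n i)),
      Finset.sum_comm]
    refine Finset.sum_congr rfl fun j _ => ?_
    conv_rhs => rw [← e3 j, map_sum, LinearMap.sum_apply]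
    simp only [map_smul, LinearMap.smul_apply]
  rw [e5, e6, e4]

/-- A symmetric `K` vanishing on `V` is a symmetric tensor in `V° ⊗ V°`. Exchanging its factors
leaves the sum unchanged, while `Good.symm` says that it changes sign. -/
theorem piL_eq_zero_of_symm {V : Submodule ℝ (E n)} (hL : Good (ann V)) {p K : E n →ₗ[ℝ] E n}
    (hp0 : ∀ v ∈ V, p v = 0) (hp : ∀ e, e - p e ∈ V)
    (Ksymm : ∀ e e', dotE (K e) e' = dotE (K e') e) (K0 : ∀ v ∈ V, K v = 0) (ν : N n) :
    piL (tE.flip ν ∘ₗ K) = 0 := by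
  have hα : ∀ i, tr p (basisE n i) ∈ ann V := fun i v hv => by
    rw [dotE_tr, hp0 v hv, ← dotEB_apply, map_zero]
  have Kp : ∀ e, K e = K (p e) := fun e => by
    rw [← sub_eq_zero, ← map_sub]; exact K0 _ (hp e)
  have KL : ∀ e, K e ∈ ann V := fun e v hv => by
    rw [Ksymm, K0 v hv, ← dotEB_apply, map_zero, LinearMap.zero_apply]
  have h1 : piL (tE.flip ν ∘ₗ K) = ∑ i, piC (tr p (basisE n i)) (tE (K (basisE n i)) ν) :=
    piL_eq_sum (p := p) _ fun e => by simp only [LinearMap.comp_apply]; rw [Kp]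
  have h2 : ∑ i, piC (tr p (basisE n i)) (tE (K (basisE n i)) ν)
      = ∑ i, piC (K (basisE n i)) (tE (tr p (basisE n i)) ν) :=
    sum_swap Kp Ksymm (LinearMap.compl₂ piC (tE.flip ν))
  have h3 : ∑ i, piC (tr p (basisE n i)) (tE (K (basisE n i)) ν)
      + ∑ i, piC (K (basisE n i)) (tE (tr p (basisE n i)) ν) = 0 := by
    rw [← Finset.sum_add_distrib]
    exact Finset.sum_eq_zero fun i _ => hL.symm _ (hα i) _ (KL _) ν
  rw [← h2, ← two_smul ℝ, smul_eq_zero] at h3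
  rw [h1]; exact h3.resolve_left two_ne_zero

/-- The bracket `(u, v) ↦ Ω_u v - π(Ω_• u) v` attached to a `𝔤`-connection `Ω` on `E`. -/
theorem exists_of_connection {V : Submodule ℝ (E n)} (hL : Good (ann V))
    (iso : ∀ x ∈ ann V, ∀ y ∈ ann V, toN x y = 0) {p : E n →ₗ[ℝ] E n} (hp0 : ∀ v ∈ V, p v = 0)
    {Ω : E n →ₗ[ℝ] E n →ₗ[ℝ] E n} (hΩp : ∀ e, Ω e = Ω (p e)) (hΩD : ∀ e, IsDer (Ω e)) :
    ∃ (X : E n →ₗ[ℝ] E n →ₗ[ℝ] E n) (D : N n →ₗ[ℝ] E n),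
      (∀ u, X u = Ω u - piL (Ω.flip u)) ∧ (∀ u v, X u v + X v u = D (toN u v)) ∧
      (∀ x ∈ ann V, ∀ u v, dotE x (X u v) = dotE x (Ω u v) - dotE x (Ω v u)) ∧
      ∀ ξ ∈ ann V, ∃ H : E n →ₗ[ℝ] E n, (∀ v ∈ V, H v = 0) ∧
        (∀ e e', dotE (H e) e' = dotE ξ (Ω e e')) ∧
        ∀ ν, X (tE ξ ν) = piC ξ (D ν) + piL (tE.flip ν ∘ₗ H) := by
  obtain ⟨α, hα'⟩ : ∃ α : _ → E n, ∀ i, α i = tr p (basisE n i) := ⟨_, fun _ => rfl⟩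
  have hα : ∀ i, α i ∈ ann V := fun i v hv => by
    rw [hα', dotE_tr, hp0 v hv, ← dotEB_apply, map_zero]
  choose B P Q hBP using fun i => hΩD (basisE n i)
  have hπ : ∀ u, piL (Ω.flip u) = ∑ i, piC (α i) (Ω (basisE n i) u) := fun u => by
    rw [piL_eq_sum (p := p) (Ω.flip u) (fun e => by simp only [LinearMap.flip_apply]; rw [hΩp])]
    simp only [hα', LinearMap.flip_apply]
  obtain ⟨X, hX⟩ : ∃ X : E n →ₗ[ℝ] E n →ₗ[ℝ] E n, ∀ u, X u = Ω u - piL (Ω.flip u) :=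
    ⟨Ω - piL ∘ₗ Ω.flip, fun u => rfl⟩
  have hX2 : ∀ u v, X u v = Ω u v - Ω v u + ∑ i, tE (α i) (toN (Ω (basisE n i) u) v) := by
    intro u v
    rw [hX, LinearMap.sub_apply, hπ, LinearMap.sum_apply]
    simp only [piC_apply, Finset.sum_sub_distrib]
    have := eq_sum_of_factor (p := p) (Ω.flip u)
      (fun e => by simp only [LinearMap.flip_apply]; rw [hΩp]) v
    simp only [LinearMap.flip_apply, ← hα'] at this
    rw [← this]; abel
  -- The derivation rule rewrites the symmetric part through the actions `P i` on `N`, which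
  -- dictates this formula.
  obtain ⟨D, hD⟩ : ∃ D : N n →ₗ[ℝ] E n, ∀ ν, D ν = ∑ i, tE (α i) (P i ν) :=
    ⟨∑ i, tE (α i) ∘ₗ P i, fun ν => by simp only [LinearMap.sum_apply, LinearMap.comp_apply]⟩
  refine ⟨X, D, hX, fun u v => ?_, fun x hx u v => ?_, fun ξ hξ => ?_⟩
  · rw [hX2, hX2, hD]
    simp only [← (hBP _).toN, map_add, Finset.sum_add_distrib]
    simp only [toN_comm u]
    abel
  · rw [hX2, dotE_add_right, ← dotEB_apply, ← dotEB_apply, map_sub, map_sum]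
    rw [Finset.sum_eq_zero, add_zero]
    · simp only [dotEB_apply]
    intro i _
    rw [dotEB_apply, dotE_tE, iso _ (hα i) _ hx, ← pairNB_apply, map_zero, LinearMap.zero_apply]
  -- The covector `H e` is the transpose of `Ω e` applied to `ξ`.
  obtain ⟨H, hH⟩ : ∃ H : E n →ₗ[ℝ] E n, H = ∑ i, (dotEB (α i)).smulRight (B i ξ) := ⟨_, rfl⟩
  have hH1 : ∀ e, H e = ∑ i, dotE (α i) e • B i ξ := fun e => by
    simp only [hH, LinearMap.sum_apply, LinearMap.smulRight_apply, dotEB_apply]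
  refine ⟨H, fun v hv => ?_, fun e e' => ?_, fun ν => ?_⟩
  · rw [hH1]
    exact Finset.sum_eq_zero fun i _ => by rw [hα i v hv, zero_smul]
  · rw [hH1, eq_sum_of_factor Ω hΩp e, LinearMap.sum_apply, ← dotEB_apply, map_sum,
      LinearMap.sum_apply, ← dotEB_apply, map_sum]
    refine Finset.sum_congr rfl fun i _ => ?_
    simp only [map_smul, LinearMap.smul_apply, dotEB_apply, (hBP i).dotE, hα']
  -- Isotropy places `tE ξ ν` in `V`, where `Ω` vanishes.
  · have h1 : Ω (tE ξ ν) = 0 := by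
      rw [eq_sum_of_factor Ω hΩp]
      refine Finset.sum_eq_zero fun i _ => ?_
      rw [← hα', dotE_tE, iso _ hξ _ (hα i), ← pairNB_apply, map_zero, LinearMap.zero_apply,
        zero_smul]
    have h2 : piL (tE.flip ν ∘ₗ H) = ∑ i, piC (α i) (tE (B i ξ) ν) := by
      have : tE.flip ν ∘ₗ H = ∑ i, (dotEB (α i)).smulRight (tE (B i ξ) ν) := by
        refine LinearMap.ext fun e => ?_
        simp only [LinearMap.comp_apply, hH1, map_sum, LinearMap.sum_apply, map_smul,
          LinearMap.smulRight_apply, dotEB_apply, LinearMap.flip_apply]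
      simp only [this, map_sum, piL_smulRight]
    have h3 : piC ξ (D ν) = -∑ i, piC (α i) (tE ξ (P i ν)) := by
      rw [hD, map_sum, ← Finset.sum_neg_distrib]
      exact Finset.sum_congr rfl fun i _ =>
        eq_neg_of_add_eq_zero_left (hL.symm _ hξ _ (hα i) (P i ν))
    rw [hX, h1, hπ, h2, h3]
    simp only [(hBP _).tE, map_sub, Finset.sum_sub_distrib]
    abel

/-- This is the pointwise content of `[𝒟(f ν), ·] = 0`, with `ξ` the differential and `H` the second
derivative of `f`. The bracket is compared with a model built from a connection, for which
`exists_of_connection` gives the identity. -/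
theorem gauge_of_good {V : Submodule ℝ (E n)} (hn3 : 3 ≤ n) (hn : n ≤ 6) (hL : Good (ann V))
    (iso : ∀ x ∈ ann V, ∀ y ∈ ann V, toN x y = 0) {X : E n →ₗ[ℝ] E n →ₗ[ℝ] E n}
    {D : N n →ₗ[ℝ] E n} (hX : ∀ u, IsDer (X u)) (hs : ∀ u v, X u v + X v u = D (toN u v))
    (hV : ∀ u ∈ V, ∀ v ∈ V, X u v ∈ V) (hD : ∀ ν, D ν ∈ V) {ξ : E n} (hξ : ξ ∈ ann V)
    {H : E n →ₗ[ℝ] E n} (hH0 : ∀ v ∈ V, H v = 0)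
    (hH : ∀ e e', dotE (H e) e' - dotE (H e') e = dotE ξ (X e e')) (ν : N n) :
    X (tE ξ ν) = piC ξ (D ν) + piL (tE.flip ν ∘ₗ H) := by
  obtain ⟨p, hp0, hp⟩ := exists_proj V
  have hpV : ∀ x ∈ ann V, ∀ e, dotE x (p e) = dotE x e := by
    intro x hx e
    have := hx _ (hp e)
    rw [← dotEB_apply, map_sub, sub_eq_zero] at this
    exact this.symm
  have hpp : ∀ e, p (p e) = p e := by
    intro e
    have := hp0 _ (hp e)
    rw [map_sub, sub_eq_zero] at this
    exact this.symm
  -- The correction with factor `1/2` compensates double counting. Modulo `V`, antisymmetrising `X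
  -- (p u) v` counts `X (p u) (p v)` twice, and half of it must be removed from each order for the
  -- model to agree with `X`.
  obtain ⟨Ω, hΩ⟩ : ∃ Ω : E n →ₗ[ℝ] E n →ₗ[ℝ] E n,
      ∀ e, Ω e = X (p e) - (2⁻¹ : ℝ) • piL (p ∘ₗ X (p e) ∘ₗ p) :=
    ⟨X ∘ₗ p - (2⁻¹ : ℝ) • (piL ∘ₗ LinearMap.llcomp ℝ _ _ _ p ∘ₗ LinearMap.lcomp ℝ _ p ∘ₗ X ∘ₗ p),
      fun e => rfl⟩
  have hxΩ : ∀ x ∈ ann V, ∀ u v,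
      dotE x (Ω u v) = dotE x (X (p u) v) - 2⁻¹ * dotE x (X (p u) (p v)) := by
    intro x hx u v
    obtain ⟨K, hK⟩ : ∃ K : E n →ₗ[ℝ] E n, K = p ∘ₗ X (p u) ∘ₗ p := ⟨_, rfl⟩
    have hKe : ∀ e, K e = p (X (p u) (p e)) := fun e => by rw [hK]; rfl
    have hKp : ∀ e, K e = K (p e) := fun e => by rw [hKe, hKe, hpp]
    have e : dotE x (piL K v) = dotE x (X (p u) (p v)) := by
      rw [piL_eq_sum (p := p) K hKp, LinearMap.sum_apply]
      simp only [piC_apply, Finset.sum_sub_distrib]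
      rw [← eq_sum_of_factor (p := p) K hKp v, ← dotEB_apply, map_sub, map_sum,
        Finset.sum_eq_zero, sub_zero, hKe, dotEB_apply, hpV x hx]
      intro i _
      rw [dotEB_apply, dotE_tE, iso _ _ _ hx, ← pairNB_apply, map_zero, LinearMap.zero_apply]
      intro w hw
      rw [dotE_tr, hp0 w hw, ← dotEB_apply, map_zero]
    rw [hΩ, ← hK, LinearMap.sub_apply, LinearMap.smul_apply, ← dotEB_apply, map_sub, map_smul,
      dotEB_apply, dotEB_apply, e, smul_eq_mul]
  have hΩD : ∀ e, IsDer (Ω e) := fun e => by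
    rw [hΩ]; exact (hX _).sub ((isDer_piL hn3 hn _).smul _)
  obtain ⟨XΩ, DΩ, hXΩ, hsΩ, hxXΩ, hT⟩ := exists_of_connection (p := p) hL iso hp0
    (fun e => by rw [hΩ, hΩ, hpp]) hΩD
  obtain ⟨HΩ, hHΩ0, hHΩ, hT⟩ := hT ξ hξ
  have hxX : ∀ x ∈ ann V, ∀ u v, dotE x (X u v) = -dotE x (X v u) := by
    intro x hx u v
    have := hx _ (hD (toN u v))
    rw [← hs, dotE_add_right] at this
    linarith
  have hxe : ∀ x ∈ ann V, ∀ u v, dotE x (XΩ u v) = dotE x (X u v) := by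
    intro x hx u v
    have h0 := hx _ (hV _ (hp u) _ (hp v))
    simp only [map_sub, LinearMap.sub_apply] at h0
    simp only [← dotEB_apply, map_sub] at h0
    simp only [dotEB_apply] at h0
    rw [hxXΩ x hx, hxΩ x hx, hxΩ x hx]
    have h1 := hxX x hx (p v) u
    have h2 := hxX x hx (p v) (p u)
    linarith
  -- The two brackets now agree modulo `V`, so their difference meets the gauge condition.
  have hgauge := hL.gauge (X - XΩ) (D - DΩ)
    (fun u => by
      rw [LinearMap.sub_apply, hXΩ]
      exact (hX u).sub ((hΩD u).sub (isDer_piL hn3 hn _)))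
    (fun x hx u v => by
      rw [LinearMap.sub_apply, LinearMap.sub_apply, ← dotEB_apply, map_sub, dotEB_apply,
        dotEB_apply, hxe x hx, sub_self])
    (fun u v => by simp only [LinearMap.sub_apply, ← hs, ← hsΩ]; abel) ξ hξ ν
  -- `H` and `HΩ` have the same antisymmetric part, so their difference is symmetric and `π` does
  -- not see it.
  have hK : piL (tE.flip ν ∘ₗ (H - HΩ)) = 0 := by
    refine piL_eq_zero_of_symm hL hp0 hp (fun e e' => ?_) (fun v hv => ?_) ν
    · have h1 := hH e e'
      rw [← hxe ξ hξ, hxXΩ ξ hξ, ← hHΩ, ← hHΩ] at h1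
      simp only [LinearMap.sub_apply]
      simp only [← dotEB_apply, map_sub, LinearMap.sub_apply]
      simp only [dotEB_apply]
      linarith
    · rw [LinearMap.sub_apply, hH0 v hv, hHΩ0 v hv, sub_zero]
  rw [LinearMap.comp_sub, map_sub, sub_eq_zero] at hK
  rw [LinearMap.sub_apply, LinearMap.sub_apply, map_sub, hT ν, ← hK] at hgauge
  rw [← sub_eq_zero] at hgauge ⊢
  rw [← hgauge]
  abel

/-! ### Derivatives along vector fields -/

section Derivative

variable {m : ℕ} {M : Type*} [TopologicalSpace M] [ChartedSpace (EuclideanSpace ℝ (Fin m)) M]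
  [IsManifold (𝓡 m) ∞ M] {W : Type*} [NormedAddCommGroup W] [NormedSpace ℝ W]

theorem two_le_infty : (2 : WithTop ℕ∞) ≤ ∞ :=
  WithTop.coe_le_coe.2 le_top

/-- The derivative of a function along a vector field. -/
def dirDeriv (X : (p : M) → TangentSpace (𝓡 m) p) (F : M → W) (p : M) : W :=
  mfderiv (𝓡 m) 𝓘(ℝ, W) F p (X p)

theorem contMDiff_dirDeriv {F : M → W} (hF : ContMDiff (𝓡 m) 𝓘(ℝ, W) ∞ F)
    {X : (p : M) → TangentSpace (𝓡 m) p}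
    (hX : ContMDiff (𝓡 m) (𝓡 m).tangent ∞ (fun p => (⟨p, X p⟩ : TangentBundle (𝓡 m) M))) :
    ContMDiff (𝓡 m) 𝓘(ℝ, W) ∞ (dirDeriv X F) := by
  have : IsManifold (𝓡 m) 1 M := .of_le (n := ∞) (by simp)
  have h1 := (hF.contMDiff_tangentMap (m := ∞) (by simp)).comp hX
  exact (contMDiff_snd_tangentBundle_modelSpace W 𝓘(ℝ, W)).comp h1

/-- The chart derivative is invertible, so pulling the vector field back and pushing it forward
cancel. Directional derivatives may thus be computed in a chart. -/
theorem fderiv_comp_extChartAt_symm (p : M) {F : M → W} (hF : ContMDiff (𝓡 m) 𝓘(ℝ, W) ∞ F)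
    (X : (p : M) → TangentSpace (𝓡 m) p) {y : EuclideanSpace ℝ (Fin m)}
    (hy : y ∈ (extChartAt (𝓡 m) p).target) :
    fderiv ℝ (F ∘ (extChartAt (𝓡 m) p).symm) y (VectorField.mpullbackWithin
      𝓘(ℝ, EuclideanSpace ℝ (Fin m)) (𝓡 m) (extChartAt (𝓡 m) p).symm X (Set.range (𝓡 m)) y)
      = dirDeriv X F ((extChartAt (𝓡 m) p).symm y) := by
  have : IsManifold (𝓡 m) 1 M := .of_le (n := ∞) (by simp)
  have hi := isInvertible_mfderivWithin_extChartAt_symm (I := 𝓡 m) hy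
  have hd := (mdifferentiableWithinAt_extChartAt_symm (I := 𝓡 m) hy)
  rw [ModelWithCorners.range_eq_univ] at hi hd ⊢
  rw [← mfderiv_eq_fderiv, ← mfderivWithin_univ, mfderivWithin_univ (f := F ∘ _),
    mfderiv_comp y (hF.mdifferentiable (by simp) _) (mdifferentiableWithinAt_univ.1 hd)]
  rw [VectorField.mpullbackWithin_apply]
  rw [mfderivWithin_univ] at hi ⊢
  exact congrArg (mfderiv (𝓡 m) 𝓘(ℝ, W) F _) (hi.self_apply_inverse _)

/-- The Lie bracket acts on functions as a commutator. Both sides are transported to a chart, where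
the statement reduces to symmetry of the second derivative. -/
theorem mfderiv_apply_mlieBracket (p : M) {F : M → W} (hF : ContMDiff (𝓡 m) 𝓘(ℝ, W) ∞ F)
    {X Y : (p : M) → TangentSpace (𝓡 m) p}
    (hX : ContMDiff (𝓡 m) (𝓡 m).tangent ∞ (fun p => (⟨p, X p⟩ : TangentBundle (𝓡 m) M)))
    (hY : ContMDiff (𝓡 m) (𝓡 m).tangent ∞ (fun p => (⟨p, Y p⟩ : TangentBundle (𝓡 m) M))) :
    dirDeriv (VectorField.mlieBracket (𝓡 m) X Y) F p =
      dirDeriv X (dirDeriv Y F) p - dirDeriv Y (dirDeriv X F) p := by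
  have : IsManifold (𝓡 m) 1 M := .of_le (n := ∞) (by simp)
  have : IsManifold (𝓡 m) 2 M := .of_le (n := ∞) two_le_infty
  have key : ∀ {X Y : (p : M) → TangentSpace (𝓡 m) p},
      ContMDiff (𝓡 m) (𝓡 m).tangent ∞ (fun p => (⟨p, X p⟩ : TangentBundle (𝓡 m) M)) →
      ContMDiff (𝓡 m) (𝓡 m).tangent ∞ (fun p => (⟨p, Y p⟩ : TangentBundle (𝓡 m) M)) →
      fderiv ℝ (fun y => fderiv ℝ (F ∘ (extChartAt (𝓡 m) p).symm) y (VectorField.mpullbackWithin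
        𝓘(ℝ, EuclideanSpace ℝ (Fin m)) (𝓡 m) (extChartAt (𝓡 m) p).symm Y (Set.range (𝓡 m)) y))
        (extChartAt (𝓡 m) p p) (VectorField.mpullbackWithin 𝓘(ℝ, EuclideanSpace ℝ (Fin m)) (𝓡 m)
          (extChartAt (𝓡 m) p).symm X (Set.range (𝓡 m)) (extChartAt (𝓡 m) p p)) =
      dirDeriv X (dirDeriv Y F) p := by
    intro X Y hX hY
    have h1 : (fun y => fderiv ℝ (F ∘ (extChartAt (𝓡 m) p).symm) y (VectorField.mpullbackWithin
        𝓘(ℝ, EuclideanSpace ℝ (Fin m)) (𝓡 m) (extChartAt (𝓡 m) p).symm Y (Set.range (𝓡 m)) y))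
        =ᶠ[nhds (extChartAt (𝓡 m) p p)] dirDeriv Y F ∘ (extChartAt (𝓡 m) p).symm := by
      filter_upwards [extChartAt_target_mem_nhds (I := 𝓡 m) p] with y hy
      exact fderiv_comp_extChartAt_symm p hF Y hy
    rw [h1.fderiv_eq, fderiv_comp_extChartAt_symm p (contMDiff_dirDeriv hF hY) X
      (mem_extChartAt_target p), extChartAt_to_inv]
  have hdiff : ∀ {X : (p : M) → TangentSpace (𝓡 m) p},
      ContMDiff (𝓡 m) (𝓡 m).tangent ∞ (fun p => (⟨p, X p⟩ : TangentBundle (𝓡 m) M)) →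
      DifferentiableAt ℝ (VectorField.mpullbackWithin 𝓘(ℝ, EuclideanSpace ℝ (Fin m)) (𝓡 m)
        (extChartAt (𝓡 m) p).symm X (Set.range (𝓡 m))) (extChartAt (𝓡 m) p p) := by
    intro X hX
    have h := MDifferentiableWithinAt.differentiableWithinAt_mpullbackWithin_vectorField
      ((hX.mdifferentiable (by simp)).mdifferentiableAt (x := p)).mdifferentiableWithinAt
      (s := Set.univ)
    rw [Set.preimage_univ, Set.univ_inter, ModelWithCorners.range_eq_univ] at h
    rw [ModelWithCorners.range_eq_univ]
    exact differentiableWithinAt_univ.1 h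
  have hFs : ContDiffAt ℝ ∞ (F ∘ (extChartAt (𝓡 m) p).symm) (extChartAt (𝓡 m) p p) := by
    rw [← contMDiffAt_iff_contDiffAt]
    refine hF.contMDiffAt.comp _ ?_
    exact (contMDiffOn_extChartAt_symm p).contMDiffAt (extChartAt_target_mem_nhds p)
  rw [← key hX hY, ← key hY hX, ← VectorField.fderiv_apply_lieBracket hFs (by simpa using two_le_infty) (hdiff hY) (hdiff hX)]
  have hl : ∀ (U V : EuclideanSpace ℝ (Fin m) → EuclideanSpace ℝ (Fin m)) x,
      VectorField.lieBracketWithin ℝ U V Set.univ x = VectorField.lieBracket ℝ U V x :=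
    fun _ _ _ => by rw [VectorField.lieBracketWithin_univ]
  have hi := isInvertible_mfderiv_extChartAt (I := 𝓡 m) (mem_extChartAt_source (I := 𝓡 m) p)
  have hFe : F =ᶠ[nhds p] (F ∘ (extChartAt (𝓡 m) p).symm) ∘ extChartAt (𝓡 m) p := by
    filter_upwards [extChartAt_source_mem_nhds (I := 𝓡 m) p] with q hq
    simp only [Function.comp_apply, (extChartAt (𝓡 m) p).left_inv hq]
  rw [dirDeriv, hFe.mfderiv_eq, mfderiv_comp p (hFs.differentiableAt (by simp)).mdifferentiableAt
    (mdifferentiableAt_extChartAt (mem_chart_source _ p)), ← VectorField.mlieBracketWithin_univ,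
    VectorField.mlieBracketWithin_apply, mfderiv_eq_fderiv]
  simp only [ModelWithCorners.range_eq_univ, Set.preimage_univ, Set.inter_univ]
  exact congrArg (fderiv ℝ _ _) ((hi.self_apply_inverse _).trans
    (hl _ _ _))

end Derivative

/-! ### Calculus of sections -/

section Calculus

variable {m : ℕ} {M : Type*} [TopologicalSpace M] [ChartedSpace (EuclideanSpace ℝ (Fin m)) M]
  {W W₁ W₂ : Type*} [NormedAddCommGroup W] [NormedSpace ℝ W]
  [NormedAddCommGroup W₁] [NormedSpace ℝ W₁] [FiniteDimensional ℝ W₁]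
  [NormedAddCommGroup W₂] [NormedSpace ℝ W₂] [FiniteDimensional ℝ W₂]

theorem Sec.ext {F G : Sec m M W} (h : ∀ p, F p = G p) : F = G := ContMDiffMap.ext h

theorem Sec.add_apply (F G : Sec m M W) (p : M) : (F + G) p = F p + G p := rfl

theorem Sec.sub_apply (F G : Sec m M W) (p : M) : (F - G) p = F p - G p := rfl

theorem Sec.smul_apply (c : ℝ) (F : Sec m M W) (p : M) : (c • F) p = c • F p := rfl

theorem Sec.fsmul_apply (f : Sec m M ℝ) (F : Sec m M W) (p : M) : (f • F) p = f p • F p := rfl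

theorem Sec.sum_apply {ι : Type*} (s : Finset ι) (F : ι → Sec m M W) (p : M) :
    (∑ i ∈ s, F i) p = ∑ i ∈ s, F i p :=
  map_sum (⟨⟨fun F : Sec m M W => F p, rfl⟩, fun _ _ => rfl⟩ : Sec m M W →+ W) F s

theorem constSec_apply (x : W) (p : M) : (constSec x : Sec m M W) p = x := rfl

theorem secToN_apply (u v : Sec m M (E n)) (p : M) : secToN u v p = toN (u p) (v p) := rfl

theorem contDiff_bilin (B : W₁ →ₗ[ℝ] W₂ →ₗ[ℝ] W) : ContDiff ℝ ∞ fun q : W₁ × W₂ => B q.1 q.2 :=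
  B.toContinuousBilinearMap.isBoundedBilinearMap.contDiff

theorem fderiv_bilin (B : W₁ →ₗ[ℝ] W₂ →ₗ[ℝ] W) (q e : W₁ × W₂) :
    fderiv ℝ (fun q : W₁ × W₂ => B q.1 q.2) q e = B e.1 q.2 + B q.1 e.2 := by
  rw [add_comm]
  exact congrArg (fun f => f e) (B.toContinuousBilinearMap.isBoundedBilinearMap.fderiv q)

/-- The section `p ↦ B (F p) (G p)`. -/
def mapSec₂ (B : W₁ →ₗ[ℝ] W₂ →ₗ[ℝ] W) (F : Sec m M W₁) (G : Sec m M W₂) : Sec m M W :=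
  ⟨fun p => B (F p) (G p), ContDiff.comp_contMDiff (g := fun q : W₁ × W₂ => B q.1 q.2)
    (f := fun p => (F p, G p)) (contDiff_bilin B) (F.contMDiff.prodMk_space G.contMDiff)⟩

/-- The section `p ↦ L (F p)`. -/
def mapSec (L : W₁ →ₗ[ℝ] W) (F : Sec m M W₁) : Sec m M W :=
  ⟨fun p => L (F p), ContDiff.comp_contMDiff (g := L) (f := F)
    L.toContinuousLinearMap.contDiff F.contMDiff⟩

theorem mapSec₂_apply (B : W₁ →ₗ[ℝ] W₂ →ₗ[ℝ] W) (F : Sec m M W₁) (G : Sec m M W₂) (p : M) :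
    mapSec₂ B F G p = B (F p) (G p) := rfl

theorem mapSec_apply (L : W₁ →ₗ[ℝ] W) (F : Sec m M W₁) (p : M) : mapSec L F p = L (F p) := rfl

/-- Constant sections generate all sections over the smooth functions, which is the source of every
reduction to constants below. -/
theorem Sec.eq_sum {ι : Type*} [Fintype ι] (b : Module.Basis ι ℝ W₁) (F : Sec m M W₁) :
    F = ∑ i, mapSec (b.coord i) F • constSec (b i) :=
  Sec.ext fun p => by
    rw [Sec.sum_apply]
    exact (b.sum_repr (F p)).symm

variable {p : M} (r : E n →ₗ[ℝ] TangentSpace (𝓡 m) p)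

theorem dHat_apply (F : Sec m M W) (e : E n) :
    dHat r F e = (mfderiv (𝓡 m) 𝓘(ℝ, W) F p (r e) : W) := rfl

theorem dHat_comp {W' : Type*} [NormedAddCommGroup W'] [NormedSpace ℝ W'] {G : W → W'}
    (hG : ContDiff ℝ ∞ G) (F : Sec m M W) (F' : Sec m M W') (h : ∀ q, F' q = G (F q)) (e : E n) :
    dHat r F' e = fderiv ℝ G (F p) (dHat r F e) := by
  have hF : (F' : M → W') = G ∘ F := funext h
  have h1 : MDifferentiableAt 𝓘(ℝ, W) 𝓘(ℝ, W') G (F p) :=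
    (hG.differentiable (by simp) _).mdifferentiableAt
  have h2 := mfderiv_comp p h1 (F.contMDiff.mdifferentiable (by simp) p)
  rw [mfderiv_eq_fderiv] at h2
  rw [dHat_apply, hF, h2]
  rfl

theorem dHat_map (L : W₁ →ₗ[ℝ] W) [FiniteDimensional ℝ W] (F : Sec m M W₁) (e : E n) :
    dHat r (mapSec L F) e = L (dHat r F e) := by
  rw [dHat_comp r (G := L) L.toContinuousLinearMap.contDiff F _ (fun _ => rfl)]
  exact congrArg (fun f => f (dHat r F e)) (L.toContinuousLinearMap.fderiv (x := F p))

theorem dHat_map₂ [FiniteDimensional ℝ W] (B : W₁ →ₗ[ℝ] W₂ →ₗ[ℝ] W) (F : Sec m M W₁)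
    (G : Sec m M W₂) {H : Sec m M W} (hH : ∀ q, H q = B (F q) (G q)) (e : E n) :
    dHat r H e = B (dHat r F e) (G p) + B (F p) (dHat r G e) := by
  let K : Sec m M (W₁ × W₂) := ⟨fun q => (F q, G q), F.contMDiff.prodMk_space G.contMDiff⟩
  have h1 : dHat r F e = (dHat r K e).1 := dHat_map r (LinearMap.fst ℝ W₁ W₂) K e
  have h2 : dHat r G e = (dHat r K e).2 := dHat_map r (LinearMap.snd ℝ W₁ W₂) K e
  rw [dHat_comp r (contDiff_bilin B) K H hH, fderiv_bilin, h1, h2]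
  rfl

theorem dHat_const (x : W) (e : E n) : dHat r (constSec x) e = 0 := by
  rw [dHat_comp r (G := fun _ : W => x) contDiff_const (constSec x) (constSec x) (fun _ => rfl),
    fderiv_fun_const]
  rfl

variable [FiniteDimensional ℝ W]

theorem dHat_fsmul (f : Sec m M ℝ) (F : Sec m M W) (e : E n) :
    dHat r (f • F) e = dHat r f e • F p + f p • dHat r F e :=
  dHat_map₂ r (LinearMap.lsmul ℝ W) f F (fun _ => rfl) e

theorem dHat_secToN (u v : Sec m M (E n)) (e : E n) :
    dHat r (secToN u v) e = toN (dHat r u e) (v p) + toN (u p) (dHat r v e) :=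
  dHat_map₂ r toNB u v (fun _ => rfl) e

theorem dHat_smul (c : ℝ) (F : Sec m M W) (e : E n) : dHat r (c • F) e = c • dHat r F e :=
  dHat_map r (c • (LinearMap.id : W →ₗ[ℝ] W)) F e

theorem dHat_add (F G : Sec m M W) (e : E n) : dHat r (F + G) e = dHat r F e + dHat r G e := by
  let K : Sec m M (W × W) := ⟨fun q => (F q, G q), F.contMDiff.prodMk_space G.contMDiff⟩
  have h1 : dHat r F e = (dHat r K e).1 := dHat_map r (LinearMap.fst ℝ W W) K e
  have h2 : dHat r G e = (dHat r K e).2 := dHat_map r (LinearMap.snd ℝ W W) K e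
  rw [h1, h2]
  exact dHat_map r (LinearMap.fst ℝ W W + LinearMap.snd ℝ W W) K e

theorem dHat_sum {ι : Type*} (s : Finset ι) (F : ι → Sec m M W) (e : E n) :
    dHat r (∑ i ∈ s, F i) e = ∑ i ∈ s, dHat r (F i) e := by
  classical
  induction s using Finset.induction_on with
  | empty =>
    rw [Finset.sum_empty, Finset.sum_empty]
    exact dHat_const r 0 e
  | insert i s hi ih => rw [Finset.sum_insert hi, Finset.sum_insert hi, dHat_add, ih]

/-- The differential of a section in terms of the components of the section. -/
theorem dHat_eq_sum {ι : Type*} [Fintype ι] (b : Module.Basis ι ℝ W) (F : Sec m M W) :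
    dHat r F = ∑ i, (dHat r (mapSec (b.coord i) F)).smulRight (b i) := by
  refine LinearMap.ext fun e => ?_
  conv_lhs => rw [Sec.eq_sum b F]
  rw [dHat_sum, LinearMap.sum_apply]
  refine Finset.sum_congr rfl fun i _ => ?_
  rw [dHat_fsmul, dHat_const, smul_zero, add_zero]
  rfl

end Calculus

/-! ### Derivations along a bundle map -/

section Derivation

variable {m : ℕ} {M : Type*} [TopologicalSpace M] [ChartedSpace (EuclideanSpace ℝ (Fin m)) M]
  [IsManifold (𝓡 m) ∞ M] {W : Type*} [NormedAddCommGroup W] [NormedSpace ℝ W]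

/-- The derivative of a section along the vector field `χ e`. -/
def BundleMap.der (χ : BundleMap n m M) (e : E n) (F : Sec m M W) : Sec m M W :=
  ⟨fun p => dHat (χ.toFun p) F e, contMDiff_dirDeriv F.contMDiff (χ.smooth e)⟩

theorem Action.dHat_bracket {A : Elgebra n} (χ : Action A m M) (u v : E n) (F : Sec m M W) (p : M) :
    dHat (χ.toFun p) F (A.bracket u v) =
      dHat (χ.toFun p) (χ.der v F) u - dHat (χ.toFun p) (χ.der u F) v := by
  have h := mfderiv_apply_mlieBracket p F.contMDiff (χ.smooth u) (χ.smooth v)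
  rw [dHat_apply, χ.map_bracket]
  exact h

/-- The bracket of two vector fields that vanish at a point vanishes there. -/
theorem Action.bracket_mem {A : Elgebra n} (χ : Action A m M) (p : M) {u v : E n}
    (hu : u ∈ χ.stabiliser p) (hv : v ∈ χ.stabiliser p) : A.bracket u v ∈ χ.stabiliser p := by
  rw [Action.stabiliser, LinearMap.mem_ker] at *
  rw [χ.map_bracket, ← VectorField.mlieBracketWithin_univ]
  exact VectorField.mlieBracketWithin_eq_zero_of_eq_zero hu hv

/-- On elements `toN u v` the operator `𝒟` is a symmetrised bracket, which an action sends to zero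
because the Lie bracket is antisymmetric. -/
theorem Action.D_mem (hn3 : 3 ≤ n) (hn : n ≤ 6) {A : Elgebra n} (χ : Action A m M) (p : M)
    (ν : N n) : A.D ν ∈ χ.stabiliser p := by
  have h : χ.toFun p ∘ₗ A.D = 0 := by
    refine eq_zero_of_toN hn3 hn fun u v => ?_
    rw [LinearMap.comp_apply, ← A.symm, map_add, χ.map_bracket, χ.map_bracket,
      VectorField.mlieBracket_swap_apply, neg_add_cancel]
  exact congrArg (fun f => f ν) h

end Derivation

/-! ### The pullback bracket -/

/-- `homToE` in coordinates, as a linear map. -/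
def homL : (E n →ₗ[ℝ] N n) →ₗ[ℝ] E n where
  toFun K := ∑ i, tE (basisE n i) (K (basisE n i))
  map_add' K K' := by simp only [LinearMap.add_apply, map_add, Finset.sum_add_distrib]
  map_smul' c K := by
    simp only [LinearMap.smul_apply, map_smul, Finset.smul_sum, RingHom.id_apply]

theorem homToE_eq (K : E n →ₗ[ℝ] N n) : homToE K = homL K := by
  simp only [homToE, toE_eq, covec_coord]; rfl

theorem homL_smulRight (ξ : Module.Dual ℝ (E n)) (ν : N n) :
    homL (ξ.smulRight ν) = tE (covec ξ) ν := by
  conv_rhs => rw [← sum_coord_smul (covec ξ)]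
  simp only [homL, LinearMap.coe_mk, AddHom.coe_mk, LinearMap.smulRight_apply, map_smul, map_sum,
    LinearMap.sum_apply, LinearMap.smul_apply, ← dotE_basisE_right, dotE_covec]

theorem piL_smulRight_dual (ξ : Module.Dual ℝ (E n)) (u : E n) :
    piL (ξ.smulRight u) = piC (covec ξ) u := by
  rw [← piL_smulRight, dotEB_covec]

theorem piL_apply_eq (B : E n →ₗ[ℝ] E n) (v : E n) : piL B v = B v - homL (toNLeft v ∘ₗ B) := by
  rw [← piMap_eq_piL, piMap, homToE_eq]

theorem piL_eq_sum_basis (B : E n →ₗ[ℝ] E n) (v : E n) :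
    piL B v = ∑ i, piC (basisE n i) (B (basisE n i)) v := by
  rw [← piMap_eq_piL, piMap_eq]

theorem mem_of_ann {V : Submodule ℝ (E n)} {v : E n} (h : ∀ x ∈ ann V, dotE x v = 0) : v ∈ V := by
  rw [← Subspace.dualAnnihilator_dualCoannihilator_eq (W := V), Submodule.mem_dualCoannihilator]
  intro φ hφ
  rw [Submodule.mem_dualAnnihilator] at hφ
  rw [← dotE_covec]
  exact h _ fun w hw => by rw [dotE_covec, hφ w hw]

theorem tE_mem {V : Submodule ℝ (E n)} (iso : ∀ x ∈ ann V, ∀ y ∈ ann V, toN x y = 0) {x : E n}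
    (hx : x ∈ ann V) (ν : N n) : tE x ν ∈ V :=
  mem_of_ann fun y hy => by
    rw [dotE_tE, iso _ hx _ hy, ← pairNB_apply, map_zero, LinearMap.zero_apply]

/-- Adding the Jacobi identities for `u, v, w` and `v, u, w` shows that the symmetrised bracket acts
by zero. -/
theorem Elgebra.bracket_D (hn3 : 3 ≤ n) (hn : n ≤ 6) (A : Elgebra n) (ν : N n) :
    A.bracket (A.D ν) = 0 := by
  have h : A.bracket ∘ₗ A.D = 0 := by
    refine eq_zero_of_toN hn3 hn fun u v => LinearMap.ext fun w => ?_
    rw [LinearMap.comp_apply, ← A.symm, map_add, LinearMap.add_apply, LinearMap.zero_apply]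
    have h1 := A.jacobi u v w
    have h2 := A.jacobi v u w
    refine add_right_cancel (b := A.bracket u (A.bracket v w)) ?_
    rw [zero_add, add_assoc, ← h2, ← h1]
  exact congrArg (fun f => f ν) h

section Calculus

variable {m : ℕ} {M : Type*} [TopologicalSpace M] [ChartedSpace (EuclideanSpace ℝ (Fin m)) M]

theorem dHat_fsmul_eq {W : Type*} [NormedAddCommGroup W] [NormedSpace ℝ W] [FiniteDimensional ℝ W]
    {p : M} (r : E n →ₗ[ℝ] TangentSpace (𝓡 m) p) (f : Sec m M ℝ) (F : Sec m M W) :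
    dHat r (f • F) = (dHat r f).smulRight (F p) + f p • dHat r F :=
  LinearMap.ext fun e => dHat_fsmul r f F e

theorem dHat_const_eq {W : Type*} [NormedAddCommGroup W] [NormedSpace ℝ W]
    [FiniteDimensional ℝ W] {p : M} (r : E n →ₗ[ℝ] TangentSpace (𝓡 m) p) (x : W) :
    dHat r (constSec x) = 0 :=
  LinearMap.ext fun e => dHat_const r x e

end Calculus

section Pullback

variable {m : ℕ} {M : Type*} [TopologicalSpace M] [ChartedSpace (EuclideanSpace ℝ (Fin m)) M]
  [IsManifold (𝓡 m) ∞ M] {A : Elgebra n} (χ : Action A m M)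

theorem sum_coord_apply {W : Type*} [AddCommGroup W] [Module ℝ W] (K : E n →ₗ[ℝ] W) (e : E n) :
    ∑ i, (basisE n).coord i e • K (basisE n i) = K e := by
  conv_rhs => rw [← sum_coord_smul e]
  simp only [map_sum, map_smul]

/-- The section `d̂f` of `E*`, in coordinates. -/
def Action.dSec (f : Sec m M ℝ) : Sec m M (E n) :=
  ∑ i, χ.der (basisE n i) f • constSec (basisE n i)

theorem Action.dSec_apply (f : Sec m M ℝ) (p : M) :
    χ.dSec f p = covec (dHat (χ.toFun p) f) := by
  rw [Action.dSec, Sec.sum_apply]; rfl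

/-- The derivative `ρ(u) f`. -/
def Action.rho (u : Sec m M (E n)) (f : Sec m M ℝ) : Sec m M ℝ := mapSec₂ dotEB (χ.dSec f) u

theorem Action.rho_apply (u : Sec m M (E n)) (f : Sec m M ℝ) (p : M) :
    χ.rho u f p = dHat (χ.toFun p) f (u p) := by
  rw [Action.rho, mapSec₂_apply, dotEB_apply, χ.dSec_apply, dotE_covec]

/-- Identifies the derivative of `d̂f` with the second derivative of `f`. By `Action.dHat_bracket`
its antisymmetric part is `d̂f` evaluated on the bracket of `E`. -/
theorem Action.dotE_dHat_dSec (f : Sec m M ℝ) (p : M) (e e' : E n) :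
    dotE (dHat (χ.toFun p) (χ.dSec f) e) e' = dHat (χ.toFun p) (χ.der e' f) e := by
  have h : χ.der e' f = mapSec (dotEB.flip e') (χ.dSec f) :=
    Sec.ext fun q => by
      rw [mapSec_apply, LinearMap.flip_apply, dotEB_apply, χ.dSec_apply, dotE_covec]; rfl
  rw [h, dHat_map]; rfl

theorem Action.dHat_rho (u : Sec m M (E n)) (f : Sec m M ℝ) (p : M) (e : E n) :
    dHat (χ.toFun p) (χ.rho u f) e = dotE (dHat (χ.toFun p) (χ.dSec f) e) (u p)
      + dHat (χ.toFun p) f (dHat (χ.toFun p) u e) := by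
  rw [dHat_map₂ (χ.toFun p) dotEB (χ.dSec f) u (H := χ.rho u f) (fun _ => rfl), dotEB_apply,
    dotEB_apply, χ.dSec_apply, dotE_covec]

/-- The bracket on sections of the pullback of an elgebra. -/
def Action.br (u v : Sec m M (E n)) : Sec m M (E n) :=
  mapSec₂ A.bracket u v + ∑ i, mapSec ((basisE n).coord i) u • χ.der (basisE n i) v
    - ∑ i, mapSec₂ (piC (basisE n i)) (χ.der (basisE n i) u) v

theorem Action.br_apply (u v : Sec m M (E n)) (p : M) :
    χ.br u v p = A.bracket (u p) (v p) + dHat (χ.toFun p) v (u p)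
      - piL (dHat (χ.toFun p) u) (v p) := by
  rw [← sum_coord_apply (dHat (χ.toFun p) v) (u p), Action.br, Sec.sub_apply, Sec.add_apply,
    Sec.sum_apply, Sec.sum_apply]
  congr 1
  rw [piL_eq_sum_basis]
  rfl

/-- The operator `𝒟` of the pullback of an elgebra. -/
def Action.dd (ν : Sec m M (N n)) : Sec m M (E n) :=
  mapSec A.D ν + ∑ i, mapSec (tE (basisE n i)) (χ.der (basisE n i) ν)

theorem Action.dd_apply (ν : Sec m M (N n)) (p : M) :
    χ.dd ν p = A.D (ν p) + homL (dHat (χ.toFun p) ν) := by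
  rw [Action.dd, Sec.add_apply, Sec.sum_apply]; rfl

theorem Action.br_add_left (u u' v : Sec m M (E n)) : χ.br (u + u') v = χ.br u v + χ.br u' v :=
  Sec.ext fun p => by
    have h : dHat (χ.toFun p) (u + u') = dHat (χ.toFun p) u + dHat (χ.toFun p) u' :=
      LinearMap.ext fun e => dHat_add _ u u' e
    simp only [Sec.add_apply, χ.br_apply, h, map_add, LinearMap.add_apply]
    abel

theorem Action.br_add_right (u v v' : Sec m M (E n)) : χ.br u (v + v') = χ.br u v + χ.br u v' :=
  Sec.ext fun p => by
    simp only [Sec.add_apply, χ.br_apply, dHat_add, map_add]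
    abel

theorem Action.br_smul_left (c : ℝ) (u v : Sec m M (E n)) : χ.br (c • u) v = c • χ.br u v :=
  Sec.ext fun p => by
    have h : dHat (χ.toFun p) (c • u) = c • dHat (χ.toFun p) u :=
      LinearMap.ext fun e => dHat_smul _ c u e
    simp only [Sec.smul_apply, χ.br_apply, h, map_smul, LinearMap.smul_apply, smul_add, smul_sub]

theorem Action.br_smul_right (c : ℝ) (u v : Sec m M (E n)) : χ.br u (c • v) = c • χ.br u v :=
  Sec.ext fun p => by
    simp only [Sec.smul_apply, χ.br_apply, dHat_smul, map_smul, smul_add, smul_sub]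

theorem Action.dd_add (ν ν' : Sec m M (N n)) : χ.dd (ν + ν') = χ.dd ν + χ.dd ν' :=
  Sec.ext fun p => by
    have h : dHat (χ.toFun p) (ν + ν') = dHat (χ.toFun p) ν + dHat (χ.toFun p) ν' :=
      LinearMap.ext fun e => dHat_add _ ν ν' e
    simp only [Sec.add_apply, χ.dd_apply, h, map_add]
    abel

theorem Action.dd_smul (c : ℝ) (ν : Sec m M (N n)) : χ.dd (c • ν) = c • χ.dd ν :=
  Sec.ext fun p => by
    have h : dHat (χ.toFun p) (c • ν) = c • dHat (χ.toFun p) ν :=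
      LinearMap.ext fun e => dHat_smul _ c ν e
    simp only [Sec.smul_apply, χ.dd_apply, h, map_smul, smul_add]

theorem Action.br_fsmul_right (u v : Sec m M (E n)) (f : Sec m M ℝ) :
    χ.br u (f • v) = f • χ.br u v + χ.rho u f • v :=
  Sec.ext fun p => by
    simp only [Sec.add_apply, Sec.fsmul_apply, χ.br_apply, χ.rho_apply, dHat_fsmul, map_smul]
    module

theorem Action.br_fsmul_left (u v : Sec m M (E n)) (f : Sec m M ℝ) (p : M) :
    χ.br (f • u) v p = f p • χ.br u v p - piC (χ.dSec f p) (u p) (v p) := by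
  simp only [Sec.fsmul_apply, χ.br_apply, dHat_fsmul_eq, map_add, map_smul, piL_smulRight_dual,
    χ.dSec_apply, LinearMap.add_apply, LinearMap.smul_apply]
  module

theorem Action.dd_fsmul (ν : Sec m M (N n)) (f : Sec m M ℝ) (p : M) :
    χ.dd (f • ν) p = f p • χ.dd ν p + tE (χ.dSec f p) (ν p) := by
  simp only [Sec.fsmul_apply, χ.dd_apply, dHat_fsmul_eq, map_add, map_smul, homL_smulRight,
    χ.dSec_apply]
  module

theorem Action.br_symm (u v : Sec m M (E n)) : χ.br u v + χ.br v u = χ.dd (secToN u v) :=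
  Sec.ext fun p => by
    have h : dHat (χ.toFun p) (secToN u v) = toNLeft (v p) ∘ₗ dHat (χ.toFun p) u
        + toNLeft (u p) ∘ₗ dHat (χ.toFun p) v := by
      refine LinearMap.ext fun e => ?_
      rw [dHat_secToN, toN_comm (u p)]; rfl
    simp only [Sec.add_apply, χ.br_apply, χ.dd_apply, h, map_add, secToN_apply, ← A.symm,
      piL_apply_eq]
    abel

theorem Action.br_const (u v : E n) :
    χ.br (constSec u) (constSec v) = constSec (A.bracket u v) :=
  Sec.ext fun p => by
    simp only [χ.br_apply, dHat_const_eq, constSec_apply, map_zero, LinearMap.zero_apply,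
      add_zero, sub_zero]

theorem Action.dd_const (ν : N n) : χ.dd (constSec ν) = constSec (A.D ν) :=
  Sec.ext fun p => by
    simp only [χ.dd_apply, dHat_const_eq, constSec_apply, map_zero, add_zero]

theorem Action.dHat_of_mem {W : Type*} [NormedAddCommGroup W] [NormedSpace ℝ W] {p : M} {e : E n}
    (he : e ∈ χ.stabiliser p) (F : Sec m M W) : dHat (χ.toFun p) F e = 0 := by
  rw [Action.stabiliser, LinearMap.mem_ker] at he
  rw [dHat_apply, he, map_zero]
  rfl

theorem Action.covec_dHat_mem (f : Sec m M ℝ) (p : M) :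
    covec (dHat (χ.toFun p) f) ∈ ann (χ.stabiliser p) := fun v hv => by
  rw [dotE_covec, χ.dHat_of_mem hv]

theorem Action.homL_dHat_mem {p : M}
    (iso : ∀ x ∈ ann (χ.stabiliser p), ∀ y ∈ ann (χ.stabiliser p), toN x y = 0)
    (ν : Sec m M (N n)) : homL (dHat (χ.toFun p) ν) ∈ χ.stabiliser p := by
  rw [dHat_eq_sum (χ.toFun p) (Module.finBasis ℝ (N n)) ν, map_sum]
  refine Submodule.sum_mem _ fun a _ => ?_
  rw [homL_smulRight]
  exact tE_mem iso (χ.covec_dHat_mem _ p) _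

/-- The anchor respects brackets. Besides the commutator of derivatives, the formula for the bracket
contributes a term of the form `(d̂ν)_E`, which lies in the stabiliser by isotropy. -/
theorem Action.rho_br {p : M}
    (iso : ∀ x ∈ ann (χ.stabiliser p), ∀ y ∈ ann (χ.stabiliser p), toN x y = 0)
    (u v : Sec m M (E n)) (f : Sec m M ℝ) :
    χ.rho (χ.br u v) f p = χ.rho u (χ.rho v f) p - χ.rho v (χ.rho u f) p := by
  have h : dHat (χ.toFun p) f (homL (toNLeft (v p) ∘ₗ dHat (χ.toFun p) u)) = 0 := by
    have h1 : toNLeft (v p) ∘ₗ dHat (χ.toFun p) u = dHat (χ.toFun p) (mapSec (toNLeft (v p)) u) :=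
      LinearMap.ext fun e => (dHat_map (χ.toFun p) (toNLeft (v p)) u e).symm
    rw [h1]
    exact χ.dHat_of_mem (χ.homL_dHat_mem iso _) f
  simp only [χ.rho_apply, χ.br_apply, χ.dHat_rho, χ.dotE_dHat_dSec, map_add, map_sub,
    χ.dHat_bracket, piL_apply_eq, h]
  ring

/-- It suffices to treat `f` times a constant section of `N`. Every term that differentiates `w`
drops out because `𝒟` has values in the stabiliser, and the rest is the identity `gauge_of_good`. -/
theorem Action.br_dd (hn3 : 3 ≤ n) (hn : n ≤ 6) {p : M}
    (iso : ∀ x ∈ ann (χ.stabiliser p), ∀ y ∈ ann (χ.stabiliser p), toN x y = 0)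
    (good : Good (ann (χ.stabiliser p))) (ν : Sec m M (N n)) (w : Sec m M (E n)) :
    χ.br (χ.dd ν) w p = 0 := by
  have key : ∀ (f : Sec m M ℝ) (ν : N n), χ.br (χ.dd (f • constSec ν)) w p = 0 := by
    intro f ν
    have h1 : χ.dd (f • constSec ν) = f • constSec (A.D ν) + mapSec (tE.flip ν) (χ.dSec f) :=
      Sec.ext fun q => by rw [χ.dd_fsmul, χ.dd_const]; rfl
    have h2 : dHat (χ.toFun p) (mapSec (tE.flip ν) (χ.dSec f))
        = tE.flip ν ∘ₗ dHat (χ.toFun p) (χ.dSec f) :=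
      LinearMap.ext fun e => dHat_map _ _ _ e
    have hξ := χ.covec_dHat_mem f p
    have h3 := gauge_of_good hn3 hn good iso (X := A.bracket) (D := A.D)
      (fun u => (A.preserves u).isDer hn) A.symm (fun u hu v hv => χ.bracket_mem p hu hv)
      (fun ν => χ.D_mem hn3 hn p ν) hξ (H := dHat (χ.toFun p) (χ.dSec f))
      (fun v hv => χ.dHat_of_mem hv _)
      -- The second derivative of `f` fails to be symmetric by the commutator of the two vector
      -- fields, which is the bracket in `E`.
      (fun e e' => by
        rw [χ.dotE_dHat_dSec, χ.dotE_dHat_dSec, dotE_covec, χ.dHat_bracket]) ν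
    rw [h1, χ.br_add_left, Sec.add_apply, χ.br_fsmul_left, χ.br_apply, χ.br_apply, h2,
      dHat_const_eq, constSec_apply, A.bracket_D hn3 hn,
      χ.dHat_of_mem (χ.D_mem hn3 hn p ν) w, mapSec_apply, LinearMap.flip_apply, χ.dSec_apply,
      χ.dHat_of_mem (tE_mem iso hξ ν) w, h3]
    simp only [map_zero, LinearMap.zero_apply, LinearMap.add_apply, add_zero, sub_zero, smul_zero]
    abel
  rw [Sec.eq_sum (Module.finBasis ℝ (N n)) ν]
  have hs : ∀ {ι : Type} (s : Finset ι) (g : ι → Sec m M ℝ) (c : ι → N n),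
      χ.br (χ.dd (∑ i ∈ s, g i • constSec (c i))) w p = 0 := by
    intro ι s g c
    classical
    induction s using Finset.induction_on with
    | empty =>
      rw [Finset.sum_empty, ← zero_smul (Sec m M ℝ) (constSec (0 : N n)), key]
    | insert i s hi ih =>
      rw [Finset.sum_insert hi, χ.dd_add, χ.br_add_left, Sec.add_apply, ih, key, add_zero]
  exact hs _ _ _

end Pullback

/-! ### The Jacobi identity for the pullback bracket -/

section Jacobi

variable {m : ℕ} {M : Type*} [TopologicalSpace M] [ChartedSpace (EuclideanSpace ℝ (Fin m)) M]

theorem Sec.induction_const {W : Type*} [NormedAddCommGroup W] [NormedSpace ℝ W]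
    [FiniteDimensional ℝ W] {P : Sec m M W → Prop} (h0 : P 0)
    (hadd : ∀ F G, P F → P G → P (F + G)) (h : ∀ (f : Sec m M ℝ) (x : W), P (f • constSec x))
    (F : Sec m M W) : P F := by
  rw [Sec.eq_sum (Module.finBasis ℝ W) F]
  exact Finset.sum_induction _ P hadd h0 fun i _ => h _ _

variable [IsManifold (𝓡 m) ∞ M] {A : Elgebra n} (χ : Action A m M)

theorem Action.isDer_br (hn3 : 3 ≤ n) (hn : n ≤ 6) (u : Sec m M (E n)) (p : M) :
    IsDer (A.bracket (u p) - piL (dHat (χ.toFun p) u)) :=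
  ((A.preserves _).isDer hn).sub (isDer_piL hn3 hn _)

theorem Action.br_apply' (u v : Sec m M (E n)) (p : M) :
    χ.br u v p = (A.bracket (u p) - piL (dHat (χ.toFun p) u)) (v p)
      + dHat (χ.toFun p) v (u p) := by
  rw [χ.br_apply, LinearMap.sub_apply]; abel

theorem Action.br_constSec (u : Sec m M (E n)) (c : E n) (p : M) :
    χ.br u (constSec c) p = (A.bracket (u p) - piL (dHat (χ.toFun p) u)) c := by
  rw [χ.br_apply', dHat_const, add_zero, constSec_apply]

/-- The Jacobiator of the pullback bracket. -/
def Action.jac (u v w : Sec m M (E n)) : Sec m M (E n) :=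
  χ.br u (χ.br v w) - (χ.br (χ.br u v) w + χ.br v (χ.br u w))

theorem Action.jac_add_left (u u' v w : Sec m M (E n)) :
    χ.jac (u + u') v w = χ.jac u v w + χ.jac u' v w := by
  simp only [Action.jac, χ.br_add_left, χ.br_add_right]; abel

theorem Action.jac_add_mid (u v v' w : Sec m M (E n)) :
    χ.jac u (v + v') w = χ.jac u v w + χ.jac u v' w := by
  simp only [Action.jac, χ.br_add_left, χ.br_add_right]; abel

theorem Action.jac_add_right (u v w w' : Sec m M (E n)) :
    χ.jac u v (w + w') = χ.jac u v w + χ.jac u v w' := by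
  simp only [Action.jac, χ.br_add_right]; abel

theorem Action.jac_fsmul_right
    (iso : ∀ p, ∀ x ∈ ann (χ.stabiliser p), ∀ y ∈ ann (χ.stabiliser p), toN x y = 0)
    (u v w : Sec m M (E n)) (f : Sec m M ℝ) : χ.jac u v (f • w) = f • χ.jac u v w := by
  have h : χ.rho (χ.br u v) f = χ.rho u (χ.rho v f) - χ.rho v (χ.rho u f) :=
    Sec.ext fun p => χ.rho_br (iso p) u v f
  simp only [Action.jac, χ.br_fsmul_right, χ.br_add_right, h]
  module

/-- The iterated brackets cancel in the symmetrisation, leaving minus the bracket of `𝒟 (u ⊗ v)_N`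
with `w`. -/
theorem Action.jac_symm (hn3 : 3 ≤ n) (hn : n ≤ 6)
    (iso : ∀ p, ∀ x ∈ ann (χ.stabiliser p), ∀ y ∈ ann (χ.stabiliser p), toN x y = 0)
    (good : ∀ p, Good (ann (χ.stabiliser p))) (u v w : Sec m M (E n)) :
    χ.jac u v w + χ.jac v u w = 0 := by
  have h : χ.br (χ.br u v) w + χ.br (χ.br v u) w = 0 := by
    rw [← χ.br_add_left, χ.br_symm]
    exact Sec.ext fun p => χ.br_dd hn3 hn (iso p) (good p) _ w
  simp only [Action.jac]
  rw [← neg_eq_zero, ← h]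
  abel

/-- The rule `d̂(ρ(u) f) = ℒ_u d̂f`, obtained by evaluating the anchor property on constant
sections. The map `B` is the transpose of the vertical part of `[u, ·]`. -/
theorem Action.dSec_rho {p : M}
    (iso : ∀ x ∈ ann (χ.stabiliser p), ∀ y ∈ ann (χ.stabiliser p), toN x y = 0)
    (u : Sec m M (E n)) (f : Sec m M ℝ) {B : E n →ₗ[ℝ] E n}
    (hB : ∀ x e, dotE (B x) e = dotE x ((A.bracket (u p) - piL (dHat (χ.toFun p) u)) e)) :
    χ.dSec (χ.rho u f) p = dHat (χ.toFun p) (χ.dSec f) (u p) - B (χ.dSec f p) := by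
  refine eq_of_dotE fun e => ?_
  have h := χ.rho_br iso u (constSec e) f
  rw [χ.rho_apply, χ.br_constSec, χ.rho_apply, χ.rho_apply, χ.dHat_rho, dHat_const, map_zero,
    add_zero, constSec_apply] at h
  rw [dotE_comm, dotE_comm e, χ.dSec_apply, dotE_covec, ← dotEB_apply, map_sub,
    LinearMap.sub_apply, dotEB_apply, dotEB_apply, hB, χ.dSec_apply, dotE_covec, h]
  ring

/-- A function in the left slot of the bracket produces a term in `π(d̂f ⊗ v)`. Acting on it by `[u,
·]` and distributing the action over `d̂f`, `v` and `w` gives the same result by equivariance, so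
these terms cancel. -/
theorem Action.jac_fsmul_mid (hn3 : 3 ≤ n) (hn : n ≤ 6)
    (iso : ∀ p, ∀ x ∈ ann (χ.stabiliser p), ∀ y ∈ ann (χ.stabiliser p), toN x y = 0)
    (u : Sec m M (E n)) (v w : E n) (f : Sec m M ℝ) :
    χ.jac u (f • constSec v) (constSec w) = f • χ.jac u (constSec v) (constSec w) := by
  refine Sec.ext fun p => ?_
  obtain ⟨B, P, Q, hB⟩ := χ.isDer_br hn3 hn u p
  obtain ⟨Λ, hΛ⟩ : ∃ Λ : E n →ₗ[ℝ] E n, ∀ x, Λ x = piC x v w :=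
    ⟨(LinearMap.applyₗ w) ∘ₗ (piC.flip v), fun _ => rfl⟩
  have h1 : χ.br (f • constSec v) (constSec w) + mapSec Λ (χ.dSec f)
      = f • χ.br (constSec v) (constSec w) :=
    Sec.ext fun q => by
      rw [Sec.add_apply, χ.br_fsmul_left, mapSec_apply, hΛ, constSec_apply, constSec_apply,
        sub_add_cancel]
      rfl
  have h2 := congrArg (fun f => f w) (hB.piC (χ.dSec f p) v)
  have t1 := congrArg (fun F => χ.br u F p) h1
  simp only [χ.br_add_right, χ.br_fsmul_right, Sec.add_apply, Sec.fsmul_apply,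
    χ.br_apply' u (mapSec _ _), dHat_map, mapSec_apply] at t1
  have t2 : χ.br (χ.br u (f • constSec v)) (constSec w) p = _ :=
    congrArg (fun F => χ.br F (constSec w) p) (χ.br_fsmul_right u (constSec v) f)
  simp only [χ.br_add_left, Sec.add_apply, χ.br_fsmul_left, χ.dSec_rho (iso p) u f hB.dotE,
    χ.br_constSec u v p, constSec_apply, map_sub] at t2
  have t3 := χ.br_fsmul_left (constSec v) (χ.br u (constSec w)) f p
  rw [χ.br_constSec u w p, constSec_apply] at t3
  simp only [LinearMap.sub_apply, LinearMap.comp_apply, ← hΛ] at h2 t1 t2 t3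
  rw [← eq_sub_iff_add_eq] at t1
  simp only [Action.jac, Sec.sub_apply, Sec.add_apply, Sec.fsmul_apply, t2, t3]
  rw [t1, smul_sub, smul_add, eq_add_of_sub_eq h2]
  abel

/-- Vanishing spreads from constants to a general middle argument, then by antisymmetry to the first
slot, then to the middle slot again. The last argument is freed at the end. -/
theorem Action.jac_eq_zero (hn3 : 3 ≤ n) (hn : n ≤ 6)
    (iso : ∀ p, ∀ x ∈ ann (χ.stabiliser p), ∀ y ∈ ann (χ.stabiliser p), toN x y = 0)
    (good : ∀ p, Good (ann (χ.stabiliser p))) (u v w : Sec m M (E n)) : χ.jac u v w = 0 := by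
  have zero_left : ∀ v w, χ.jac 0 v w = 0 := fun v w => by
    simpa using χ.jac_add_left 0 0 v w
  have zero_mid : ∀ u w, χ.jac u 0 w = 0 := fun u w => by
    simpa using χ.jac_add_mid u 0 0 w
  have zero_right : ∀ u v, χ.jac u v 0 = 0 := fun u v => by
    simpa using χ.jac_add_right u v 0 0
  have h0 : ∀ u v w : E n, χ.jac (constSec u) (constSec v) (constSec w) = 0 := by
    intro u v w
    simp only [Action.jac, χ.br_const]
    refine Sec.ext fun p => ?_
    simp only [Sec.sub_apply, Sec.add_apply, constSec_apply]
    rw [A.jacobi, sub_self]; rfl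
  have anti : ∀ u v w, χ.jac u v w = 0 → χ.jac v u w = 0 := by
    intro u v w h
    have := χ.jac_symm hn3 hn iso good u v w
    rwa [h, zero_add] at this
  have h1 : ∀ (u : E n) (v : Sec m M (E n)) (w : E n),
      χ.jac (constSec u) v (constSec w) = 0 := by
    intro u v w
    refine Sec.induction_const (P := fun v => χ.jac (constSec u) v (constSec w) = 0)
      (zero_mid _ _) (fun v v' h h' => ?_) (fun f x => ?_) v
    · rw [χ.jac_add_mid, h, h', add_zero]
    · rw [χ.jac_fsmul_mid hn3 hn iso, h0, smul_zero]
  have h2 : ∀ (u v : Sec m M (E n)) (w : E n), χ.jac u v (constSec w) = 0 := by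
    intro u v w
    refine Sec.induction_const (P := fun v => χ.jac u v (constSec w) = 0)
      (zero_mid _ _) (fun v v' h h' => ?_) (fun f x => ?_) v
    · rw [χ.jac_add_mid, h, h', add_zero]
    · rw [χ.jac_fsmul_mid hn3 hn iso, anti _ _ _ (h1 x u w), smul_zero]
  refine Sec.induction_const (P := fun w => χ.jac u v w = 0)
    (zero_right _ _) (fun w w' h h' => ?_) (fun f x => ?_) w
  · rw [χ.jac_add_right, h, h', add_zero]
  · rw [χ.jac_fsmul_right iso, h2, smul_zero]

/-- The pullback of an elgebra along an action with good stabilisers. -/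
def Action.pullback (hn3 : 3 ≤ n) (hn : n ≤ 6)
    (iso : ∀ p, ∀ x ∈ ann (χ.stabiliser p), ∀ y ∈ ann (χ.stabiliser p), toN x y = 0)
    (good : ∀ p, Good (ann (χ.stabiliser p))) : Elgebroid n m M where
  bracket := LinearMap.mk₂ ℝ χ.br χ.br_add_left χ.br_smul_left χ.br_add_right χ.br_smul_right
  anchor := χ.toBundleMap
  D := ⟨⟨χ.dd, χ.dd_add⟩, χ.dd_smul⟩
  jacobi u v w := sub_eq_zero.1 (χ.jac_eq_zero hn3 hn iso good u v w)
  leibniz u v f p := by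
    have h := congrArg (fun F : Sec m M (E n) => F p) (χ.br_fsmul_right u v f)
    simp only [Sec.add_apply, Sec.fsmul_apply, χ.rho_apply] at h
    exact h
  symm := χ.br_symm
  leibniz_D ν f p := by
    rw [toE_eq, ← χ.dSec_apply]
    exact χ.dd_fsmul ν f p
  preserves u p := by
    have h := (χ.isDer_br hn3 hn u p).inG (by omega) hn
    have h2 : (fun v => χ.br u (constSec v) p)
        = ⇑(A.bracket (u p) - piL (dHat (χ.toFun p) u)) := funext fun v => χ.br_constSec u v p
    rw [← h2] at h
    exact h

theorem Action.pullback_isPullback (hn3 : 3 ≤ n) (hn : n ≤ 6)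
    (iso : ∀ p, ∀ x ∈ ann (χ.stabiliser p), ∀ y ∈ ann (χ.stabiliser p), toN x y = 0)
    (good : ∀ p, Good (ann (χ.stabiliser p))) : (χ.pullback hn3 hn iso good).IsPullback A :=
  ⟨χ.br_const, χ.dd_const⟩

end Jacobi

/-! ### Exactness and uniqueness -/

theorem toNStar_eq (ξ η : Module.Dual ℝ (E n)) (ν : N n) : toNStar ξ η ν = η (toE ξ ν) := by
  rw [toNStar, ← dotE_tE, dotE_covec, toE_eq]

theorem IsCoisotropic.toN_eq_zero {V : Submodule ℝ (E n)} (h : IsCoisotropic V) :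
    ∀ x ∈ ann V, ∀ y ∈ ann V, toN x y = 0 := by
  intro x hx y hy
  have key := h (dotEB x) ((Submodule.mem_dualAnnihilator _).2 hx) (dotEB y)
    ((Submodule.mem_dualAnnihilator _).2 hy) (toN x y)
  rw [toNStar, covec_dotEB, covec_dotEB] at key
  exact pairN_self_pos key

section Theorem

variable {m : ℕ} {M : Type*} [TopologicalSpace M] [ChartedSpace (EuclideanSpace ℝ (Fin m)) M]
  [IsManifold (𝓡 m) ∞ M] {A : Elgebra n} (χ : Action A m M)

theorem exists_lift_of_mem_dualAnnihilator {T : Type*} [AddCommGroup T] [Module ℝ T]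
    {r : E n →ₗ[ℝ] T} (hr : Function.Surjective r) {ξ : Module.Dual ℝ (E n)}
    (hξ : ξ ∈ (LinearMap.ker r).dualAnnihilator) : ∃ α : T →ₗ[ℝ] ℝ, ξ = α ∘ₗ r := by
  obtain ⟨s, hs⟩ := LinearMap.exists_rightInverse_of_surjective r (LinearMap.range_eq_top.2 hr)
  refine ⟨ξ ∘ₗ s, LinearMap.ext fun e => ?_⟩
  rw [Submodule.mem_dualAnnihilator] at hξ
  have h := hξ (e - s (r e)) (by
    rw [LinearMap.mem_ker, map_sub, sub_eq_zero]
    exact (congrArg (fun f => f (r e)) hs).symm)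
  rwa [map_sub, sub_eq_zero] at h

/-- Exactness makes `V` equal to the span of `toE (V° ⊗ N)`. Containment in `V` is coisotropy. A
smaller coisotropic subspace has a larger annihilator, so it contains this span too. -/
theorem Elgebroid.IsMExact.isCoLagrangian {P : Elgebroid n m M} (h : P.IsMExact) (p : M) :
    IsCoLagrangian (LinearMap.ker (P.anchor.toFun p)) := by
  obtain ⟨hs, he⟩ := h.2 p
  have hmem : ∀ ξ ∈ (LinearMap.ker (P.anchor.toFun p)).dualAnnihilator, ∀ ν,
      toE ξ ν ∈ LinearMap.ker (P.anchor.toFun p) := by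
    intro ξ hξ ν
    obtain ⟨α, rfl⟩ := exists_lift_of_mem_dualAnnihilator hs hξ
    rw [← he]
    exact Submodule.subset_span ⟨α, ν, rfl⟩
  refine ⟨fun ξ hξ η hη ν => ?_, fun W hW hWV => ?_⟩
  · rw [toNStar_eq]
    exact (Submodule.mem_dualAnnihilator _).1 hη _ (hmem ξ hξ ν)
  · rw [← he, Submodule.span_le]
    rintro _ ⟨α, ν, rfl⟩
    rw [SetLike.mem_coe, ← Subspace.dualAnnihilator_dualCoannihilator_eq (W := W),
      Submodule.mem_dualCoannihilator]
    intro η hη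
    rw [← toNStar_eq]
    refine hW _ (Submodule.dualAnnihilator_anti hWV ?_) _ hη ν
    rw [Submodule.mem_dualAnnihilator]
    intro w hw
    rw [LinearMap.comp_apply, LinearMap.mem_ker.1 hw, map_zero]

theorem Action.finrank_quotient_stabiliser (hχ : χ.IsTransitive) (p : M) :
    Module.finrank ℝ (E n ⧸ χ.stabiliser p) = m := by
  rw [Action.stabiliser, ((χ.toFun p).quotKerEquivOfSurjective (hχ p)).finrank_eq]
  exact finrank_euclideanSpace_fin

/-- One inclusion is isotropy of the annihilator and the other is `Good.span`. Surjectivity lets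
each covector that annihilates the stabiliser be lifted to the tangent space. -/
theorem Action.pullback_isMExact (hn3 : 3 ≤ n) (hn : n ≤ 6)
    (iso : ∀ p, ∀ x ∈ ann (χ.stabiliser p), ∀ y ∈ ann (χ.stabiliser p), toN x y = 0)
    (good : ∀ p, Good (ann (χ.stabiliser p))) (hχ : χ.IsTransitive) (hm : m = n) :
    (χ.pullback hn3 hn iso good).IsMExact := by
  refine ⟨hm, fun p => ⟨hχ p, le_antisymm (Submodule.span_le.2 ?_) fun v hv => ?_⟩⟩
  · rintro _ ⟨α, ν, rfl⟩
    rw [toE_eq]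
    refine tE_mem (iso p) (fun w hw => ?_) ν
    rw [dotE_covec]
    exact (congrArg α (LinearMap.mem_ker.1 hw)).trans (map_zero α)
  · refine Submodule.span_mono ?_ ((good p).span v fun x hx => hx v hv)
    rintro _ ⟨x, hx, ν, rfl⟩
    obtain ⟨α, hα⟩ := exists_lift_of_mem_dualAnnihilator (hχ p) (ξ := dotEB x)
      ((Submodule.mem_dualAnnihilator _).2 hx)
    refine ⟨α, ν, ?_⟩
    rw [toE_eq]
    exact (congrArg (fun y => tE y ν) ((congrArg covec hα).symm.trans (covec_dotEB x))).symm

theorem Elgebroid.D_eq {P : Elgebroid n m M} (hP : P.IsPullback A) (ν : Sec m M (N n)) (p : M) :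
    P.D ν p = A.D (ν p) + homToE (dHat (P.anchor.toFun p) ν) := by
  have h : ∀ ν : Sec m M (N n), P.D ν p = A.D (ν p) + homL (dHat (P.anchor.toFun p) ν) := by
    intro ν
    refine Sec.induction_const
      (P := fun ν => P.D ν p = A.D (ν p) + homL (dHat (P.anchor.toFun p) ν)) ?_
      (fun F G hF hG => ?_) (fun f x => ?_) ν
    · have : dHat (P.anchor.toFun p) (0 : Sec m M (N n)) = 0 := dHat_const_eq _ 0
      rw [this, map_zero, map_zero, add_zero]
      exact (map_zero A.D).symm
    · have : dHat (P.anchor.toFun p) (F + G) = dHat (P.anchor.toFun p) F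
          + dHat (P.anchor.toFun p) G := LinearMap.ext fun e => dHat_add _ F G e
      rw [map_add, Sec.add_apply, Sec.add_apply, hF, hG, this, map_add, map_add]
      abel
    · rw [P.leibniz_D, hP.2, dHat_fsmul_eq, dHat_const_eq, smul_zero, add_zero, homL_smulRight,
        Sec.fsmul_apply, map_smul, toE_eq]
      rfl
  rw [homToE_eq, h]

theorem Elgebroid.bracket_const {P : Elgebroid n m M} (hP : P.IsPullback A) (u : E n)
    (v : Sec m M (E n)) (p : M) :
    P.bracket (constSec u) v p = A.bracket u (v p) + dHat (P.anchor.toFun p) v u := by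
  refine Sec.induction_const (P := fun v => P.bracket (constSec u) v p
    = A.bracket u (v p) + dHat (P.anchor.toFun p) v u) ?_ (fun F G hF hG => ?_) (fun f x => ?_) v
  · have : dHat (P.anchor.toFun p) (0 : Sec m M (E n)) u = 0 := dHat_const _ 0 u
    rw [this, map_zero, add_zero]
    exact (map_zero (A.bracket u)).symm
  · rw [map_add, Sec.add_apply, Sec.add_apply, hF, hG, dHat_add, map_add]
    abel
  · rw [P.leibniz, hP.1, dHat_fsmul, dHat_const, smul_zero, add_zero, Sec.fsmul_apply, map_smul]
    rfl

/-- With a constant right argument the bracket is exchanged for one with a constant left argument,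
at the cost of `𝒟` of the symmetric product. Both are already known, and the resulting correction is
exactly `π(d̂u)`. -/
theorem Elgebroid.bracket_eq {P : Elgebroid n m M} (hP : P.IsPullback A) (u v : Sec m M (E n))
    (p : M) : P.bracket u v p = A.bracket (u p) (v p) + dHat (P.anchor.toFun p) v (u p)
      - piMap (dHat (P.anchor.toFun p) u) (v p) := by
  have h : ∀ x : E n, P.bracket u (constSec x) p = A.bracket (u p) x
      - piL (dHat (P.anchor.toFun p) u) x := by
    intro x
    have h1 := congrArg (fun F : Sec m M (E n) => F p) (P.symm u (constSec x))
    have h2 : dHat (P.anchor.toFun p) (secToN u (constSec x))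
        = toNLeft x ∘ₗ dHat (P.anchor.toFun p) u := by
      refine LinearMap.ext fun e => ?_
      rw [dHat_secToN, dHat_const, toN_zero_right, add_zero]
      rfl
    simp only [Sec.add_apply] at h1
    rw [bracket_const hP, D_eq hP, h2, secToN_apply, constSec_apply, ← A.symm, homToE_eq,
      ← eq_sub_iff_add_eq] at h1
    rw [h1, piL_apply_eq]
    abel
  rw [piMap_eq_piL]
  refine Sec.induction_const (P := fun v => P.bracket u v p = A.bracket (u p) (v p)
    + dHat (P.anchor.toFun p) v (u p) - piL (dHat (P.anchor.toFun p) u) (v p)) ?_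
    (fun F G hF hG => ?_) (fun f x => ?_) v
  · have : dHat (P.anchor.toFun p) (0 : Sec m M (E n)) (u p) = 0 := dHat_const _ 0 _
    have h0 : (0 : Sec m M (E n)) p = 0 := rfl
    rw [this, map_zero, h0, map_zero, map_zero, add_zero, sub_zero]
  · rw [map_add, Sec.add_apply, Sec.add_apply, hF, hG, dHat_add, map_add, map_add]
    abel
  · rw [P.leibniz, h, dHat_fsmul, dHat_const, smul_zero, add_zero, Sec.fsmul_apply, map_smul,
      map_smul, constSec_apply]
    module

end Theorem

end Elg

end

theorem mainTheorem2 (n : ℕ) (hn3 : 3 ≤ n) (hn6 : n ≤ 6) (A : Elg.Elgebra n)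
    (M : Type*) [TopologicalSpace M] [T2Space M] [SecondCountableTopology M]
    [ChartedSpace (EuclideanSpace ℝ (Fin n)) M] [IsManifold (𝓡 n) ∞ M]
    (χ : Elg.Action A n M) (hχ : χ.IsTransitive) :
    ((∃ P : Elg.Elgebroid n n M, P.anchor = χ.toBundleMap ∧ P.IsPullback A ∧ P.IsMExact) ↔
      ∀ p : M, Elg.IsCoLagrangian (χ.stabiliser p) ∧
        Module.finrank ℝ (Elg.E n ⧸ χ.stabiliser p) = n) ∧
    ∀ P : Elg.Elgebroid n n M, P.anchor = χ.toBundleMap → P.IsPullback A →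
      (∀ (u v : Elg.Sec n M (Elg.E n)) (p : M),
        P.bracket u v p = A.bracket (u p) (v p) + Elg.dHat (χ.toFun p) v (u p)
          - Elg.piMap (Elg.dHat (χ.toFun p) u) (v p)) ∧
      (∀ (ν : Elg.Sec n M (Elg.N n)) (p : M),
        P.D ν p = A.D (ν p) + Elg.homToE (Elg.dHat (χ.toFun p) ν)) := by
  refine ⟨⟨fun ⟨P, hP, _, hE⟩ p => ⟨?_, χ.finrank_quotient_stabiliser hχ p⟩, fun h => ?_⟩,
    fun P hP hpb => ⟨fun u v p => ?_, fun ν p => ?_⟩⟩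
  · have := hE.isCoLagrangian p
    rwa [hP] at this
  · have iso := fun p => (h p).1.prop.toN_eq_zero
    have good : ∀ p, Elg.Good (Elg.ann (χ.stabiliser p)) := fun p =>
      Elg.good_of_isotropic hn3 hn6 (iso p) ((Elg.finrank_ann _).trans (h p).2)
    exact ⟨χ.pullback hn3 hn6 iso good, rfl, χ.pullback_isPullback hn3 hn6 iso good,
      χ.pullback_isMExact hn3 hn6 iso good hχ rfl⟩
  · rw [Elg.Elgebroid.bracket_eq hpb, hP]
  · rw [Elg.Elgebroid.D_eq hpb, hP]
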